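/- Let $F$ be a finite field with $q$ elements. The subspace transporter problem is: given $n\ge k\ge 0$, matrices $g_1,\dots,g_m\in \mathrm{GL}(n,q)$ generating a group $G$, and two $k$-dimensional subspaces $V,W\le \mathbb F_q^n$ (each given by a basis), compute the set $G_{V\to W}=\{g\in G : g(V)=W\}$. That is, either report that it is empty, or output an element $g_0$ and a list of generators of a subgroup $H\le \mathrm{GL}(n,q)$ such that $G_{V\to W}=g_0H$. The field is given by the addition and multiplication tables of its elements, numbered $0,\dots,q-1$ in any way. Theorem 7.2. There is a deterministic algorithm (a program of a random access machine with logarithmic cost, the same for all $q,n,k,m$) and a constant $C$ such that on every instance the algorithm solves the subspace transporter problem in time at most $$C\cdot\bigl(q^{\frac14k^2+Cn}+m^{C}\bigr).$$ In particular, the time is $q^{\frac14k^2+O(n)}$ when $n\ge 1$ and the number of generators is $m\le q^{O(n)}$. -/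

import Mathlib

/-! Part 1. The machine model: a random access machine with the logarithmic cost criterion,
programmed in a structured language. A machine has finitely many named registers (those which the
program mentions), an unbounded memory of natural numbers, and an output stream which can only be
appended to. Every operation is charged according to the bit lengths of the numbers it handles,
so that packing much data into one number gains nothing. -/

namespace Ram

/-- The elementary operations on natural numbers. -/
inductive Op where
  | add | sub | mul | div | mod | lt | eq

/-- Subtraction is truncated, division and remainder are those of `ℕ` (with `a / 0 = 0` and
`a % 0 = a`), and comparisons return `1` for true and `0` for false. -/
def Op.eval : Op → ℕ → ℕ → ℕ
  | .add, a, b => a + b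
  | .sub, a, b => a - b
  | .mul, a, b => a * b
  | .div, a, b => a / b
  | .mod, a, b => a % b
  | .lt, a, b => if a < b then 1 else 0
  | .eq, a, b => if a = b then 1 else 0

/-- The charge for handling the number `a`: one more than its bit length. -/
def charge (a : ℕ) : ℕ := Nat.size a + 1

/-- A machine state: registers, memory, and the output written so far. -/
structure State where
  reg : ℕ → ℕ
  mem : ℕ → ℕ
  out : List ℕ

/-- Expressions: literals, registers, memory cells at a computed address, and operations. -/
inductive Expr where
  | lit (a : ℕ)
  | reg (x : ℕ)
  | load (e : Expr)
  | op (o : Op) (e₁ e₂ : Expr)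

/-- The value of an expression. -/
def Expr.eval (s : State) : Expr → ℕ
  | .lit a => a
  | .reg x => s.reg x
  | .load e => s.mem (e.eval s)
  | .op o e₁ e₂ => o.eval (e₁.eval s) (e₂.eval s)

/-- The time for evaluating an expression. An operation is charged the product of the charges of
its operands (the cost of schoolbook arithmetic on binary numbers); a memory access is charged for
the address and for the contents. -/
def Expr.cost (s : State) : Expr → ℕ
  | .lit a => charge a
  | .reg x => charge (s.reg x)
  | .load e => e.cost s + charge (e.eval s) + charge (s.mem (e.eval s))
  | .op _ e₁ e₂ => e₁.cost s + e₂.cost s + charge (e₁.eval s) * charge (e₂.eval s)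

/-- Programs. -/
inductive Prog where
  /-- do nothing -/
  | skip
  /-- put the value of `e` into register `x` -/
  | assign (x : ℕ) (e : Expr)
  /-- put the value of `e` into the memory cell whose address is the value of `a` -/
  | store (a e : Expr)
  /-- append the value of `e` to the output -/
  | emit (e : Expr)
  /-- first `p`, then `p'` -/
  | seq (p p' : Prog)
  /-- `p` if the value of `e` is not zero, otherwise `p'` -/
  | branch (e : Expr) (p p' : Prog)
  /-- repeat `p` as long as the value of `e` is not zero -/
  | loop (e : Expr) (p : Prog)

/-- `Exec p s s' t`: the program `p`, started in the state `s`, halts in the state `s'` after time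
exactly `t`. -/
inductive Exec : Prog → State → State → ℕ → Prop
  | skip (s : State) : Exec .skip s s 1
  | assign (s : State) (x : ℕ) (e : Expr) :
      Exec (.assign x e) s { s with reg := Function.update s.reg x (e.eval s) }
        (e.cost s + charge (e.eval s))
  | store (s : State) (a e : Expr) :
      Exec (.store a e) s { s with mem := Function.update s.mem (a.eval s) (e.eval s) }
        (a.cost s + e.cost s + charge (a.eval s) + charge (e.eval s))
  | emit (s : State) (e : Expr) :
      Exec (.emit e) s { s with out := s.out ++ [e.eval s] } (e.cost s + charge (e.eval s))
  | seq {p p' : Prog} {s s' s'' : State} {t t' : ℕ} :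
      Exec p s s' t → Exec p' s' s'' t' → Exec (.seq p p') s s'' (t + t')
  | branch_true {e : Expr} {p p' : Prog} {s s' : State} {t : ℕ} :
      e.eval s ≠ 0 → Exec p s s' t → Exec (.branch e p p') s s' (e.cost s + 1 + t)
  | branch_false {e : Expr} {p p' : Prog} {s s' : State} {t : ℕ} :
      e.eval s = 0 → Exec p' s s' t → Exec (.branch e p p') s s' (e.cost s + 1 + t)
  | loop_true {e : Expr} {p : Prog} {s s' s'' : State} {t t' : ℕ} :
      e.eval s ≠ 0 → Exec p s s' t → Exec (.loop e p) s' s'' t' →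
        Exec (.loop e p) s s'' (e.cost s + 1 + t + t')
  | loop_false {e : Expr} {p : Prog} {s : State} :
      e.eval s = 0 → Exec (.loop e p) s s (e.cost s + 1)

/-- The machine is deterministic: final state and running time are determined by program and
initial state. -/
theorem Exec.deterministic {p : Prog} {s s₁ s₂ : State} {t₁ t₂ : ℕ}
    (h₁ : Exec p s s₁ t₁) (h₂ : Exec p s s₂ t₂) : s₁ = s₂ ∧ t₁ = t₂ := by
  induction h₁ generalizing s₂ t₂ with
  | skip => cases h₂; exact ⟨rfl, rfl⟩
  | assign => cases h₂; exact ⟨rfl, rfl⟩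
  | store => cases h₂; exact ⟨rfl, rfl⟩
  | emit => cases h₂; exact ⟨rfl, rfl⟩
  | seq _ _ ih ih' =>
    cases h₂ with
    | seq h h' =>
      obtain ⟨rfl, rfl⟩ := ih h
      obtain ⟨rfl, rfl⟩ := ih' h'
      exact ⟨rfl, rfl⟩
  | branch_true he _ ih =>
    cases h₂ with
    | branch_true _ h => obtain ⟨rfl, rfl⟩ := ih h; exact ⟨rfl, rfl⟩
    | branch_false he' _ => exact absurd he' he
  | branch_false he _ ih =>
    cases h₂ with
    | branch_true he' _ => exact absurd he he'
    | branch_false _ h => obtain ⟨rfl, rfl⟩ := ih h; exact ⟨rfl, rfl⟩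
  | loop_true he _ _ ih ih' =>
    cases h₂ with
    | loop_true _ h h' =>
      obtain ⟨rfl, rfl⟩ := ih h
      obtain ⟨rfl, rfl⟩ := ih' h'
      exact ⟨rfl, rfl⟩
    | loop_false he' => exact absurd he' he
  | loop_false he =>
    cases h₂ with
    | loop_true he' _ _ => exact absurd he he'
    | loop_false _ => exact ⟨rfl, rfl⟩

/-- The initial state on an input word: the word occupies the memory cells `0, 1, 2, …`, all other
memory cells and all registers are `0`, and the output is empty. -/
def State.init (input : List ℕ) : State where
  reg := fun _ => 0
  mem := fun i => input.getD i 0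
  out := []

/-- On the input word `input`, the program `p` halts with output `output` after time `t`. -/
def HaltsWith (p : Prog) (input output : List ℕ) (t : ℕ) : Prop :=
  ∃ s' : State, Exec p (State.init input) s' t ∧ s'.out = output

end Ram

/-! Part 2. The problem. A field with `q` elements is presented to the machine by numbering its
elements `0, …, q - 1` in an arbitrary way and listing its addition and multiplication tables. -/

namespace SubspTrans

open Matrix

/-- The transporter `{g ∈ G : g(V) = W}`. -/
def transporter {F : Type} [Field F] {n : ℕ} (G : Subgroup (GL (Fin n) F))
    (V W : Submodule F (Fin n → F)) : Set (GL (Fin n) F) :=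
  {g | g ∈ G ∧ V.map (Matrix.mulVecLin (g : Matrix (Fin n) (Fin n) F)) = W}

/-- The word of a matrix: its entries row by row. -/
def encMatrix {F : Type} {q m n : ℕ} (code : F ≃ Fin q) (A : Matrix (Fin m) (Fin n) F) : List ℕ :=
  (List.ofFn fun i => List.ofFn fun j => (code (A i j) : ℕ)).flatten

/-- The word of the `q × q` table of a binary operation on `F`, row by row. -/
def encTable {F : Type} {q : ℕ} (code : F ≃ Fin q) (f : F → F → F) : List ℕ :=
  encMatrix code (Matrix.of fun i j : Fin q => f (code.symm i) (code.symm j))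

/-- The word of a finite sequence of invertible matrices. -/
def encGens {F : Type} [Field F] {q n m : ℕ} (code : F ≃ Fin q) (g : Fin m → GL (Fin n) F) :
    List ℕ :=
  (List.ofFn fun i => encMatrix code (g i : Matrix (Fin n) (Fin n) F)).flatten

/-- The input word of an instance: the numbers `n, k, m, q`, the tables of the field, the `m`
generators, the `k` vectors of the basis of `V`, the `k` vectors of the basis of `W`. -/
noncomputable def encInput {F : Type} [Field F] {q n k m : ℕ} (code : F ≃ Fin q)
    (gens : Fin m → GL (Fin n) F) {V W : Submodule F (Fin n → F)}
    (bV : Module.Basis (Fin k) F V) (bW : Module.Basis (Fin k) F W) : List ℕ :=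
  [n, k, m, q] ++ encTable code (· + ·) ++ encTable code (· * ·) ++ encGens code gens
    ++ encMatrix code (Matrix.of fun i => (bV i : Fin n → F))
    ++ encMatrix code (Matrix.of fun i => (bW i : Fin n → F))

/-- `output` describes the set `S` of matrices as a coset: it is either the word `0`, and `S` is
empty, or the word that consists of `1`, a number `r`, an element `g`, and `r` generators of a
group `H` with `S = g H`. -/
def DescribesCoset {F : Type} [Field F] {q n : ℕ} (code : F ≃ Fin q) (S : Set (GL (Fin n) F))
    (output : List ℕ) : Prop :=
  (S = ∅ ∧ output = [0]) ∨
    ∃ (g : GL (Fin n) F) (r : ℕ) (h : Fin r → GL (Fin n) F),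
      S = {x | ∃ y ∈ Subgroup.closure (Set.range h), x = g * y} ∧
        output = [1, r] ++ encMatrix code (g : Matrix (Fin n) (Fin n) F) ++ encGens code h

end SubspTrans

/-! Let `A` be the given group and let `V_j = flag x j` be the span of the first `j` basis vectors
`x_0, x_1, …` of `V`. The algorithm climbs from `j = 0` to `j = k`. On level `j` it holds generators
of the setwise stabilizer of `V_j` in `A`, and the list of all images of `V_j` under `A` that are
contained in `V` or in `W`, each with one matrix of `A` that carries `V_j` to it. On level `k` the
transporter is nonempty exactly when `W` is on the list, and it is then the coset of the recorded
matrix by the stabilizer of `V`.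

The passage to the next level rests on one observation. If `g V_{j+1}` lies in `V` or in `W`, then
so does `U = g V_j`; hence `U` is listed, with a matrix `f`, and `f⁻¹ g` stabilizes `V_j`. So `f⁻¹ g
x_j` lies in the orbit of the vector `x_j` under the stabilizer of `V_j`. Conversely, if `U` is
listed with `f`, `z` is not in `U`, and `f⁻¹ z = t x_j` with `t` in that stabilizer, then `f t`
carries `V_{j+1}` to `U + F z`. Running through the pairs `(U, z)` therefore yields the complete
next list, and the matrices `f t` with `U + F z = V_{j+1}`, together with the stabilizer of the
vector `x_j` in the old group, generate the new stabilizer (`extendS_spec`). Orbits of vectors have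
at most `q ^ n` points and are computed by closure (`orbitS_spec`); the vector stabilizer comes from
Schreier's lemma (`mem_of_schreier`, `schreierS_spec`). Generating sets never exceed `q ^ (2 * n)`
matrices, because every new generator is sifted through a filter in the manner of Sims
(`insertS_spec`).

Only subspaces of `V` or of `W` are listed. A `k`-dimensional space has at most `q ^ (k ^ 2 / 4 +
k)` subspaces of dimension `j`, because `j (k - j) ≤ k ^ 2 / 4` (`card_subspaces_le`). This is the
source of the exponent; the remaining work per listed subspace is polynomial in `q ^ n` and in the
bit length of `m`.

For the machine, a vector is a number below `N = q ^ n`, a matrix is the number whose base-`N`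
digits are its table of values, and a subspace is the number whose binary digits are its
characteristic function. Linear algebra becomes exhaustive search over `N` points. The programs are
written in two small total languages for which the running time is bounded once and for all
(`Exp.compile_spec`, `Stm.compile_spec`): short loops make at most `N` rounds, accumulators and
stored values are reduced modulo `M`, so bit lengths stay bounded by a power of `L`, and the time is
at most `L ^ c * (K + 1) ^ h`, where `h` is the nesting depth of the long loops. Here `h = 1`, `L`
is polynomial in `q ^ n` and the bit length of `m`, and `K` is `m` plus the bound for the lists;
`time_bound` turns this into the required form. -/

set_option linter.unusedSectionVars false

/-! ### Bounded expressions, their compilation and its cost -/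

namespace Ram

/-- The eight read-only parameters of a compiled program. Loops of the expression language run at
most `N` times and their accumulators are reduced modulo `M`; the long loops of the statement
language run at most `K` times. -/
structure Globals where
  N : ℕ
  M : ℕ
  K : ℕ
  base : ℕ
  n : ℕ
  k : ℕ
  m : ℕ
  q : ℕ

/-- Names of the parameters. -/
inductive Glob where
  | N | M | K | base | n | k | m | q

/-- The register that holds a parameter. -/
def Glob.idx : Glob → ℕ
  | .N => 0 | .M => 1 | .K => 2 | .base => 3 | .n => 4 | .k => 5 | .m => 6 | .q => 7

theorem Glob.idx_lt (x : Glob) : x.idx < 8 := by cases x <;> simp [Glob.idx]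

/-- The value of a parameter. -/
def Globals.get (G : Globals) : Glob → ℕ
  | .N => G.N | .M => G.M | .K => G.K | .base => G.base
  | .n => G.n | .k => G.k | .m => G.m | .q => G.q

/-- Total numeric expressions over a list of local variables, with bounded iteration. -/
inductive Exp where
  | lit (a : ℕ)
  | glob (x : Glob)
  | var (i : ℕ)
  | load (e : Exp)
  | op (o : Op) (a b : Exp)
  | ite (c a b : Exp)
  -- A call: the body `f` sees only its arguments, numbered from 0, so that variable numbers are
  -- local to each function.
  | app1 (f a : Exp)
  | app2 (f a b : Exp)
  | app3 (f a b c : Exp)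
  -- `c` is the number of rounds and `a` the initial accumulator; the body `b` sees the round number
  -- and the accumulator as two additional variables at the end of the list.
  | iter (c a b : Exp)

/-- Bounded iteration with an accumulator that is reduced modulo `M` in every step. -/
def iterMod (M : ℕ) (f : ℕ → ℕ → ℕ) (a : ℕ) : ℕ → ℕ
  | 0 => a
  | i + 1 => f i (iterMod M f a i) % M

/-- The value of an expression. -/
def Exp.eval (G : Globals) (mem : ℕ → ℕ) : Exp → List ℕ → ℕ
  | .lit a, _ => a
  | .glob x, _ => G.get x
  | .var i, ρ => ρ.getD i 0
  | .load e, ρ => mem (e.eval G mem ρ)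
  | .op o a b, ρ => o.eval (a.eval G mem ρ) (b.eval G mem ρ)
  | .ite c a b, ρ => if c.eval G mem ρ ≠ 0 then a.eval G mem ρ else b.eval G mem ρ
  | .app1 f a, ρ => f.eval G mem [a.eval G mem ρ]
  | .app2 f a b, ρ => f.eval G mem [a.eval G mem ρ, b.eval G mem ρ]
  | .app3 f a b c, ρ => f.eval G mem [a.eval G mem ρ, b.eval G mem ρ, c.eval G mem ρ]
  | .iter c a b, ρ =>
      iterMod G.M (fun i x => b.eval G mem (ρ ++ [i, x])) (a.eval G mem ρ)
        (min (c.eval G mem ρ) G.N)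

/-- Code for an expression: the variables are in the registers `Γ`, the result goes into the
register `d`, and only registers from `d` on are changed. -/
def Exp.compile : Exp → List ℕ → ℕ → Prog
  | .lit a, _, d => .assign d (.lit a)
  | .glob x, _, d => .assign d (.reg x.idx)
  | .var i, Γ, d => if i < Γ.length then .assign d (.reg (Γ.getD i 0)) else .assign d (.lit 0)
  | .load e, Γ, d => .seq (e.compile Γ d) (.assign d (.load (.reg d)))
  | .op o a b, Γ, d =>
      .seq (a.compile Γ d) (.seq (b.compile Γ (d + 1))
        (.assign d (.op o (.reg d) (.reg (d + 1)))))
  | .ite c a b, Γ, d =>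
      .seq (c.compile Γ d) (.branch (.reg d) (a.compile Γ d) (b.compile Γ d))
  | .app1 f a, Γ, d =>
      .seq (a.compile Γ d) (.seq (f.compile [d] (d + 1)) (.assign d (.reg (d + 1))))
  | .app2 f a b, Γ, d =>
      .seq (a.compile Γ d) (.seq (b.compile Γ (d + 1))
        (.seq (f.compile [d, d + 1] (d + 2)) (.assign d (.reg (d + 2)))))
  | .app3 f a b c, Γ, d =>
      .seq (a.compile Γ d) (.seq (b.compile Γ (d + 1)) (.seq (c.compile Γ (d + 2))
        (.seq (f.compile [d, d + 1, d + 2] (d + 3)) (.assign d (.reg (d + 3))))))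
  | .iter c a b, Γ, d =>
      .seq (a.compile Γ d) (.seq (c.compile Γ (d + 1))
        (.seq (.branch (.op .lt (.reg Glob.N.idx) (.reg (d + 1)))
            (.assign (d + 1) (.reg Glob.N.idx)) .skip)
          (.seq (.assign (d + 2) (.lit 0))
            (.loop (.op .lt (.reg (d + 2)) (.reg (d + 1)))
              (.seq (b.compile (Γ ++ [d + 2, d]) (d + 3))
                (.seq (.assign d (.op .mod (.reg (d + 3)) (.reg Glob.M.idx)))
                  (.assign (d + 2) (.op .add (.reg (d + 2)) (.lit 1)))))))))

theorem charge_mono {a b : ℕ} (h : a ≤ b) : charge a ≤ charge b := by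
  unfold charge; have := Nat.size_le_size h; omega

theorem one_le_charge (a : ℕ) : 1 ≤ charge a := by unfold charge; omega

theorem charge_le_self (a : ℕ) : charge a ≤ a + 1 := by
  unfold charge
  have : Nat.size a ≤ a := Nat.size_le.2 Nat.lt_two_pow_self
  omega

theorem charge_add_le (a b : ℕ) : charge (a + b) ≤ charge a + charge b := by
  have h : Nat.size (a + b) ≤ Nat.size a + Nat.size b + 1 := by
    rw [Nat.size_le]
    have ha := Nat.lt_size_self a
    have hb := Nat.lt_size_self b
    have h1 : 2 ^ Nat.size a ≤ 2 ^ (Nat.size a + Nat.size b) :=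
      Nat.pow_le_pow_right (by norm_num) (by omega)
    have h2 : 2 ^ Nat.size b ≤ 2 ^ (Nat.size a + Nat.size b) :=
      Nat.pow_le_pow_right (by norm_num) (by omega)
    rw [pow_succ]; omega
  unfold charge; omega

theorem charge_mul_le (a b : ℕ) : charge (a * b) ≤ charge a + charge b := by
  have h : Nat.size (a * b) ≤ Nat.size a + Nat.size b := by
    rw [Nat.size_le, pow_add]
    exact Nat.mul_lt_mul'' (Nat.lt_size_self a) (Nat.lt_size_self b)
  unfold charge; omega

/-- Differences, quotients and remainders do not exceed the first operand, and comparisons have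
charge at most 2. Bit lengths therefore grow only additively. -/
theorem charge_op_le (o : Op) (a b : ℕ) : charge (o.eval a b) ≤ charge a + charge b := by
  have h1 : charge 1 = 2 := rfl
  have h0 : charge 0 = 1 := rfl
  have ha := one_le_charge a
  have hb := one_le_charge b
  cases o with
  | add => exact charge_add_le a b
  | sub => exact (charge_mono (Nat.sub_le a b)).trans (by omega)
  | mul => exact charge_mul_le a b
  | div => exact (charge_mono (Nat.div_le_self a b)).trans (by omega)
  | mod => exact (charge_mono (Nat.mod_le a b)).trans (by omega)
  | lt => simp only [Op.eval]; split_ifs <;> omega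
  | eq => simp only [Op.eval]; split_ifs <;> omega

/-- `p` leads from `s` to `s'` within time `T`. -/
def Run (p : Prog) (s s' : State) (T : ℕ) : Prop := ∃ t, t ≤ T ∧ Exec p s s' t

namespace Run

variable {p p' : Prog} {s s' s'' : State} {T T' : ℕ}

theorem mono (h : Run p s s' T) (hT : T ≤ T') : Run p s s' T' :=
  let ⟨t, ht, he⟩ := h; ⟨t, ht.trans hT, he⟩

theorem seq (h : Run p s s' T) (h' : Run p' s' s'' T') : Run (.seq p p') s s'' (T + T') :=
  let ⟨_, ht, he⟩ := h; let ⟨_, ht', he'⟩ := h'; ⟨_, add_le_add ht ht', .seq he he'⟩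

theorem skip (s : State) : Run .skip s s 1 := ⟨_, le_rfl, .skip s⟩

theorem assign (s : State) (x : ℕ) (e : Expr) :
    Run (.assign x e) s { s with reg := Function.update s.reg x (e.eval s) }
      (e.cost s + charge (e.eval s)) := ⟨_, le_rfl, .assign s x e⟩

theorem branch_true {e : Expr} (he : e.eval s ≠ 0) (h : Run p s s' T) :
    Run (.branch e p p') s s' (e.cost s + 1 + T) :=
  let ⟨_, ht, hx⟩ := h; ⟨_, by omega, .branch_true he hx⟩

theorem branch_false {e : Expr} (he : e.eval s = 0) (h : Run p' s s' T) :
    Run (.branch e p p') s s' (e.cost s + 1 + T) :=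
  let ⟨_, ht, hx⟩ := h; ⟨_, by omega, .branch_false he hx⟩

theorem loop_true {e : Expr} (he : e.eval s ≠ 0) (h : Run p s s' T)
    (h' : Run (.loop e p) s' s'' T') : Run (.loop e p) s s'' (e.cost s + 1 + T + T') :=
  let ⟨_, ht, hx⟩ := h; let ⟨_, ht', hx'⟩ := h'; ⟨_, by omega, .loop_true he hx hx'⟩

theorem loop_false {e : Expr} (he : e.eval s = 0) : Run (.loop e p) s s (e.cost s + 1) :=
  ⟨_, le_rfl, .loop_false he⟩

/-- A counting loop with invariant `I`. -/
theorem count_loop {body : Prog} {i b cnt : ℕ} (I : ℕ → State → Prop)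
    (hr : ∀ j s, I j s → s.reg i = j ∧ s.reg b = cnt)
    (hb : ∀ j < cnt, ∀ s, I j s → ∃ s', Run body s s' T ∧ I (j + 1) s')
    {s : State} (h0 : I 0 s) :
    ∃ s', Run (.loop (.op .lt (.reg i) (.reg b)) body) s s'
      ((cnt + 1) * (T + (2 * charge cnt + charge cnt * charge cnt + 1))) ∧ I cnt s' := by
  set X := 2 * charge cnt + charge cnt * charge cnt + 1 with hX
  have hcost : ∀ j ≤ cnt, ∀ s, I j s →
      (Expr.op .lt (.reg i) (.reg b)).cost s + 1 ≤ X := by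
    intro j hj s hs
    obtain ⟨h1, h2⟩ := hr j s hs
    simp only [Expr.cost, Expr.eval, h1, h2]
    have := charge_mono hj
    have := Nat.mul_le_mul_right (charge cnt) this
    omega
  -- Induction on the number `r` of rounds that are still to be made.
  have key : ∀ r ≤ cnt, ∀ s, I (cnt - r) s →
      ∃ s', Run (.loop (.op .lt (.reg i) (.reg b)) body) s s' (r * (T + X) + X) ∧ I cnt s' := by
    intro r
    induction r with
    | zero =>
      intro _ s hs
      obtain ⟨h1, h2⟩ := hr _ s hs
      refine ⟨s, (loop_false ?_).mono ?_, by simpa using hs⟩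
      · simp [Expr.eval, Op.eval, h1, h2]
      · have := hcost _ (Nat.sub_le _ _) s hs
        omega
    | succ r ih =>
      intro hr' s hs
      obtain ⟨h1, h2⟩ := hr _ s hs
      obtain ⟨s₁, hs₁, hI₁⟩ := hb _ (by omega) s hs
      obtain ⟨s₂, hs₂, hI₂⟩ := ih (by omega) s₁ (by
        have : cnt - (r + 1) + 1 = cnt - r := by omega
        rwa [this] at hI₁)
      refine ⟨s₂, (loop_true ?_ hs₁ hs₂).mono ?_, hI₂⟩
      · simp only [Expr.eval, Op.eval, h1, h2]
        rw [if_pos (by omega)]; norm_num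
      · have := hcost _ (Nat.sub_le _ _) s hs
        have e : (r + 1) * (T + X) = r * (T + X) + (T + X) := by ring
        omega
  obtain ⟨s', h, h'⟩ := key cnt le_rfl s (by simpa using h0)
  refine ⟨s', h.mono ?_, h'⟩
  have e : (cnt + 1) * (T + X) = cnt * (T + X) + (T + X) := by ring
  omega

end Run

/-- `s'` arises from `s` by putting `v` into the register `d`, except for changes of registers
beyond `d`. -/
structure Ext (d : ℕ) (s s' : State) (v : ℕ) : Prop where
  mem : s'.mem = s.mem
  out : s'.out = s.out
  reg : ∀ r < d, s'.reg r = s.reg r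
  val : s'.reg d = v

/-- The state `s` has the parameters `G` and all its relevant numbers have charge at most `L`. -/
structure Ready (G : Globals) (Γ : List ℕ) (d : ℕ) (s : State) (L : ℕ) : Prop where
  hL : 100 ≤ L
  hN : G.N ≤ L
  hM : 0 < G.M
  hG : ∀ x, charge (G.get x) ≤ L
  reg : ∀ x : Glob, s.reg x.idx = G.get x
  hd : 8 ≤ d
  hΓ : ∀ r ∈ Γ, r < d ∧ charge (s.reg r) ≤ L
  hmem : ∀ a, charge (s.mem a) ≤ L

/-- Hands the value just computed in the register `d` on to the next piece of code, possibly as a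
new variable. The bound may grow to `L'`, which has to cover that value. -/
theorem Ready.step {G : Globals} {Γ Γ' : List ℕ} {d d' v : ℕ} {s s' : State} {L L' : ℕ}
    (h : Ready G Γ d s L) (e : Ext d s s' v) (hv : charge v ≤ L') (hL : L ≤ L') (hd : d < d')
    (hΓ : ∀ r ∈ Γ', r ∈ Γ ∨ r = d) : Ready G Γ' d' s' L' where
  hL := h.hL.trans hL
  hN := h.hN.trans hL
  hM := h.hM
  hG x := (h.hG x).trans hL
  reg x := by rw [e.reg _ (x.idx_lt.trans_le h.hd), h.reg]
  hd := by have := h.hd; omega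
  hΓ r hr := by
    rcases hΓ r hr with h1 | rfl
    · obtain ⟨h2, h3⟩ := h.hΓ r h1
      exact ⟨h2.trans hd, by rw [e.reg _ h2]; exact h3.trans hL⟩
    · exact ⟨hd, by rw [e.val]; exact hv⟩
  hmem a := by rw [e.mem]; exact (h.hmem a).trans hL

theorem Ready.same {G : Globals} {Γ : List ℕ} {d : ℕ} {s s' : State} {L v : ℕ}
    (h : Ready G Γ d s L) (e : Ext d s s' v) : Ready G Γ d s' L where
  hL := h.hL
  hN := h.hN
  hM := h.hM
  hG := h.hG
  reg x := by rw [e.reg _ (x.idx_lt.trans_le h.hd), h.reg]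
  hd := h.hd
  hΓ r hr := ⟨(h.hΓ r hr).1, by rw [e.reg _ (h.hΓ r hr).1]; exact (h.hΓ r hr).2⟩
  hmem a := by rw [e.mem]; exact h.hmem a

theorem Ready.map_eq {G : Globals} {Γ : List ℕ} {d : ℕ} {s s' : State} {L : ℕ}
    (h : Ready G Γ d s L) (e : ∀ r < d, s'.reg r = s.reg r) :
    Γ.map s'.reg = Γ.map s.reg :=
  List.map_congr_left fun r hr => e r (h.hΓ r hr).1

theorem Ext.trans {d d' v v' : ℕ} {s s' s'' : State} (h : Ext d s s' v) (h' : Ext d' s' s'' v')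
    (hd : d < d') : Ext d s s'' v where
  mem := h'.mem.trans h.mem
  out := h'.out.trans h.out
  reg r hr := (h'.reg r (hr.trans hd)).trans (h.reg r hr)
  val := (h'.reg d hd).trans h.val

theorem Ext.comp {d v v' : ℕ} {s s' s'' : State} (h : Ext d s s' v) (h' : Ext d s' s'' v') :
    Ext d s s'' v' where
  mem := h'.mem.trans h.mem
  out := h'.out.trans h.out
  reg r hr := (h'.reg r hr).trans (h.reg r hr)
  val := h'.val

theorem Ext.assign (d : ℕ) (s : State) (e : Expr) :
    Ext d s { s with reg := Function.update s.reg d (e.eval s) } (e.eval s) where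
  mem := rfl
  out := rfl
  reg r hr := by simp [Function.update_of_ne hr.ne]
  val := by simp

/-- One more factor `L` swallows any constant up to 100. All additive overhead of the generated code
is hidden in the exponent in this way. -/
theorem le_pow_of_le_mul {L c x : ℕ} (hL : 100 ≤ L) (h : x ≤ 100 * L ^ c) : x ≤ L ^ (c + 1) := by
  rw [pow_succ, mul_comm]; exact h.trans (Nat.mul_le_mul_right _ hL)

theorem pow_le_of_le {L a b : ℕ} (hL : 100 ≤ L) (h : a ≤ b) : L ^ a ≤ L ^ b :=
  Nat.pow_le_pow_right (by omega) h

theorem le_pow_self {L c : ℕ} (hL : 100 ≤ L) (h : 1 ≤ c) : L ≤ L ^ c := by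
  simpa using pow_le_of_le hL h

/-- The code of an expression computes its value within a time that is polynomial in the
number of iterations and the charges of the numbers at hand. -/
theorem Exp.compile_spec (e : Exp) : ∃ c, 1 ≤ c ∧ ∀ G Γ d s L, Ready G Γ d s L →
    ∃ s', Run (e.compile Γ d) s s' (L ^ c) ∧ Ext d s s' (e.eval G s.mem (Γ.map s.reg)) ∧
      charge (e.eval G s.mem (Γ.map s.reg)) ≤ L ^ c := by
  induction e with
  | lit a =>
    -- A literal is not bounded by `L`, but it is fixed with the expression, so its charge may enter
    -- the exponent.
    refine ⟨charge a + 2, by omega, fun G Γ d s L h => ⟨_, (Run.assign s d (.lit a)).mono ?_,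
      Ext.assign d s (.lit a), ?_⟩⟩
    all_goals
      simp only [Expr.cost, Expr.eval, Exp.eval]
      have h1 : charge a < L ^ charge a := Nat.lt_pow_self (by have := h.hL; omega)
      have h2 : L ^ (charge a + 2) = L ^ charge a * L ^ 2 := pow_add _ _ _
      have h3 : 2 ≤ L ^ 2 := by have := h.hL; nlinarith
      nlinarith
  | glob x =>
    refine ⟨2, by omega, fun G Γ d s L h => ⟨_, (Run.assign s d (.reg x.idx)).mono ?_, ?_, ?_⟩⟩
    · simp only [Expr.cost, Expr.eval, h.reg]
      have := h.hG x; have := h.hL; nlinarith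
    · simp only [Exp.eval, ← h.reg x]
      exact Ext.assign d s (.reg x.idx)
    · simp only [Exp.eval]
      have := h.hG x; have := h.hL; nlinarith
  | var i =>
    refine ⟨2, by omega, fun G Γ d s L h => ?_⟩
    by_cases hi : i < Γ.length
    · have hv : (Exp.var i).eval G s.mem (Γ.map s.reg) = s.reg (Γ.getD i 0) := by
        simp [Exp.eval, List.getD_eq_getElem?_getD, hi]
      have hc : charge (s.reg (Γ.getD i 0)) ≤ L :=
        (h.hΓ _ (by simp [List.getD_eq_getElem?_getD, hi])).2
      rw [hv]
      simp only [Exp.compile, hi, if_true]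
      refine ⟨_, (Run.assign s d (.reg (Γ.getD i 0))).mono ?_,
        Ext.assign d s (.reg (Γ.getD i 0)), ?_⟩
      · simp only [Expr.cost, Expr.eval]
        have := h.hL; nlinarith
      · have := h.hL; nlinarith
    · have hv : (Exp.var i).eval G s.mem (Γ.map s.reg) = 0 := by
        simp [Exp.eval, List.getD_eq_getElem?_getD, hi]
      rw [hv]
      simp only [Exp.compile, hi, if_false]
      refine ⟨_, (Run.assign s d (.lit 0)).mono ?_, Ext.assign d s (.lit 0), ?_⟩
      all_goals
        simp only [Expr.cost, Expr.eval, charge, Nat.size_zero]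
        have := h.hL; nlinarith
  | load e ih =>
    obtain ⟨c, hc, ih⟩ := ih
    refine ⟨c + 2, by omega, fun G Γ d s L h => ?_⟩
    obtain ⟨s₁, r₁, e₁, b₁⟩ := ih G Γ d s L h
    have h1 := le_pow_self h.hL hc
    have h2 := h.hmem (e.eval G s.mem (Γ.map s.reg))
    refine ⟨_, (r₁.seq (Run.assign s₁ d (.load (.reg d)))).mono ?_, ?_, ?_⟩
    · simp only [Expr.cost, Expr.eval, e₁.val, e₁.mem]
      exact (le_pow_of_le_mul h.hL (c := c) (by omega)).trans (pow_le_of_le h.hL (by omega))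
    · have := e₁.comp (Ext.assign d s₁ (.load (.reg d)))
      simpa only [Exp.eval, Expr.eval, e₁.val, e₁.mem] using this
    · simp only [Exp.eval]
      exact (h2.trans h1).trans (pow_le_of_le h.hL (by omega))
  | op o a b iha ihb =>
    obtain ⟨ca, hca, iha⟩ := iha
    obtain ⟨cb, hcb, ihb⟩ := ihb
    -- The code for `b` is run under the bound `L ^ ca` left behind by `a`, whence `ca * cb`. The
    -- factor 2 pays for the product of two charges, the final 1 for constants.
    refine ⟨2 * (ca + ca * cb) + 1, by omega, fun G Γ d s L h => ?_⟩
    obtain ⟨s₁, r₁, e₁, b₁⟩ := iha G Γ d s L h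
    have h1 := le_pow_self h.hL hca
    have R1 : Ready G Γ (d + 1) s₁ (L ^ ca) :=
      h.step e₁ b₁ h1 (by omega) fun _ hr => .inl hr
    obtain ⟨s₂, r₂, e₂, b₂⟩ := ihb G Γ (d + 1) s₁ _ R1
    rw [e₁.mem, h.map_eq e₁.reg] at e₂ b₂
    rw [← pow_mul] at b₂ r₂
    set va := a.eval G s.mem (Γ.map s.reg)
    set vb := b.eval G s.mem (Γ.map s.reg)
    have e₁₂ := e₁.trans e₂ (Nat.lt_succ_self d)
    have hP : 1 ≤ L ^ (ca + ca * cb) := Nat.one_le_pow _ _ (by have := h.hL; omega)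
    have p1 : L ^ ca ≤ L ^ (ca + ca * cb) := pow_le_of_le h.hL (by omega)
    have p2 : L ^ (ca * cb) ≤ L ^ (ca + ca * cb) := pow_le_of_le h.hL (by omega)
    have p3 : L ^ (2 * (ca + ca * cb)) = L ^ (ca + ca * cb) * L ^ (ca + ca * cb) := by
      rw [← pow_add]; ring_nf
    have p4 : charge va * charge vb ≤ L ^ (ca + ca * cb) * L ^ (ca + ca * cb) :=
      Nat.mul_le_mul (b₁.trans p1) (b₂.trans p2)
    have p5 := charge_op_le o va vb
    have p6 : L ^ (ca + ca * cb) ≤ L ^ (ca + ca * cb) * L ^ (ca + ca * cb) :=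
      Nat.le_mul_of_pos_left _ hP
    refine ⟨_, (r₁.seq (r₂.seq (Run.assign s₂ d (.op o (.reg d) (.reg (d + 1)))))).mono ?_,
      ?_, ?_⟩
    · simp only [Expr.cost, Expr.eval, e₁₂.val, e₂.val]
      exact le_pow_of_le_mul h.hL (by omega)
    · have := e₁₂.comp (Ext.assign d s₂ (.op o (.reg d) (.reg (d + 1))))
      simpa only [Exp.eval, Expr.eval, e₁₂.val, e₂.val] using this
    · exact le_pow_of_le_mul h.hL (by simp only [Exp.eval]; rw [show o.eval (a.eval G s.mem (Γ.map s.reg)) (b.eval G s.mem (Γ.map s.reg)) = o.eval va vb from rfl]; omega)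
  | ite c a b ihc iha ihb =>
    obtain ⟨cc, hcc, ihc⟩ := ihc
    obtain ⟨ca, hca, iha⟩ := iha
    obtain ⟨cb, hcb, ihb⟩ := ihb
    refine ⟨cc + ca + cb + 1, by omega, fun G Γ d s L h => ?_⟩
    obtain ⟨s₁, r₁, e₁, b₁⟩ := ihc G Γ d s L h
    have R1 : Ready G Γ d s₁ L := h.same e₁
    have p0 : 1 ≤ L ^ (cc + ca + cb) := Nat.one_le_pow _ _ (by have := h.hL; omega)
    have p1 : L ^ cc ≤ L ^ (cc + ca + cb) := pow_le_of_le h.hL (by omega)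
    have p2 : L ^ ca ≤ L ^ (cc + ca + cb) := pow_le_of_le h.hL (by omega)
    have p3 : L ^ cb ≤ L ^ (cc + ca + cb) := pow_le_of_le h.hL (by omega)
    by_cases hv : c.eval G s.mem (Γ.map s.reg) = 0
    · obtain ⟨s₂, r₂, e₂, b₂⟩ := ihb G Γ d s₁ L R1
      rw [e₁.mem, h.map_eq e₁.reg] at e₂ b₂
      have hev : (Exp.ite c a b).eval G s.mem (Γ.map s.reg) = b.eval G s.mem (Γ.map s.reg) := by
        simp [Exp.eval, hv]
      rw [hev]
      refine ⟨s₂, (r₁.seq (Run.branch_false (by simp [Expr.eval, e₁.val, hv]) r₂)).mono ?_,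
        e₁.comp e₂, le_pow_of_le_mul h.hL (by omega)⟩
      simp only [Expr.cost, e₁.val]
      exact le_pow_of_le_mul h.hL (by omega)
    · obtain ⟨s₂, r₂, e₂, b₂⟩ := iha G Γ d s₁ L R1
      rw [e₁.mem, h.map_eq e₁.reg] at e₂ b₂
      have hev : (Exp.ite c a b).eval G s.mem (Γ.map s.reg) = a.eval G s.mem (Γ.map s.reg) := by
        simp [Exp.eval, hv]
      rw [hev]
      refine ⟨s₂, (r₁.seq (Run.branch_true (by simp [Expr.eval, e₁.val, hv]) r₂)).mono ?_,
        e₁.comp e₂, le_pow_of_le_mul h.hL (by omega)⟩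
      simp only [Expr.cost, e₁.val]
      exact le_pow_of_le_mul h.hL (by omega)
  | app1 f a ihf iha =>
    obtain ⟨cf, hcf, ihf⟩ := ihf
    obtain ⟨ca, hca, iha⟩ := iha
    refine ⟨ca + ca * cf + 1, by omega, fun G Γ d s L h => ?_⟩
    obtain ⟨s₁, r₁, e₁, b₁⟩ := iha G Γ d s L h
    have h1 := le_pow_self h.hL hca
    have R1 : Ready G [d] (d + 1) s₁ (L ^ ca) := h.step e₁ b₁ h1 (by omega) (by simp)
    obtain ⟨s₂, r₂, e₂, b₂⟩ := ihf G [d] (d + 1) s₁ _ R1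
    have hev : f.eval G s₁.mem ([d].map s₁.reg) = (Exp.app1 f a).eval G s.mem (Γ.map s.reg) := by
      simp [Exp.eval, e₁.mem, e₁.val]
    rw [hev] at e₂ b₂
    rw [← pow_mul] at b₂ r₂
    have e₁₂ := e₁.trans e₂ (Nat.lt_succ_self d)
    have p1 : L ^ ca ≤ L ^ (ca + ca * cf) := pow_le_of_le h.hL (by omega)
    have p2 : L ^ (ca * cf) ≤ L ^ (ca + ca * cf) := pow_le_of_le h.hL (by omega)
    refine ⟨_, (r₁.seq (r₂.seq (Run.assign s₂ d (.reg (d + 1))))).mono ?_, ?_, ?_⟩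
    · simp only [Expr.cost, Expr.eval, e₂.val]
      exact le_pow_of_le_mul h.hL (by omega)
    · have := e₁₂.comp (Ext.assign d s₂ (.reg (d + 1)))
      simpa only [Expr.eval, e₂.val] using this
    · exact le_pow_of_le_mul h.hL (by omega)
  | app2 f a b ihf iha ihb =>
    obtain ⟨cf, hcf, ihf⟩ := ihf
    obtain ⟨ca, hca, iha⟩ := iha
    obtain ⟨cb, hcb, ihb⟩ := ihb
    refine ⟨ca + ca * cb + ca * (cb * cf) + 1, by omega, fun G Γ d s L h => ?_⟩
    obtain ⟨s₁, r₁, e₁, b₁⟩ := iha G Γ d s L h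
    have h1 := le_pow_self h.hL hca
    have R1 : Ready G (Γ ++ [d]) (d + 1) s₁ (L ^ ca) := h.step e₁ b₁ h1 (by omega) (by simp)
    obtain ⟨s₂, r₂, e₂, b₂⟩ := ihb G Γ (d + 1) s₁ _
      (h.step e₁ b₁ h1 (by omega) fun _ hr => .inl hr)
    rw [e₁.mem, h.map_eq e₁.reg] at e₂ b₂
    have R2 : Ready G [d, d + 1] (d + 2) s₂ ((L ^ ca) ^ cb) :=
      R1.step e₂ b₂ (le_pow_self R1.hL hcb) (by omega) (by simp)
    obtain ⟨s₃, r₃, e₃, b₃⟩ := ihf G [d, d + 1] (d + 2) s₂ _ R2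
    have e₁₂ := e₁.trans e₂ (Nat.lt_succ_self d)
    have hev : f.eval G s₂.mem ([d, d + 1].map s₂.reg)
        = (Exp.app2 f a b).eval G s.mem (Γ.map s.reg) := by
      simp [Exp.eval, e₁₂.mem, e₁₂.val, e₂.val]
    rw [hev] at e₃ b₃
    rw [← pow_mul] at r₂ b₂
    rw [← pow_mul, ← pow_mul] at r₃ b₃
    have e₁₃ := e₁₂.trans e₃ (by omega)
    have p1 : L ^ ca ≤ L ^ (ca + ca * cb + ca * (cb * cf)) := pow_le_of_le h.hL (by omega)
    have p2 : L ^ (ca * cb) ≤ L ^ (ca + ca * cb + ca * (cb * cf)) := pow_le_of_le h.hL (by omega)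
    have p3 : L ^ (ca * (cb * cf)) ≤ L ^ (ca + ca * cb + ca * (cb * cf)) :=
      pow_le_of_le h.hL (by omega)
    refine ⟨_, (r₁.seq (r₂.seq (r₃.seq (Run.assign s₃ d (.reg (d + 2)))))).mono ?_, ?_, ?_⟩
    · simp only [Expr.cost, Expr.eval, e₃.val]
      exact le_pow_of_le_mul h.hL (by omega)
    · have := e₁₃.comp (Ext.assign d s₃ (.reg (d + 2)))
      simpa only [Expr.eval, e₃.val] using this
    · exact le_pow_of_le_mul h.hL (by omega)
  | app3 f a b c ihf iha ihb ihc =>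
    obtain ⟨cf, hcf, ihf⟩ := ihf
    obtain ⟨ca, hca, iha⟩ := iha
    obtain ⟨cb, hcb, ihb⟩ := ihb
    obtain ⟨cc, hcc, ihc⟩ := ihc
    refine ⟨ca + ca * cb + ca * (cb * cc) + ca * (cb * (cc * cf)) + 1, by omega,
      fun G Γ d s L h => ?_⟩
    obtain ⟨s₁, r₁, e₁, b₁⟩ := iha G Γ d s L h
    have h1 := le_pow_self h.hL hca
    have R1 : Ready G (Γ ++ [d]) (d + 1) s₁ (L ^ ca) := h.step e₁ b₁ h1 (by omega) (by simp)
    have R1' : Ready G Γ (d + 1) s₁ (L ^ ca) :=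
      h.step e₁ b₁ h1 (by omega) fun _ hr => .inl hr
    obtain ⟨s₂, r₂, e₂, b₂⟩ := ihb G Γ (d + 1) s₁ _ R1'
    rw [e₁.mem, h.map_eq e₁.reg] at e₂ b₂
    have e₁₂ := e₁.trans e₂ (Nat.lt_succ_self d)
    have R2 : Ready G [d, d + 1] (d + 2) s₂ ((L ^ ca) ^ cb) :=
      R1.step e₂ b₂ (le_pow_self R1.hL hcb) (by omega) (by simp)
    have R2' : Ready G Γ (d + 2) s₂ ((L ^ ca) ^ cb) :=
      R1'.step e₂ b₂ (le_pow_self R1.hL hcb) (by omega) fun _ hr => .inl hr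
    obtain ⟨s₃, r₃, e₃, b₃⟩ := ihc G Γ (d + 2) s₂ _ R2'
    rw [e₁₂.mem, h.map_eq e₁₂.reg] at e₃ b₃
    have e₁₃ := e₁₂.trans e₃ (by omega)
    have e₂₃ := e₂.trans e₃ (by omega)
    have R3 : Ready G [d, d + 1, d + 2] (d + 3) s₃ (((L ^ ca) ^ cb) ^ cc) :=
      R2.step e₃ b₃ (le_pow_self R2.hL hcc) (by omega) (by simp)
    obtain ⟨s₄, r₄, e₄, b₄⟩ := ihf G [d, d + 1, d + 2] (d + 3) s₃ _ R3
    have hev : f.eval G s₃.mem ([d, d + 1, d + 2].map s₃.reg)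
        = (Exp.app3 f a b c).eval G s.mem (Γ.map s.reg) := by
      simp [Exp.eval, e₁₃.mem, e₁₃.val, e₂₃.val, e₃.val]
    rw [hev] at e₄ b₄
    rw [← pow_mul] at r₂ b₂
    rw [← pow_mul, ← pow_mul] at r₃ b₃
    rw [← pow_mul, ← pow_mul, ← pow_mul] at r₄ b₄
    have e₁₄ := e₁₃.trans e₄ (by omega)
    set C := ca + ca * cb + ca * (cb * cc) + ca * (cb * (cc * cf)) with hC
    have p1 : L ^ ca ≤ L ^ C := pow_le_of_le h.hL (by omega)
    have p2 : L ^ (ca * cb) ≤ L ^ C := pow_le_of_le h.hL (by omega)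
    have p3 : L ^ (ca * (cb * cc)) ≤ L ^ C := pow_le_of_le h.hL (by omega)
    have p4 : L ^ (ca * (cb * (cc * cf))) ≤ L ^ C := pow_le_of_le h.hL (by omega)
    refine ⟨_, (r₁.seq (r₂.seq (r₃.seq (r₄.seq (Run.assign s₄ d (.reg (d + 3))))))).mono ?_,
      ?_, ?_⟩
    · simp only [Expr.cost, Expr.eval, e₄.val]
      exact le_pow_of_le_mul h.hL (by omega)
    · have := e₁₄.comp (Ext.assign d s₄ (.reg (d + 3)))
      simpa only [Expr.eval, e₄.val] using this
    · exact le_pow_of_le_mul h.hL (by omega)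
  | iter c a b ihc iha ihb =>
    obtain ⟨cc, hcc, ihc⟩ := ihc
    obtain ⟨ca, hca, iha⟩ := iha
    obtain ⟨cb, hcb, ihb⟩ := ihb
    -- With `P = L ^ (ca + ca * cc + ca * cb)` there are at most about `P` rounds, and each costs a
    -- constant times `P * P`; this gives the factor 3.
    refine ⟨3 * (ca + ca * cc + ca * cb) + 1, by omega, fun G Γ d s L h => ?_⟩
    obtain ⟨s₁, r₁, e₁, b₁⟩ := iha G Γ d s L h
    have h1 := le_pow_self h.hL hca
    have R1 : Ready G Γ (d + 1) s₁ (L ^ ca) :=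
      h.step e₁ b₁ h1 (by omega) fun _ hr => .inl hr
    obtain ⟨s₂, r₂, e₂, b₂⟩ := ihc G Γ (d + 1) s₁ _ R1
    rw [e₁.mem, h.map_eq e₁.reg] at e₂ b₂
    rw [← pow_mul] at b₂ r₂
    set va := a.eval G s.mem (Γ.map s.reg) with hva
    set vc := c.eval G s.mem (Γ.map s.reg) with hvc
    set cn := min vc G.N with hcn
    set P := L ^ (ca + ca * cc + ca * cb) with hP
    have p0 : 100 ≤ P := h.hL.trans (le_pow_self h.hL (by omega))
    have p1 : L ^ ca ≤ P := pow_le_of_le h.hL (by omega)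
    have p2 : L ^ (ca * cc) ≤ P := pow_le_of_le h.hL (by omega)
    have p3 : L ^ (ca * cb) ≤ P := pow_le_of_le h.hL (by omega)
    have hNP : charge G.N ≤ P := (h.hG .N).trans (h1.trans p1)
    have hMP : charge G.M ≤ P := (h.hG .M).trans (h1.trans p1)
    have hcnN : cn ≤ G.N := min_le_right _ _
    have hcnP : charge cn ≤ P := (charge_mono hcnN).trans hNP
    have e₁₂ := e₁.trans e₂ (Nat.lt_succ_self d)
    have hN₂ : s₂.reg Glob.N.idx = G.N := by
      rw [e₁₂.reg _ (Glob.N.idx_lt.trans_le h.hd), h.reg]; rfl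
    have hmul : charge G.N * charge vc ≤ P * P := Nat.mul_le_mul hNP (b₂.trans p2)
    obtain ⟨s₃, r₃, e₃⟩ : ∃ s₃, Run (.branch (.op .lt (.reg Glob.N.idx) (.reg (d + 1)))
            (.assign (d + 1) (.reg Glob.N.idx)) .skip) s₂ s₃ (P * P + 10 * P)
            ∧ Ext (d + 1) s₂ s₃ cn := by
      by_cases hlt : G.N < vc
      · refine ⟨_, (Run.branch_true ?_ (Run.assign s₂ (d + 1) (.reg Glob.N.idx))).mono ?_, ?_⟩
        · simp [Expr.eval, Op.eval, hN₂, e₂.val, hlt]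
        · simp only [Expr.cost, Expr.eval, hN₂, e₂.val]
          omega
        · have := Ext.assign (d + 1) s₂ (.reg Glob.N.idx)
          have h2 : cn = G.N := min_eq_right hlt.le
          rw [h2]
          simpa only [Expr.eval, hN₂] using this
      · refine ⟨_, (Run.branch_false ?_ (Run.skip s₂)).mono ?_, ?_⟩
        · simp [Expr.eval, Op.eval, hN₂, e₂.val, hlt]
        · simp only [Expr.cost, Expr.eval, hN₂, e₂.val]
          omega
        · have h2 : cn = vc := min_eq_left (by omega)
          rw [h2]
          exact ⟨rfl, rfl, fun _ _ => rfl, e₂.val⟩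
    have e₁₃ := e₁₂.trans e₃ (Nat.lt_succ_self d)
    have e₄ := Ext.assign (d + 2) s₃ (.lit 0)
    have r₄ := Run.assign s₃ (d + 2) (.lit 0)
    have e₁₄ := e₁₃.trans e₄ (by omega)
    have e₃₄ := e₃.trans e₄ (by omega)
    set s₄ : State := { s₃ with reg := Function.update s₃.reg (d + 2) ((Expr.lit 0).eval s₃) }
    set f : ℕ → ℕ → ℕ := fun i x => b.eval G s.mem (Γ.map s.reg ++ [i, x]) with hf
    -- The reduction modulo `M` is what keeps the accumulator short: without it, repeated squaring
    -- could double its length in every round.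
    have hacc : ∀ j, charge (iterMod G.M f va j) ≤ L ^ ca := by
      intro j
      cases j with
      | zero => exact b₁
      | succ j => exact ((charge_mono (Nat.mod_lt _ h.hM).le).trans (h.hG .M)).trans h1
    have hz : charge 0 = 1 := rfl
    have hone : charge 1 = 2 := rfl
    obtain ⟨s₅, r₅, e₅, -, -⟩ := Run.count_loop
      (body := .seq (b.compile (Γ ++ [d + 2, d]) (d + 3))
                (.seq (.assign d (.op .mod (.reg (d + 3)) (.reg Glob.M.idx)))
                  (.assign (d + 2) (.op .add (.reg (d + 2)) (.lit 1)))))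
      (i := d + 2) (b := d + 1) (cnt := cn) (T := P * P + 20 * P)
      (fun j s' => Ext d s s' (iterMod G.M f va j) ∧ s'.reg (d + 1) = cn ∧ s'.reg (d + 2) = j)
      (fun j s' hI => ⟨hI.2.2, hI.2.1⟩)
      (by
        rintro j hj t ⟨ht, ht1, ht2⟩
        have hjN : j ≤ G.N := by omega
        have hjL : charge j ≤ L ^ ca := ((charge_mono hjN).trans (h.hG .N)).trans h1
        have R : Ready G (Γ ++ [d + 2, d]) (d + 3) t (L ^ ca) :=
          { hL := R1.hL, hN := R1.hN, hM := h.hM, hG := R1.hG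
            reg := fun x => by rw [ht.reg _ (x.idx_lt.trans_le h.hd), h.reg]
            hd := by have := h.hd; omega
            hΓ := by
              intro r hr
              simp only [List.mem_append, List.mem_cons, List.not_mem_nil, or_false] at hr
              rcases hr with hr | rfl | rfl
              · obtain ⟨h2, h3⟩ := h.hΓ r hr
                exact ⟨by omega, by rw [ht.reg _ h2]; exact h3.trans h1⟩
              · exact ⟨by omega, by rw [ht2]; exact hjL⟩
              · exact ⟨by omega, by rw [ht.val]; exact hacc j⟩
            hmem := fun a => by rw [ht.mem]; exact (h.hmem a).trans h1 }
        obtain ⟨t₁, q₁, f₁, c₁⟩ := ihb G _ (d + 3) t _ R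
        have hev : b.eval G t.mem ((Γ ++ [d + 2, d]).map t.reg) = f j (iterMod G.M f va j) := by
          simp [hf, ht.mem, ht.val, ht2, h.map_eq ht.reg]
        rw [hev] at f₁ c₁
        rw [← pow_mul] at q₁ c₁
        have hM₁ : t₁.reg Glob.M.idx = G.M := by
          have := Glob.M.idx_lt
          rw [f₁.reg _ (by have := h.hd; omega), ht.reg _ (by have := h.hd; omega), h.reg]; rfl
        refine ⟨_, (q₁.seq ((Run.assign t₁ d (.op .mod (.reg (d + 3)) (.reg Glob.M.idx))).seq
          (Run.assign _ (d + 2) (.op .add (.reg (d + 2)) (.lit 1))))).mono ?_, ?_, ?_, ?_⟩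
        · have g2 : (Function.update t₁.reg d
              ((Expr.op .mod (.reg (d + 3)) (.reg Glob.M.idx)).eval t₁)) (d + 2) = j := by
            rw [Function.update_of_ne (by omega), f₁.reg _ (by omega), ht2]
          simp only [Expr.cost, Expr.eval, f₁.val, hM₁]
          simp only [Expr.eval, f₁.val, hM₁] at g2
          rw [g2]
          have w1 : charge (f j (iterMod G.M f va j)) * charge G.M ≤ P * P :=
            Nat.mul_le_mul (c₁.trans p3) hMP
          have w2 := charge_op_le .mod (f j (iterMod G.M f va j)) G.M
          have w3 := charge_op_le .add j 1
          have w4 := c₁.trans p3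
          have w5 := hjL.trans p1
          rw [hone] at *
          omega
        · refine ⟨?_, ?_, fun r hr => ?_, ?_⟩
          · exact f₁.mem.trans ht.mem
          · exact f₁.out.trans ht.out
          · simp only
            rw [Function.update_of_ne (by omega), Function.update_of_ne (by omega),
              f₁.reg _ (by omega), ht.reg _ hr]
          · simp only
            rw [Function.update_of_ne (by omega), Function.update_self]
            simp only [Expr.eval, f₁.val, hM₁, Op.eval, iterMod]
        · simp only
          rw [Function.update_of_ne (by omega), Function.update_of_ne (by omega),
            f₁.reg _ (by omega), ht1]
        · simp only
          rw [Function.update_self]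
          simp only [Expr.eval, Op.eval]
          rw [Function.update_of_ne (by omega), f₁.reg _ (by omega), ht2])
      (s := s₄) ⟨e₁₄, e₃₄.val, e₄.val⟩
    have hev : iterMod G.M f va cn = (Exp.iter c a b).eval G s.mem (Γ.map s.reg) := rfl
    rw [hev] at e₅
    have hexp : L ^ (3 * (ca + ca * cc + ca * cb)) = P * P * P := by
      rw [hP, ← pow_add, ← pow_add]; ring_nf
    have hPP : 100 * P ≤ P * P := Nat.mul_le_mul_right _ p0
    have hPPP : 100 * (P * P) ≤ P * P * P := by
      rw [mul_comm]; exact Nat.mul_le_mul_left _ p0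
    refine ⟨s₅, (r₁.seq (r₂.seq (r₃.seq (r₄.seq r₅)))).mono ?_, e₅, ?_⟩
    · apply le_pow_of_le_mul h.hL
      rw [hexp]
      have w1 : cn + 1 ≤ 2 * P := by have := h.hN; omega
      have w2 : charge cn * charge cn ≤ P * P := Nat.mul_le_mul hcnP hcnP
      have w3 := Nat.mul_le_mul w1 (show P * P + 20 * P +
        (2 * charge cn + charge cn * charge cn + 1) ≤ 3 * (P * P) by omega)
      have w4 : 2 * P * (3 * (P * P)) = 6 * (P * P * P) := by ring
      simp only [Expr.cost, Expr.eval, hz]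
      omega
    · rw [← hev]
      exact ((hacc cn).trans p1).trans (by
        rw [pow_succ, hexp]; have := h.hL; nlinarith)

end Ram

/-! ### Statements with short and long loops, and their running time -/

namespace Ram

/-- Statements over a list of immutable local variables. Stored values are reduced modulo `M`;
`short` loops run at most `N` times and `long` loops at most `K` times. -/
inductive Stm where
  | skip
  | store (a e : Exp)
  | emit (e : Exp)
  | seq (p p' : Stm)
  | ite (c : Exp) (p p' : Stm)
  | letIn (e : Exp) (p : Stm)
  | call1 (a : Exp) (p : Stm)
  | call2 (a b : Exp) (p : Stm)
  | loop (long : Bool) (c : Exp) (p : Stm)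

/-- Memory and output. -/
structure Store where
  mem : ℕ → ℕ
  out : List ℕ

/-- `f (i - 1) (… (f 0 a))`. -/
def iterFrom {α : Type*} (f : ℕ → α → α) (a : α) : ℕ → α
  | 0 => a
  | i + 1 => f i (iterFrom f a i)

theorem iterFrom_induction {α : Type*} {f : ℕ → α → α} {a : α} (I : ℕ → α → Prop) {c : ℕ}
    (h0 : I 0 a) (hs : ∀ i < c, ∀ x, I i x → I (i + 1) (f i x)) : I c (iterFrom f a c) := by
  have : ∀ i ≤ c, I i (iterFrom f a i) := by
    intro i
    induction i with
    | zero => exact fun _ => h0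
    | succ i ih => exact fun hi => hs i hi _ (ih (by omega))
  exact this c le_rfl

/-- The parameter that limits a loop. -/
def loopGlob (long : Bool) : Glob := if long then .K else .N

/-- The effect of a statement. -/
def Stm.run (G : Globals) : Stm → List ℕ → Store → Store
  | .skip, _, σ => σ
  | .store a e, ρ, σ =>
      ⟨Function.update σ.mem (a.eval G σ.mem ρ) (e.eval G σ.mem ρ % G.M), σ.out⟩
  | .emit e, ρ, σ => ⟨σ.mem, σ.out ++ [e.eval G σ.mem ρ]⟩
  | .seq p p', ρ, σ => p'.run G ρ (p.run G ρ σ)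
  | .ite c p p', ρ, σ => if c.eval G σ.mem ρ ≠ 0 then p.run G ρ σ else p'.run G ρ σ
  | .letIn e p, ρ, σ => p.run G (ρ ++ [e.eval G σ.mem ρ]) σ
  | .call1 a p, ρ, σ => p.run G [a.eval G σ.mem ρ] σ
  | .call2 a b p, ρ, σ => p.run G [a.eval G σ.mem ρ, b.eval G σ.mem ρ] σ
  | .loop long c p, ρ, σ =>
      iterFrom (fun i σ => p.run G (ρ ++ [i]) σ) σ (min (c.eval G σ.mem ρ) (G.get (loopGlob long)))

/-- Code for a statement: the variables are in the registers `Γ`, and only registers from `d` on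
are changed. -/
def Stm.compile : Stm → List ℕ → ℕ → Prog
  | .skip, _, _ => .skip
  | .store a e, Γ, d =>
      .seq (a.compile Γ d) (.seq (e.compile Γ (d + 1))
        (.store (.reg d) (.op .mod (.reg (d + 1)) (.reg Glob.M.idx))))
  | .emit e, Γ, d => .seq (e.compile Γ d) (.emit (.reg d))
  | .seq p p', Γ, d => .seq (p.compile Γ d) (p'.compile Γ d)
  | .ite c p p', Γ, d => .seq (c.compile Γ d) (.branch (.reg d) (p.compile Γ d) (p'.compile Γ d))
  | .letIn e p, Γ, d => .seq (e.compile Γ d) (p.compile (Γ ++ [d]) (d + 1))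
  | .call1 a p, Γ, d => .seq (a.compile Γ d) (p.compile [d] (d + 1))
  | .call2 a b p, Γ, d =>
      .seq (a.compile Γ d) (.seq (b.compile Γ (d + 1)) (p.compile [d, d + 1] (d + 2)))
  | .loop long c p, Γ, d =>
      .seq (c.compile Γ d)
        (.seq (.branch (.op .lt (.reg (loopGlob long).idx) (.reg d))
            (.assign d (.reg (loopGlob long).idx)) .skip)
          (.seq (.assign (d + 1) (.lit 0))
            (.loop (.op .lt (.reg (d + 1)) (.reg d))
              (.seq (p.compile (Γ ++ [d + 1]) (d + 2))
                (.assign (d + 1) (.op .add (.reg (d + 1)) (.lit 1)))))))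

/-- The nesting depth of the long loops. -/
def Stm.height : Stm → ℕ
  | .skip | .store _ _ | .emit _ => 0
  | .seq p p' | .ite _ p p' => max p.height p'.height
  | .letIn _ p | .call1 _ p | .call2 _ _ p => p.height
  | .loop long _ p => if long then p.height + 1 else p.height

/-- Cells change only through `store`, which reduces modulo `M`. So the bound for the memory
contents survives any number of rounds of any loop, and time bounds need no knowledge of what a
program computes. -/
theorem Stm.run_mem (G : Globals) (hM : 0 < G.M) (p : Stm) (ρ : List ℕ) (σ : Store) (a : ℕ) :
    (p.run G ρ σ).mem a = σ.mem a ∨ (p.run G ρ σ).mem a < G.M := by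
  induction p generalizing ρ σ with
  | skip => exact .inl rfl
  | store b e =>
    simp only [Stm.run, Function.update_apply]
    split_ifs
    · exact .inr (Nat.mod_lt _ hM)
    · exact .inl rfl
  | emit e => exact .inl rfl
  | seq p p' ih ih' =>
    simp only [Stm.run]
    rcases ih' ρ (p.run G ρ σ) with h | h
    · rw [h]; exact ih ρ σ
    · exact .inr h
  | ite c p p' ih ih' =>
    simp only [Stm.run]
    split_ifs
    · exact ih _ _
    · exact ih' _ _
  | letIn e p ih => exact ih _ _
  | call1 e p ih => exact ih _ _
  | call2 e e' p ih => exact ih _ _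
  | loop long c p ih =>
    simp only [Stm.run]
    refine iterFrom_induction (fun _ (τ : Store) => τ.mem a = σ.mem a ∨ τ.mem a < G.M) (.inl rfl) ?_
    intro i _ τ hτ
    rcases ih (ρ ++ [i]) τ with h | h
    · rw [h]; exact hτ
    · exact .inr h

/-- The effect of a statement on states. -/
structure After (d : ℕ) (s s' : State) (σ : Store) : Prop where
  mem : s'.mem = σ.mem
  out : s'.out = σ.out
  reg : ∀ r < d, s'.reg r = s.reg r

theorem charge_run_le {G : Globals} {L : ℕ} (hM : 0 < G.M) (hL : charge G.M ≤ L) {p : Stm}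
    {ρ : List ℕ} {σ : Store} (h : ∀ a, charge (σ.mem a) ≤ L) (a : ℕ) :
    charge ((p.run G ρ σ).mem a) ≤ L := by
  rcases p.run_mem G hM ρ σ a with h' | h'
  · rw [h']; exact h a
  · exact (charge_mono h'.le).trans hL

theorem Ready.after {G : Globals} {Γ : List ℕ} {d : ℕ} {s s' : State} {L : ℕ} {p : Stm}
    {ρ : List ℕ} (h : Ready G Γ d s L) (e : After d s s' (p.run G ρ ⟨s.mem, s.out⟩)) :
    Ready G Γ d s' L where
  hL := h.hL
  hN := h.hN
  hM := h.hM
  hG := h.hG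
  reg x := by rw [e.reg _ (x.idx_lt.trans_le h.hd), h.reg]
  hd := h.hd
  hΓ r hr := ⟨(h.hΓ r hr).1, by rw [e.reg _ (h.hΓ r hr).1]; exact (h.hΓ r hr).2⟩
  hmem a := by rw [e.mem]; exact charge_run_le h.hM (h.hG .M) h.hmem a

/-- The code of a statement has its effect, and takes a time that is polynomial in the bounds for
the short loops and the numbers at hand, times the bound for the long loops. -/
theorem Stm.compile_spec (p : Stm) : ∃ c, 1 ≤ c ∧ ∀ G Γ d s L, Ready G Γ d s L →
    ∃ s', Run (p.compile Γ d) s s' (L ^ c * (G.K + 1) ^ p.height) ∧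
      After d s s' (p.run G (Γ.map s.reg) ⟨s.mem, s.out⟩) := by
  induction p with
  | skip =>
    refine ⟨1, le_rfl, fun G Γ d s L h => ⟨s, (Run.skip s).mono ?_, rfl, rfl, fun _ _ => rfl⟩⟩
    have := h.hL
    simp only [height, pow_zero, pow_one]; omega
  | store a e =>
    obtain ⟨ca, hca, iha⟩ := a.compile_spec
    obtain ⟨ce, hce, ihe⟩ := e.compile_spec
    refine ⟨2 * (ca + ca * ce) + 1, by omega, fun G Γ d s L h => ?_⟩
    obtain ⟨s₁, r₁, e₁, b₁⟩ := iha G Γ d s L h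
    have h1 := le_pow_self h.hL hca
    obtain ⟨s₂, r₂, e₂, b₂⟩ := ihe G Γ (d + 1) s₁ _
      (h.step e₁ b₁ h1 (by omega) fun _ hr => .inl hr)
    rw [e₁.mem, h.map_eq e₁.reg] at e₂ b₂
    rw [← pow_mul] at b₂ r₂
    have e₁₂ := e₁.trans e₂ (Nat.lt_succ_self d)
    set va := a.eval G s.mem (Γ.map s.reg) with hva
    set ve := e.eval G s.mem (Γ.map s.reg) with hve
    set P := L ^ (ca + ca * ce) with hP
    have p0 : 100 ≤ P := h.hL.trans (le_pow_self h.hL (by omega))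
    have p1 : L ^ ca ≤ P := pow_le_of_le h.hL (by omega)
    have p2 : L ^ (ca * ce) ≤ P := pow_le_of_le h.hL (by omega)
    have hMP : charge G.M ≤ P := (h.hG .M).trans (h1.trans p1)
    have hM₂ : s₂.reg Glob.M.idx = G.M := by
      rw [e₁₂.reg _ (Glob.M.idx_lt.trans_le h.hd), h.reg]; rfl
    have hPP : L ^ (2 * (ca + ca * ce)) = P * P := by rw [hP, ← pow_add]; ring_nf
    have hPP' : 100 * P ≤ P * P := Nat.mul_le_mul_right _ p0
    have w1 : charge ve * charge G.M ≤ P * P := Nat.mul_le_mul (b₂.trans p2) hMP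
    have w2 := charge_op_le .mod ve G.M
    refine ⟨_, (r₁.seq (r₂.seq ⟨_, le_rfl, .store s₂ (.reg d)
      (.op .mod (.reg (d + 1)) (.reg Glob.M.idx))⟩)).mono ?_, ?_, ?_, ?_⟩
    · simp only [Expr.cost, Expr.eval, e₁₂.val, e₂.val, hM₂, height, pow_zero, mul_one]
      apply le_pow_of_le_mul h.hL
      rw [hPP]
      omega
    · simp only [Expr.eval, e₁₂.val, e₂.val, hM₂, e₁₂.mem, Stm.run, Op.eval]
      rfl
    · exact e₁₂.out
    · exact e₁₂.reg
  | emit e =>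
    obtain ⟨c, hc, ih⟩ := e.compile_spec
    refine ⟨c + 1, by omega, fun G Γ d s L h => ?_⟩
    obtain ⟨s₁, r₁, e₁, b₁⟩ := ih G Γ d s L h
    refine ⟨_, (r₁.seq ⟨_, le_rfl, .emit s₁ (.reg d)⟩).mono ?_, e₁.mem, ?_, e₁.reg⟩
    · simp only [Expr.cost, Expr.eval, e₁.val, height, pow_zero, mul_one]
      exact le_pow_of_le_mul h.hL (by omega)
    · simp only [Expr.eval, e₁.val, e₁.out, Stm.run]
  | seq p p' ih ih' =>
    obtain ⟨c, hc, ih⟩ := ih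
    obtain ⟨c', hc', ih'⟩ := ih'
    refine ⟨c + c' + 1, by omega, fun G Γ d s L h => ?_⟩
    obtain ⟨s₁, r₁, a₁⟩ := ih G Γ d s L h
    obtain ⟨s₂, r₂, a₂⟩ := ih' G Γ d s₁ L (h.after a₁)
    rw [a₁.mem, a₁.out, h.map_eq a₁.reg] at a₂
    refine ⟨s₂, (r₁.seq r₂).mono ?_, a₂.mem, a₂.out, fun r hr => (a₂.reg r hr).trans (a₁.reg r hr)⟩
    have h1 : (G.K + 1) ^ p.height ≤ (G.K + 1) ^ (Stm.seq p p').height :=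
      Nat.pow_le_pow_right (by omega) (le_max_left _ _)
    have h2 : (G.K + 1) ^ p'.height ≤ (G.K + 1) ^ (Stm.seq p p').height :=
      Nat.pow_le_pow_right (by omega) (le_max_right _ _)
    have p1 := Nat.mul_le_mul (pow_le_of_le h.hL (show c ≤ c + c' by omega)) h1
    have p2 := Nat.mul_le_mul (pow_le_of_le h.hL (show c' ≤ c + c' by omega)) h2
    have hL := h.hL
    calc _ ≤ 100 * (L ^ (c + c') * (G.K + 1) ^ (Stm.seq p p').height) := by omega
      _ ≤ L * (L ^ (c + c') * (G.K + 1) ^ (Stm.seq p p').height) := Nat.mul_le_mul_right _ hL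
      _ = _ := by ring
  | ite e p p' ih ih' =>
    obtain ⟨ce, hce, ihe⟩ := e.compile_spec
    obtain ⟨c, hc, ih⟩ := ih
    obtain ⟨c', hc', ih'⟩ := ih'
    refine ⟨ce + c + c' + 1, by omega, fun G Γ d s L h => ?_⟩
    obtain ⟨s₁, r₁, e₁, b₁⟩ := ihe G Γ d s L h
    have R1 : Ready G Γ d s₁ L := h.same e₁
    have h0 : 1 ≤ (G.K + 1) ^ (Stm.ite e p p').height := Nat.one_le_pow _ _ (by omega)
    have h1 : (G.K + 1) ^ p.height ≤ (G.K + 1) ^ (Stm.ite e p p').height :=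
      Nat.pow_le_pow_right (by omega) (le_max_left _ _)
    have h2 : (G.K + 1) ^ p'.height ≤ (G.K + 1) ^ (Stm.ite e p p').height :=
      Nat.pow_le_pow_right (by omega) (le_max_right _ _)
    have p1 := Nat.mul_le_mul (pow_le_of_le h.hL (show c ≤ ce + c + c' by omega)) h1
    have p2 := Nat.mul_le_mul (pow_le_of_le h.hL (show c' ≤ ce + c + c' by omega)) h2
    have p3 := Nat.mul_le_mul (pow_le_of_le h.hL (show ce ≤ ce + c + c' by omega)) h0
    have hL := h.hL
    have p4 : 1 ≤ L ^ ce := Nat.one_le_pow _ _ (by omega)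
    have fin : ∀ T, T ≤ 100 * (L ^ (ce + c + c') * (G.K + 1) ^ (Stm.ite e p p').height) →
        T ≤ L ^ (ce + c + c' + 1) * (G.K + 1) ^ (Stm.ite e p p').height := fun T hT =>
      hT.trans <| (Nat.mul_le_mul_right _ hL).trans_eq (by ring)
    by_cases hv : e.eval G s.mem (Γ.map s.reg) = 0
    · obtain ⟨s₂, r₂, a₂⟩ := ih' G Γ d s₁ L R1
      rw [e₁.mem, e₁.out, h.map_eq e₁.reg] at a₂
      have hev : (Stm.ite e p p').run G (Γ.map s.reg) ⟨s.mem, s.out⟩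
          = p'.run G (Γ.map s.reg) ⟨s.mem, s.out⟩ := by simp [Stm.run, hv]
      rw [hev]
      refine ⟨s₂, (r₁.seq (Run.branch_false (by simp [Expr.eval, e₁.val, hv]) r₂)).mono ?_,
        a₂.mem, a₂.out, fun r hr => (a₂.reg r hr).trans (e₁.reg r hr)⟩
      simp only [Expr.cost, e₁.val]
      exact fin _ (by omega)
    · obtain ⟨s₂, r₂, a₂⟩ := ih G Γ d s₁ L R1
      rw [e₁.mem, e₁.out, h.map_eq e₁.reg] at a₂
      have hev : (Stm.ite e p p').run G (Γ.map s.reg) ⟨s.mem, s.out⟩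
          = p.run G (Γ.map s.reg) ⟨s.mem, s.out⟩ := by simp [Stm.run, hv]
      rw [hev]
      refine ⟨s₂, (r₁.seq (Run.branch_true (by simp [Expr.eval, e₁.val, hv]) r₂)).mono ?_,
        a₂.mem, a₂.out, fun r hr => (a₂.reg r hr).trans (e₁.reg r hr)⟩
      simp only [Expr.cost, e₁.val]
      exact fin _ (by omega)
  | letIn e p ih =>
    obtain ⟨ce, hce, ihe⟩ := e.compile_spec
    obtain ⟨c, hc, ih⟩ := ih
    refine ⟨ce + ce * c + 1, by omega, fun G Γ d s L h => ?_⟩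
    obtain ⟨s₁, r₁, e₁, b₁⟩ := ihe G Γ d s L h
    obtain ⟨s₂, r₂, a₂⟩ := ih G (Γ ++ [d]) (d + 1) s₁ _
      (h.step e₁ b₁ (le_pow_self h.hL hce) (by omega) (by simp))
    have hρ : (Γ ++ [d]).map s₁.reg = Γ.map s.reg ++ [e.eval G s.mem (Γ.map s.reg)] := by
      simp [h.map_eq e₁.reg, e₁.val]
    rw [hρ, e₁.mem, e₁.out] at a₂
    rw [← pow_mul] at r₂
    refine ⟨s₂, (r₁.seq r₂).mono ?_, a₂.mem, a₂.out,
      fun r hr => (a₂.reg r (by omega)).trans (e₁.reg r hr)⟩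
    have h0 : 1 ≤ (G.K + 1) ^ p.height := Nat.one_le_pow _ _ (by omega)
    have p1 := Nat.mul_le_mul (pow_le_of_le h.hL (show ce ≤ ce + ce * c by omega)) h0
    have p2 := Nat.mul_le_mul_right ((G.K + 1) ^ p.height)
      (pow_le_of_le h.hL (show ce * c ≤ ce + ce * c by omega))
    refine le_trans ?_ ((Nat.mul_le_mul_right (L ^ (ce + ce * c) * (G.K + 1) ^ p.height)
      h.hL).trans_eq (by simp only [height]; ring))
    omega
  | call1 e p ih =>
    obtain ⟨ce, hce, ihe⟩ := e.compile_spec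
    obtain ⟨c, hc, ih⟩ := ih
    refine ⟨ce + ce * c + 1, by omega, fun G Γ d s L h => ?_⟩
    obtain ⟨s₁, r₁, e₁, b₁⟩ := ihe G Γ d s L h
    obtain ⟨s₂, r₂, a₂⟩ := ih G [d] (d + 1) s₁ _
      (h.step e₁ b₁ (le_pow_self h.hL hce) (by omega) (by simp))
    have hρ : [d].map s₁.reg = [e.eval G s.mem (Γ.map s.reg)] := by
      simp [e₁.val]
    rw [hρ, e₁.mem, e₁.out] at a₂
    rw [← pow_mul] at r₂
    refine ⟨s₂, (r₁.seq r₂).mono ?_, a₂.mem, a₂.out,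
      fun r hr => (a₂.reg r (by omega)).trans (e₁.reg r hr)⟩
    have h0 : 1 ≤ (G.K + 1) ^ p.height := Nat.one_le_pow _ _ (by omega)
    have p1 := Nat.mul_le_mul (pow_le_of_le h.hL (show ce ≤ ce + ce * c by omega)) h0
    have p2 := Nat.mul_le_mul_right ((G.K + 1) ^ p.height)
      (pow_le_of_le h.hL (show ce * c ≤ ce + ce * c by omega))
    refine le_trans ?_ ((Nat.mul_le_mul_right (L ^ (ce + ce * c) * (G.K + 1) ^ p.height)
      h.hL).trans_eq (by simp only [height]; ring))
    omega
  | call2 a b p ih =>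
    obtain ⟨ca, hca, iha⟩ := a.compile_spec
    obtain ⟨cb, hcb, ihb⟩ := b.compile_spec
    obtain ⟨c, hc, ih⟩ := ih
    refine ⟨ca + ca * cb + ca * (cb * c) + 1, by omega, fun G Γ d s L h => ?_⟩
    obtain ⟨s₁, r₁, e₁, b₁⟩ := iha G Γ d s L h
    have h1 := le_pow_self h.hL hca
    have R1 : Ready G (Γ ++ [d]) (d + 1) s₁ (L ^ ca) := h.step e₁ b₁ h1 (by omega) (by simp)
    obtain ⟨s₂, r₂, e₂, b₂⟩ := ihb G Γ (d + 1) s₁ _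
      (h.step e₁ b₁ h1 (by omega) fun _ hr => .inl hr)
    rw [e₁.mem, h.map_eq e₁.reg] at e₂ b₂
    have R2 : Ready G [d, d + 1] (d + 2) s₂ ((L ^ ca) ^ cb) :=
      R1.step e₂ b₂ (le_pow_self R1.hL hcb) (by omega) (by simp)
    obtain ⟨s₃, r₃, a₃⟩ := ih G [d, d + 1] (d + 2) s₂ _ R2
    have e₁₂ := e₁.trans e₂ (Nat.lt_succ_self d)
    have hρ : [d, d + 1].map s₂.reg
        = [a.eval G s.mem (Γ.map s.reg), b.eval G s.mem (Γ.map s.reg)] := by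
      simp [e₁₂.val, e₂.val]
    rw [hρ, e₁₂.mem, e₁₂.out] at a₃
    rw [← pow_mul] at r₂
    rw [← pow_mul, ← pow_mul] at r₃
    refine ⟨s₃, (r₁.seq (r₂.seq r₃)).mono ?_, a₃.mem, a₃.out,
      fun r hr => (a₃.reg r (by omega)).trans (e₁₂.reg r hr)⟩
    set C := ca + ca * cb + ca * (cb * c) with hC
    have h0 : 1 ≤ (G.K + 1) ^ p.height := Nat.one_le_pow _ _ (by omega)
    have p1 := Nat.mul_le_mul (pow_le_of_le h.hL (show ca ≤ C by omega)) h0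
    have p2 := Nat.mul_le_mul (pow_le_of_le h.hL (show ca * cb ≤ C by omega)) h0
    have p3 := Nat.mul_le_mul_right ((G.K + 1) ^ p.height)
      (pow_le_of_le h.hL (show ca * (cb * c) ≤ C by omega))
    refine le_trans ?_ ((Nat.mul_le_mul_right (L ^ C * (G.K + 1) ^ p.height)
      h.hL).trans_eq (by simp only [height]; ring))
    omega
  | loop long e p ih =>
    obtain ⟨ce, hce, ihe⟩ := e.compile_spec
    obtain ⟨c, hc, ih⟩ := ih
    refine ⟨2 * (ce + c + 1) + 2, by omega, fun G Γ d s L h => ?_⟩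
    obtain ⟨s₁, r₁, e₁, b₁⟩ := ihe G Γ d s L h
    set v := e.eval G s.mem (Γ.map s.reg) with hv
    set B := G.get (loopGlob long) with hB
    set cn := min v B with hcn
    set P := L ^ (ce + c + 1) with hP
    have hL := h.hL
    have p0 : 100 ≤ P := h.hL.trans (le_pow_self h.hL (by omega))
    have p1 : L ^ ce ≤ P := pow_le_of_le h.hL (by omega)
    have p2 : L ^ c ≤ P := pow_le_of_le h.hL (by omega)
    have p3 : L ≤ P := le_pow_self h.hL (by omega)
    have hBL : charge B ≤ L := h.hG _
    have hcB : cn ≤ B := min_le_right _ _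
    have hcnL : charge cn ≤ L := (charge_mono hcB).trans hBL
    have hB₁ : s₁.reg (loopGlob long).idx = B := by
      rw [e₁.reg _ ((Glob.idx_lt _).trans_le h.hd), h.reg]
    have hmul : charge B * charge v ≤ P * P := Nat.mul_le_mul (hBL.trans p3) (b₁.trans p1)
    obtain ⟨s₂, r₂, e₂⟩ : ∃ s₂, Run (.branch (.op .lt (.reg (loopGlob long).idx) (.reg d))
            (.assign d (.reg (loopGlob long).idx)) .skip) s₁ s₂ (P * P + 10 * P)
            ∧ Ext d s₁ s₂ cn := by
      by_cases hlt : B < v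
      · refine ⟨_, (Run.branch_true ?_ (Run.assign s₁ d (.reg (loopGlob long).idx))).mono ?_, ?_⟩
        · simp [Expr.eval, Op.eval, hB₁, e₁.val, hlt]
        · simp only [Expr.cost, Expr.eval, hB₁, e₁.val]
          omega
        · have := Ext.assign d s₁ (.reg (loopGlob long).idx)
          have h2 : cn = B := min_eq_right hlt.le
          rw [h2]
          simpa only [Expr.eval, hB₁] using this
      · refine ⟨_, (Run.branch_false ?_ (Run.skip s₁)).mono ?_, ?_⟩
        · simp [Expr.eval, Op.eval, hB₁, e₁.val, hlt]
        · simp only [Expr.cost, Expr.eval, hB₁, e₁.val]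
          omega
        · have h2 : cn = v := min_eq_left (by omega)
          rw [h2]
          exact ⟨rfl, rfl, fun _ _ => rfl, e₁.val⟩
    have e₁₂ := e₁.comp e₂
    have e₃ := Ext.assign (d + 1) s₂ (.lit 0)
    have r₃ := Run.assign s₂ (d + 1) (.lit 0)
    have e₁₃ := e₁₂.trans e₃ (by omega)
    set s₃ : State := { s₂ with reg := Function.update s₂.reg (d + 1) ((Expr.lit 0).eval s₂) }
    set f : ℕ → Store → Store := fun i σ => p.run G (Γ.map s.reg ++ [i]) σ with hf
    have hmem : ∀ j, ∀ a, charge ((iterFrom f ⟨s.mem, s.out⟩ j).mem a) ≤ L := by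
      intro j
      induction j with
      | zero => exact h.hmem
      | succ j ih => exact fun a => charge_run_le h.hM (h.hG .M) ih a
    have hz : charge 0 = 1 := rfl
    have hone : charge 1 = 2 := rfl
    set H := (G.K + 1) ^ p.height with hH
    have h0 : 1 ≤ H := Nat.one_le_pow _ _ (by omega)
    obtain ⟨s₄, r₄, a₄, -, -⟩ := Run.count_loop
      (body := .seq (p.compile (Γ ++ [d + 1]) (d + 2))
                (.assign (d + 1) (.op .add (.reg (d + 1)) (.lit 1))))
      (i := d + 1) (b := d) (cnt := cn) (T := L ^ c * H + 10 * P)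
      (fun j s' => After d s s' (iterFrom f ⟨s.mem, s.out⟩ j) ∧ s'.reg d = cn ∧
        s'.reg (d + 1) = j)
      (fun j s' hI => ⟨hI.2.2, hI.2.1⟩)
      (by
        rintro j hj t ⟨ht, ht1, ht2⟩
        have hjL : charge j ≤ L := (charge_mono hj.le).trans hcnL
        have R : Ready G (Γ ++ [d + 1]) (d + 2) t L :=
          { hL := h.hL, hN := h.hN, hM := h.hM, hG := h.hG
            reg := fun x => by rw [ht.reg _ (x.idx_lt.trans_le h.hd), h.reg]
            hd := by have := h.hd; omega
            hΓ := by
              intro r hr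
              simp only [List.mem_append, List.mem_cons, List.not_mem_nil, or_false] at hr
              rcases hr with hr | rfl
              · obtain ⟨h2, h3⟩ := h.hΓ r hr
                exact ⟨by omega, by rw [ht.reg _ h2]; exact h3⟩
              · exact ⟨by omega, by rw [ht2]; exact hjL⟩
            hmem := fun a => by rw [ht.mem]; exact hmem j a }
        obtain ⟨t₁, q₁, f₁⟩ := ih G _ (d + 2) t _ R
        have hρ : (Γ ++ [d + 1]).map t.reg = Γ.map s.reg ++ [j] := by
          simp [ht2, h.map_eq ht.reg]
        rw [hρ, ht.mem, ht.out] at f₁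
        refine ⟨_, (q₁.seq (Run.assign _ (d + 1) (.op .add (.reg (d + 1)) (.lit 1)))).mono ?_,
          ⟨?_, ?_, fun r hr => ?_⟩, ?_, ?_⟩
        · simp only [Expr.cost, Expr.eval, f₁.reg _ (show d + 1 < d + 2 by omega), ht2]
          have w3 := charge_op_le .add j 1
          have w4 : L ^ c * (G.K + 1) ^ p.height = L ^ c * H := rfl
          rw [hone] at *
          omega
        · exact f₁.mem
        · exact f₁.out
        · simp only
          rw [Function.update_of_ne (by omega), f₁.reg _ (by omega), ht.reg _ hr]
        · simp only
          rw [Function.update_of_ne (by omega), f₁.reg _ (by omega), ht1]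
        · simp only
          rw [Function.update_self]
          simp only [Expr.eval, Op.eval]
          rw [f₁.reg _ (by omega), ht2])
      (s := s₃) ⟨⟨e₁₃.mem, e₁₃.out, e₁₃.reg⟩, by rw [e₃.reg _ (by omega), e₂.val], e₃.val⟩
    refine ⟨s₄, (r₁.seq (r₂.seq (r₃.seq r₄))).mono ?_, a₄⟩
    have hexp : L ^ (2 * (ce + c + 1)) = P * P := by rw [hP, ← pow_add]; ring_nf
    have hPP : 100 * P ≤ P * P := Nat.mul_le_mul_right _ p0
    -- A long loop raises the height and is paid for by the extra factor `K + 1`; a short loop has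
    -- at most `N ≤ L` rounds and is paid for by a factor of order `L`.
    have hcn1 : (cn + 1) * H ≤ 2 * L * (G.K + 1) ^ (Stm.loop long e p).height := by
      cases long with
      | true =>
        have : cn ≤ G.K := hcB
        simp only [height, if_true, pow_succ]
        rw [← hH]
        calc (cn + 1) * H ≤ (G.K + 1) * H := Nat.mul_le_mul_right _ (by omega)
          _ = 1 * (H * (G.K + 1)) := by ring
          _ ≤ 2 * L * (H * (G.K + 1)) := Nat.mul_le_mul_right _ (by omega)
      | false =>
        have : cn ≤ G.N := hcB
        have := h.hN
        simp only [height]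
        exact Nat.mul_le_mul_right _ (by omega)
    have w1 : L ^ c * H + 10 * P + (2 * charge cn + charge cn * charge cn + 1)
        ≤ 3 * (P * P) * H := by
      have w2 : charge cn * charge cn ≤ P * P :=
        Nat.mul_le_mul (hcnL.trans p3) (hcnL.trans p3)
      have w3 : L ^ c * H ≤ (P * P) * H := Nat.mul_le_mul_right _ (by omega)
      have w4 : P * P * 1 ≤ P * P * H := Nat.mul_le_mul_left _ h0
      have w5 : 3 * (P * P) * H = 3 * (P * P * H) := by ring
      omega
    have w6 := Nat.mul_le_mul_left (cn + 1) w1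
    have w7 : (cn + 1) * (3 * (P * P) * H) = 3 * (P * P) * ((cn + 1) * H) := by ring
    have w8 := Nat.mul_le_mul_left (3 * (P * P)) hcn1
    set H' := (G.K + 1) ^ (Stm.loop long e p).height
    have h0' : 1 ≤ H' := Nat.one_le_pow _ _ (by omega)
    have w9 : 3 * (P * P) * (2 * L * H') = 6 * (P * P * L * H') := by ring
    have w10 : P * P * 1 * 1 ≤ P * P * L * H' :=
      Nat.mul_le_mul (Nat.mul_le_mul_left _ (by omega)) h0'
    have w11 : L ^ (2 * (ce + c + 1) + 2) * H' = L * (P * P * L * H') := by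
      rw [pow_add, hexp]; ring
    have w12 := Nat.mul_le_mul_right (P * P * L * H') hL
    simp only [Expr.cost, Expr.eval, hz]
    omega

end Ram

/-! ### Evaluation rules and the numerical subroutines -/

namespace Ram

instance : Add Exp := ⟨.op .add⟩
instance : Sub Exp := ⟨.op .sub⟩
instance : Mul Exp := ⟨.op .mul⟩
instance : Div Exp := ⟨.op .div⟩
instance : Mod Exp := ⟨.op .mod⟩
instance (a : ℕ) : OfNat Exp a := ⟨.lit a⟩

/-- The comparison of two values. -/
def Exp.same (a b : Exp) : Exp := .op .eq a b

section eval
variable (G : Globals) (mem : ℕ → ℕ) (ρ : List ℕ) (a b c f : Exp)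

@[simp] theorem Exp.eval_add : (a + b).eval G mem ρ = a.eval G mem ρ + b.eval G mem ρ := rfl
@[simp] theorem Exp.eval_sub : (a - b).eval G mem ρ = a.eval G mem ρ - b.eval G mem ρ := rfl
@[simp] theorem Exp.eval_mul : (a * b).eval G mem ρ = a.eval G mem ρ * b.eval G mem ρ := rfl
@[simp] theorem Exp.eval_div : (a / b).eval G mem ρ = a.eval G mem ρ / b.eval G mem ρ := rfl
@[simp] theorem Exp.eval_mod : (a % b).eval G mem ρ = a.eval G mem ρ % b.eval G mem ρ := rfl
@[simp] theorem Exp.eval_two : (2 : Exp).eval G mem ρ = 2 := rfl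
@[simp] theorem Exp.eval_four : (4 : Exp).eval G mem ρ = 4 := rfl
@[simp] theorem Exp.eval_zero : (0 : Exp).eval G mem ρ = 0 := rfl
@[simp] theorem Exp.eval_one : (1 : Exp).eval G mem ρ = 1 := rfl
@[simp] theorem Exp.eval_lit (x : ℕ) : (Exp.lit x).eval G mem ρ = x := rfl
@[simp] theorem Exp.eval_var (i : ℕ) : (Exp.var i).eval G mem ρ = ρ.getD i 0 := rfl
@[simp] theorem Exp.eval_N : (Exp.glob .N).eval G mem ρ = G.N := rfl
@[simp] theorem Exp.eval_n : (Exp.glob .n).eval G mem ρ = G.n := rfl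
@[simp] theorem Exp.eval_k : (Exp.glob .k).eval G mem ρ = G.k := rfl
@[simp] theorem Exp.eval_m : (Exp.glob .m).eval G mem ρ = G.m := rfl
@[simp] theorem Exp.eval_q : (Exp.glob .q).eval G mem ρ = G.q := rfl
@[simp] theorem Exp.eval_load : (Exp.load a).eval G mem ρ = mem (a.eval G mem ρ) := rfl
@[simp] theorem Exp.eval_same : (a.same b).eval G mem ρ =
    if a.eval G mem ρ = b.eval G mem ρ then 1 else 0 := rfl
@[simp] theorem Exp.eval_ite : (Exp.ite c a b).eval G mem ρ =
    if c.eval G mem ρ ≠ 0 then a.eval G mem ρ else b.eval G mem ρ := rfl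
@[simp] theorem Exp.eval_app1 : (Exp.app1 f a).eval G mem ρ = f.eval G mem [a.eval G mem ρ] := rfl
@[simp] theorem Exp.eval_app2 : (Exp.app2 f a b).eval G mem ρ =
    f.eval G mem [a.eval G mem ρ, b.eval G mem ρ] := rfl
@[simp] theorem Exp.eval_app3 : (Exp.app3 f a b c).eval G mem ρ =
    f.eval G mem [a.eval G mem ρ, b.eval G mem ρ, c.eval G mem ρ] := rfl

theorem Exp.eval_iter (h : c.eval G mem ρ ≤ G.N) : (Exp.iter c a b).eval G mem ρ =
    iterMod G.M (fun i x => b.eval G mem (ρ ++ [i, x])) (a.eval G mem ρ) (c.eval G mem ρ) := by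
  simp only [Exp.eval, min_eq_left h]

end eval

section iterMod
variable {M : ℕ} {f : ℕ → ℕ → ℕ} {c : ℕ}

/-- The reduction modulo `M` is invisible as long as the intended intermediate values stay below
`M`. Correctness proofs of the subroutines pass through this rule to get rid of the modulus. -/
theorem iterMod_eq (x : ℕ → ℕ) (hx : ∀ i < c, f i (x i) = x (i + 1))
    (hM : ∀ i < c, x (i + 1) < M) : iterMod M f (x 0) c = x c := by
  induction c with
  | zero => rfl
  | succ c ih =>
    rw [iterMod, ih (fun i hi => hx i (by omega)) (fun i hi => hM i (by omega)), hx c (by omega),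
      Nat.mod_eq_of_lt (hM c (by omega))]

theorem iterMod_search {P : ℕ → Prop} [DecidablePred P] (hf : ∀ i < c, ∀ x,
    f i x = if P i then i else x) {i₀ : ℕ} (h0 : i₀ < c) (hP : ∀ i < c, P i ↔ i = i₀)
    (hM : c ≤ M) : iterMod M f 0 c = i₀ := by
  have := iterMod_eq (M := M) (f := f) (c := c) (fun i => if i₀ < i then i₀ else 0) ?_ ?_
  · simpa [h0] using this
  · intro i hi
    rw [hf i hi]
    by_cases h : i = i₀
    · rw [if_pos ((hP i hi).2 h), if_pos (by omega), h]
    · have : ¬ P i := fun h' => h ((hP i hi).1 h')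
      simp only [this, if_false]
      congr 1
      simp only [eq_iff_iff]; omega
  · intro i hi
    split_ifs <;> omega

theorem iterMod_exists {P : ℕ → Prop} [DecidablePred P] [Decidable (∃ i < c, P i)]
    (hf : ∀ i < c, ∀ x, f i x = if P i then 1 else x) (hM : 1 < M) :
    iterMod M f 0 c = if ∃ i < c, P i then 1 else 0 := by
  classical
  have := iterMod_eq (M := M) (f := f) (c := c) (fun i => if ∃ j < i, P j then 1 else 0) ?_ ?_
  · simp only [not_lt_zero, false_and, exists_false, if_false] at this
    rw [this]
    congr
  · intro i hi
    rw [hf i hi]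
    simp only [Nat.lt_succ_iff_lt_or_eq, or_and_right, exists_or, exists_eq_left]
    by_cases h : P i <;> simp [h]
  · intro i hi
    split_ifs <;> omega

theorem iterMod_forall {P : ℕ → Prop} [DecidablePred P] [Decidable (∀ i < c, P i)]
    (hf : ∀ i < c, ∀ x, f i x = if P i then x else 0) (hM : 1 < M) :
    iterMod M f 1 c = if ∀ i < c, P i then 1 else 0 := by
  classical
  have := iterMod_eq (M := M) (f := f) (c := c) (fun i => if ∀ j < i, P j then 1 else 0) ?_ ?_
  · simp only [not_lt_zero, false_imp_iff, implies_true, if_true] at this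
    rw [this]
    congr
  · intro i hi
    rw [hf i hi]
    simp only [Nat.lt_succ_iff_lt_or_eq, or_imp, forall_and, forall_eq]
    by_cases h : P i <;> simp [h]
  · intro i hi
    split_ifs <;> omega

end iterMod

/-- The number with the digits `f 0, …, f (c - 1)` to the base `b`. -/
def tab (b : ℕ) (f : ℕ → ℕ) (c : ℕ) : ℕ := ∑ p ∈ Finset.range c, f p * b ^ p

theorem tab_congr {b c : ℕ} {f g : ℕ → ℕ} (h : ∀ i < c, f i = g i) : tab b f c = tab b g c :=
  Finset.sum_congr rfl fun i hi => by rw [h i (Finset.mem_range.1 hi)]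

theorem tab_lt {b c : ℕ} {f : ℕ → ℕ} (h : ∀ i < c, f i < b) : tab b f c < b ^ c := by
  induction c with
  | zero => simp [tab]
  | succ c ih =>
    have h1 := ih fun i hi => h i (by omega)
    have h2 := h c (by omega)
    have h3 : tab b f (c + 1) = tab b f c + f c * b ^ c := Finset.sum_range_succ _ _
    have h4 : (f c + 1) * b ^ c ≤ b * b ^ c := Nat.mul_le_mul_right _ h2
    rw [h3, pow_succ, mul_comm (b ^ c) b]
    linarith

theorem tab_digit {b c i : ℕ} {f : ℕ → ℕ} (h : ∀ i < c, f i < b) (hi : i < c) :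
    tab b f c / b ^ i % b = f i := by
  have hb : 0 < b := by have := h i hi; omega
  obtain ⟨r, rfl⟩ := Nat.exists_eq_add_of_le (show i + 1 ≤ c by omega)
  -- The number is cut at the place `i`: the part below is less than `b ^ i` and vanishes in the
  -- division, the part above is a multiple of `b` and vanishes in the remainder.
  have h1 : tab b f (i + 1 + r) = tab b f i + b ^ i * (f i + b * tab b (fun j => f (i + 1 + j)) r) := by
    unfold tab
    rw [Finset.sum_range_add, Finset.sum_range_succ, Finset.mul_sum, mul_add, Finset.mul_sum,
      add_assoc]
    congr 1
    rw [mul_comm]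
    congr 1
    apply Finset.sum_congr rfl
    intro j _
    rw [pow_add, pow_succ]; ring
  have h2 : tab b f i < b ^ i := tab_lt fun j hj => h j (by omega)
  rw [h1, Nat.add_mul_div_left _ _ (pow_pos hb i), Nat.div_eq_of_lt h2, zero_add,
    Nat.add_mul_mod_self_left, Nat.mod_eq_of_lt (h i hi)]

theorem tab_digits (b c x : ℕ) : tab b (fun i => x / b ^ i % b) c = x % b ^ c := by
  induction c with
  | zero => simp [tab, Nat.mod_one]
  | succ c ih =>
    rw [Nat.mod_pow_succ, ← ih, mul_comm (b ^ c)]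
    exact Finset.sum_range_succ _ _

theorem iterMod_tab {M b c : ℕ} {g : ℕ → ℕ → ℕ} {f : ℕ → ℕ}
    (hg : ∀ i < c, ∀ x, g i x = x + f i * b ^ i) (hf : ∀ i < c, f i < b) (hM : b ^ c ≤ M) :
    iterMod M g 0 c = tab b f c := by
  have hb : c ≠ 0 → 0 < b := fun h => by have := hf 0 (by omega); omega
  refine iterMod_eq (fun i => tab b f i) (fun i hi => ?_) fun i hi => ?_
  · rw [hg i hi]; exact (Finset.sum_range_succ _ _).symm
  · exact (tab_lt fun j hj => hf j (by omega)).trans_le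
      ((Nat.pow_le_pow_right (hb (by omega)) (by omega)).trans hM)

/-- Arguments `b, e`: the power `b ^ e`. -/
def powF : Exp := .iter (.var 1) 1 (.var 3 * .var 0)

/-- Arguments `b, x, i`: the digit of `x` at the place `i` to the base `b`. -/
def digF : Exp := .var 1 / .app2 powF (.var 0) (.var 2) % .var 0

/-- Arguments `a, b`: the sum of two field elements. -/
def addF : Exp := .load (4 + .var 0 * .glob .q + .var 1)

/-- Arguments `a, b`: the product of two field elements. -/
def mulF : Exp := .load (4 + .glob .q * .glob .q + .var 0 * .glob .q + .var 1)

/-- The zero of the field (with a dummy argument). -/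
def zeroF : Exp :=
  -- The numbering of the field is arbitrary, so zero has to be found: it is the only solution of `a
  -- + a = a`.
  .iter (.glob .q) 0 (.ite ((Exp.app2 addF (.var 1) (.var 1)).same (.var 1)) (.var 1) (.var 2))

/-- The one of the field (with a dummy argument). -/
def oneF : Exp :=
  -- One is the only nonzero idempotent.
  .iter (.glob .q) 0 (.ite ((Exp.app2 mulF (.var 1) (.var 1)).same (.var 1))
    (.ite ((Exp.var 1).same (.app1 zeroF 0)) (.var 2) (.var 1)) (.var 2))

/-- Arguments `x, y`: the sum of two vectors. -/
def vaddF : Exp :=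
  .iter (.glob .n) 0 (.var 3 + .app2 addF (.app3 digF (.glob .q) (.var 0) (.var 2))
    (.app3 digF (.glob .q) (.var 1) (.var 2)) * .app2 powF (.glob .q) (.var 2))

/-- Arguments `c, x`: the multiple of a vector. -/
def smulF : Exp :=
  .iter (.glob .n) 0 (.var 3 + .app2 mulF (.var 0)
    (.app3 digF (.glob .q) (.var 1) (.var 2)) * .app2 powF (.glob .q) (.var 2))

/-- Arguments `a, x`: the product of the row at the address `a` with the vector `x`. -/
def rowF : Exp :=
  .iter (.glob .n) (.app1 zeroF 0) (.app2 addF (.var 3)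
    (.app2 mulF (.load (.var 0 + .var 2)) (.app3 digF (.glob .q) (.var 1) (.var 2))))

/-- Arguments `a, x`: the product of the matrix at the address `a` with the vector `x`. -/
def mvecF : Exp :=
  .iter (.glob .n) 0 (.var 3 + .app2 rowF (.var 0 + .var 2 * .glob .n) (.var 1) *
    .app2 powF (.glob .q) (.var 2))

/-- Argument `a`: the table of the matrix at the address `a`. -/
def matF : Exp :=
  .iter (.glob .N) 0 (.var 2 + .app2 mvecF (.var 0) (.var 1) * .app2 powF (.glob .N) (.var 1))

/-- Arguments `g, p`: the image of `p` under the table `g`. -/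
def appF : Exp := .app3 digF (.glob .N) (.var 0) (.var 1)

/-- Arguments `g, h`: the composition of two tables. -/
def compF : Exp :=
  .iter (.glob .N) 0 (.var 3 + .app2 appF (.var 0) (.app2 appF (.var 1) (.var 2)) *
    .app2 powF (.glob .N) (.var 2))

/-- Arguments `g, y`: the preimage of `y` under the table `g`. -/
def preF : Exp :=
  .iter (.glob .N) 0 (.ite ((Exp.app2 appF (.var 0) (.var 2)).same (.var 1)) (.var 2) (.var 3))

/-- Argument `g`: the inverse of a table. -/
def invF : Exp :=
  .iter (.glob .N) 0 (.var 2 + .app2 preF (.var 0) (.var 1) * .app2 powF (.glob .N) (.var 1))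

/-- The table of the identity (with a dummy argument). -/
def idF : Exp := .iter (.glob .N) 0 (.var 2 + .var 1 * .app2 powF (.glob .N) (.var 1))

/-- Arguments `B, p`: whether `p` is in the set `B`. -/
def bitF : Exp := .app3 digF 2 (.var 0) (.var 1)

/-- Arguments `B, x, y`: whether `x` is in the span of the subspace `B` and `y`. -/
def memF : Exp :=
  .iter (.glob .q) 0 (.ite (.app2 bitF (.var 0) (.app2 vaddF (.var 1)
    (.app2 smulF (.var 3) (.var 2)))) 1 (.var 4))

/-- Arguments `B, y`: the span of the subspace `B` and `y`. -/
def extF : Exp :=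
  .iter (.glob .N) 0 (.var 3 + .app3 memF (.var 0) (.var 2) (.var 1) *
    .app2 powF 2 (.var 2))

/-- Arguments `B, B'`: whether the set `B` is contained in `B'`. -/
def subF : Exp :=
  .iter (.glob .N) 1 (.ite (.app2 bitF (.var 0) (.var 2))
    (.ite (.app2 bitF (.var 1) (.var 2)) (.var 3) 0) (.var 3))

/-- Argument `a`: the vector at the address `a`. -/
def vecF : Exp := .iter (.glob .n) 0 (.var 2 + .load (.var 0 + .var 1) *
  .app2 powF (.glob .q) (.var 1))

/-- The zero vector (with a dummy argument). -/
def vzeroF : Exp := .iter (.glob .n) 0 (.var 2 + .app1 zeroF 0 * .app2 powF (.glob .q) (.var 1))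

/-- Arguments `a, j`: the span of the first `j` vectors of the list at the address `a`. -/
def spanF : Exp :=
  .iter (.var 1) (.app2 powF 2 (.app1 vzeroF 0))
    (.app2 extF (.var 3) (.app1 vecF (.var 0 + .var 2 * .glob .n)))

/-- Argument `j`: the `j`-th unit vector. -/
def unitF : Exp :=
  .iter (.glob .n) 0 (.var 2 + .ite ((Exp.var 1).same (.var 0)) (.app1 oneF 0) (.app1 zeroF 0) *
    .app2 powF (.glob .q) (.var 1))

end Ram

/-! ### Consistent parameters and the tables of the field -/

namespace SubspTrans

open Ram Matrix

variable {F : Type} [Field F] {G : Globals} {code : F ≃ Fin G.q} {mem : ℕ → ℕ}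

/-- The parameters are consistent and the memory holds the tables of the field. -/
structure Tables (G : Globals) (code : F ≃ Fin G.q) (mem : ℕ → ℕ) : Prop where
  hq : 2 ≤ G.q
  hn : 1 ≤ G.n
  hN : G.N = G.q ^ G.n
  -- Tables of `N` values below `N`, and sets of points coded in `N` bits, are then not affected by
  -- the reduction modulo `M`.
  hM : G.N ^ G.N < G.M
  hbase : 4 + 2 * (G.q * G.q) ≤ G.base
  add : ∀ a b : F, mem (4 + (code a : ℕ) * G.q + code b) = code (a + b)
  mul : ∀ a b : F, mem (4 + G.q * G.q + (code a : ℕ) * G.q + code b) = code (a * b)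

namespace Tables

variable (T : Tables G code mem)
include T

theorem q_le : G.q ≤ G.N := by
  rw [T.hN]; exact Nat.le_self_pow (by have := T.hn; omega) _

theorem two_le : 2 ≤ G.N := T.hq.trans T.q_le

theorem n_lt : G.n < G.N := by rw [T.hN]; exact Nat.lt_pow_self T.hq

theorem pow_lt {b e : ℕ} (hb : b ≤ G.N) (he : e ≤ G.N) : b ^ e < G.M :=
  ((Nat.pow_le_pow_left hb e).trans (Nat.pow_le_pow_right (by have := T.two_le; omega) he)).trans_lt
    T.hM

theorem N_lt : G.N < G.M := by
  simpa using T.pow_lt le_rfl (show 1 ≤ G.N by have := T.two_le; omega)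

theorem eval_powF {b e : ℕ} (hb : b ≤ G.N) (he : e ≤ G.N) : powF.eval G mem [b, e] = b ^ e := by
  rw [powF, Exp.eval_iter _ _ _ _ _ _ (by simpa using he)]
  refine iterMod_eq (fun i => b ^ i) (fun i hi => ?_) fun i hi => ?_
  · simp [pow_succ]
  · simp only [Exp.eval_var, List.getD_cons_succ, List.getD_cons_zero] at hi
    exact T.pow_lt hb (by omega)

theorem eval_digF {b x i : ℕ} (hb : b ≤ G.N) (hi : i ≤ G.N) :
    digF.eval G mem [b, x, i] = x / b ^ i % b := by
  simp [digF, T.eval_powF hb hi]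

end Tables

end SubspTrans

/-! ### Numbers for vectors, matrices and subspaces; correctness of the subroutines -/

namespace SubspTrans

open Ram Matrix

variable {F : Type} [Field F] {G : Globals}

/-- The number of a vector. -/
def vc (code : F ≃ Fin G.q) (x : Fin G.n → F) : ℕ :=
  tab G.q (fun i => if h : i < G.n then (code (x ⟨i, h⟩) : ℕ) else 0) G.n

/-- The vector with a given number. -/
def vec [NeZero G.q] (code : F ≃ Fin G.q) (p : ℕ) : Fin G.n → F :=
  fun i => code.symm (Fin.ofNat G.q (p / G.q ^ (i : ℕ)))

/-- The action of an invertible matrix on the numbers of vectors. -/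
def act [NeZero G.q] (code : F ≃ Fin G.q) (g : GL (Fin G.n) F) (p : ℕ) : ℕ :=
  vc code ((g : Matrix (Fin G.n) (Fin G.n) F) *ᵥ vec code p)

/-- The number of an invertible matrix, which encodes its table. -/
def pc [NeZero G.q] (code : F ≃ Fin G.q) (g : GL (Fin G.n) F) : ℕ :=
  tab G.N (act code g) G.N

open Classical in
/-- The number of a subspace, whose binary digits are its characteristic function. -/
noncomputable def bm [NeZero G.q] (code : F ≃ Fin G.q) (U : Submodule F (Fin G.n → F)) : ℕ :=
  tab 2 (fun p => if vec code p ∈ U then 1 else 0) G.N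

/-- The span of the first `j` vectors. -/
def flag {n k : ℕ} (x : Fin k → Fin n → F) (j : ℕ) : Submodule F (Fin n → F) :=
  Submodule.span F {y | ∃ i : Fin k, (i : ℕ) < j ∧ x i = y}

theorem flag_zero {n k : ℕ} (x : Fin k → Fin n → F) : flag x 0 = ⊥ := by simp [flag]

theorem flag_succ {n k : ℕ} (x : Fin k → Fin n → F) (i : Fin k) :
    flag x (i + 1) = flag x i ⊔ Submodule.span F {x i} := by
  rw [flag, flag, ← Submodule.span_union]
  congr 1
  ext y
  simp only [Set.mem_ofPred_eq, Set.mem_union, Set.mem_singleton_iff, Nat.lt_succ_iff_lt_or_eq,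
    or_and_right, exists_or]
  constructor
  · rintro (h | ⟨i', h, h'⟩)
    · exact .inl h
    · rw [← h', Fin.ext h]; exact .inr rfl
  · rintro (h | h)
    · exact .inl h
    · exact .inr ⟨i, rfl, h.symm⟩

variable [NeZero G.q] {code : F ≃ Fin G.q} {mem : ℕ → ℕ}

theorem vc_digit_lt (x : Fin G.n → F) (i : ℕ) :
    (if h : i < G.n then (code (x ⟨i, h⟩) : ℕ) else 0) < G.q := by
  split_ifs
  · exact (code _).2
  · exact Nat.pos_of_ne_zero (NeZero.ne _)

theorem vc_lt_pow (x : Fin G.n → F) : vc code x < G.q ^ G.n :=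
  tab_lt fun i _ => vc_digit_lt x i

theorem vc_digit (x : Fin G.n → F) {i : ℕ} (hi : i < G.n) :
    vc code x / G.q ^ i % G.q = code (x ⟨i, hi⟩) := by
  rw [vc, tab_digit (fun i _ => vc_digit_lt x i) hi, dif_pos hi]

theorem vec_vc (x : Fin G.n → F) : vec code (vc code x) = x := by
  funext i
  rw [vec, Equiv.symm_apply_eq]
  apply Fin.ext
  exact vc_digit x i.2

theorem vc_vec_pow {p : ℕ} (hp : p < G.q ^ G.n) : vc code (vec code p) = p := by
  rw [vc, ← Nat.mod_eq_of_lt hp, ← tab_digits]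
  refine tab_congr fun i hi => ?_
  rw [dif_pos hi, tab_digits, Nat.mod_eq_of_lt hp]
  simp [vec]

theorem vc_injective : Function.Injective (vc code : (Fin G.n → F) → ℕ) :=
  Function.LeftInverse.injective vec_vc

theorem act_vc (g : GL (Fin G.n) F) (x : Fin G.n → F) :
    act code g (vc code x) = vc code ((g : Matrix (Fin G.n) (Fin G.n) F) *ᵥ x) := by
  rw [act, vec_vc]

theorem act_mul (g h : GL (Fin G.n) F) (p : ℕ) :
    act code (g * h) p = act code g (act code h p) := by
  rw [act, act, act, vec_vc, Units.val_mul, Matrix.mulVec_mulVec]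

theorem flag_of_ge {n k : ℕ} (x : Fin k → Fin n → F) {j : ℕ} (h : k ≤ j) :
    flag x j = Submodule.span F (Set.range x) := by
  rw [flag]
  congr 1
  ext y
  simp only [Set.mem_ofPred_eq, Set.mem_range]
  exact ⟨fun ⟨i, _, hi⟩ => ⟨i, hi⟩, fun ⟨i, hi⟩ => ⟨i, by omega, hi⟩⟩

namespace Tables

variable (T : Tables G code mem)
include T

theorem vc_lt (x : Fin G.n → F) : vc code x < G.N := by rw [T.hN]; exact vc_lt_pow x

theorem vc_vec {p : ℕ} (hp : p < G.N) : vc code (vec code p) = p :=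
  vc_vec_pow (by rwa [← T.hN])

theorem act_lt (g : GL (Fin G.n) F) (p : ℕ) : act code g p < G.N := T.vc_lt _

theorem act_one {p : ℕ} (hp : p < G.N) : act code (1 : GL (Fin G.n) F) p = p := by
  rw [act, Units.val_one, Matrix.one_mulVec, T.vc_vec hp]

theorem act_inv {p : ℕ} (hp : p < G.N) (g : GL (Fin G.n) F) :
    act code g⁻¹ (act code g p) = p := by
  rw [← act_mul, inv_mul_cancel, T.act_one hp]

theorem eq_of_act_eq {g h : GL (Fin G.n) F} (e : ∀ p < G.N, act code g p = act code h p) :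
    g = h := by
  apply Units.ext
  apply Matrix.mulVec_injective
  funext x
  have := e _ (T.vc_lt x)
  rw [act_vc, act_vc] at this
  exact vc_injective this

theorem pc_lt (g : GL (Fin G.n) F) : pc code g < G.N ^ G.N := tab_lt fun p _ => T.act_lt g p

theorem pc_digit (g : GL (Fin G.n) F) {p : ℕ} (hp : p < G.N) :
    pc code g / G.N ^ p % G.N = act code g p := tab_digit (fun p _ => T.act_lt g p) hp

theorem pc_injective : Function.Injective (pc code : GL (Fin G.n) F → ℕ) := fun g h e =>
  T.eq_of_act_eq fun p hp => by rw [← T.pc_digit g hp, ← T.pc_digit h hp, e]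

theorem bm_digit_lt (U : Submodule F (Fin G.n → F)) (p : ℕ) [Decidable (vec code p ∈ U)] :
    (if vec code p ∈ U then 1 else 0) < 2 := by split_ifs <;> norm_num

open Classical in
theorem bm_lt (U : Submodule F (Fin G.n → F)) : bm code U < 2 ^ G.N :=
  tab_lt fun p _ => T.bm_digit_lt U p

theorem bm_lt_M (U : Submodule F (Fin G.n → F)) : bm code U < G.M :=
  (T.bm_lt U).trans (T.pow_lt T.two_le le_rfl)

open Classical in
theorem bm_digit (U : Submodule F (Fin G.n → F)) (x : Fin G.n → F) :
    bm code U / 2 ^ vc code x % 2 = if x ∈ U then 1 else 0 := by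
  rw [bm, tab_digit (fun p _ => T.bm_digit_lt U p) (T.vc_lt x), vec_vc]

theorem bm_injective : Function.Injective (bm code : Submodule F (Fin G.n → F) → ℕ) := by
  classical
  intro U U' e
  ext x
  have h1 := T.bm_digit U x
  rw [e, T.bm_digit U' x] at h1
  by_cases h : x ∈ U <;> by_cases h' : x ∈ U' <;> simp_all

theorem eval_addF (a b : F) : addF.eval G mem [code a, code b] = code (a + b) := by
  simp [addF, T.add]

theorem eval_mulF (a b : F) : mulF.eval G mem [code a, code b] = code (a * b) := by
  simp [mulF, T.mul]

theorem eval_zeroF (x : ℕ) : zeroF.eval G mem [x] = code (0 : F) := by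
  rw [zeroF, Exp.eval_iter _ _ _ _ _ _ (by simpa using T.q_le)]
  refine iterMod_search (P := fun i => addF.eval G mem [i, i] = i) (fun i _ x => by simp)
    (code 0).2 (fun i hi => ?_) (T.q_le.trans T.N_lt.le)
  obtain ⟨a, ha⟩ : ∃ a : F, (code a : ℕ) = i := ⟨code.symm ⟨i, hi⟩, by simp⟩
  rw [← ha, T.eval_addF]
  constructor
  · intro h
    rw [add_eq_left.1 (code.injective (Fin.ext h))]
  · intro h
    rw [code.injective (Fin.ext h), add_zero]

theorem eval_oneF (x : ℕ) : oneF.eval G mem [x] = code (1 : F) := by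
  rw [oneF, Exp.eval_iter _ _ _ _ _ _ (by simpa using T.q_le)]
  refine iterMod_search (P := fun i => mulF.eval G mem [i, i] = i ∧ i ≠ code (0 : F))
    (fun i _ x => ?_)
    (code 1).2 (fun i hi => ?_) (T.q_le.trans T.N_lt.le)
  · by_cases h : mulF.eval G mem [i, i] = i <;> simp [h, T.eval_zeroF]
  obtain ⟨a, ha⟩ : ∃ a : F, (code a : ℕ) = i := ⟨code.symm ⟨i, hi⟩, by simp⟩
  rw [← ha, T.eval_mulF]
  constructor
  · rintro ⟨h, h0⟩
    have h1 : a * a = a := code.injective (Fin.ext h)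
    have h2 : a ≠ 0 := fun e => h0 (by rw [e])
    rw [(mul_eq_left₀ h2).1 h1]
  · intro h
    rw [code.injective (Fin.ext h)]
    refine ⟨by rw [mul_one], fun h => one_ne_zero (code.injective (Fin.ext h))⟩

/-- Evaluation of the code that composes the number of a vector from the numbers of its
coordinates. -/
theorem iterMod_vec {g : ℕ → ℕ → ℕ} {x : Fin G.n → F}
    (hg : ∀ i (hi : i < G.n) y, g i y = y + code (x ⟨i, hi⟩) * G.q ^ i) :
    iterMod G.M g 0 G.n = vc code x := by
  refine iterMod_tab (fun i hi y => ?_) (fun i _ => vc_digit_lt x i)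
    (T.pow_lt T.q_le T.n_lt.le).le
  rw [hg i hi, dif_pos hi]

theorem eval_digit (x : Fin G.n → F) {i : ℕ} (hi : i < G.n) :
    digF.eval G mem [G.q, vc code x, i] = code (x ⟨i, hi⟩) := by
  rw [T.eval_digF T.q_le (hi.trans T.n_lt).le, vc_digit x hi]

theorem eval_powq {i : ℕ} (hi : i < G.n) : powF.eval G mem [G.q, i] = G.q ^ i :=
  T.eval_powF T.q_le (hi.trans T.n_lt).le

theorem eval_vaddF (x y : Fin G.n → F) :
    vaddF.eval G mem [vc code x, vc code y] = vc code (x + y) := by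
  rw [vaddF, Exp.eval_iter _ _ _ _ _ _ (by simpa using T.n_lt.le)]
  exact T.iterMod_vec fun i hi z => by
    simp [T.eval_digit _ hi, T.eval_powq hi, T.eval_addF]

theorem eval_smulF (c : F) (x : Fin G.n → F) :
    smulF.eval G mem [code c, vc code x] = vc code (c • x) := by
  rw [smulF, Exp.eval_iter _ _ _ _ _ _ (by simpa using T.n_lt.le)]
  exact T.iterMod_vec fun i hi z => by
    simp [T.eval_digit _ hi, T.eval_powq hi, T.eval_mulF]

theorem eval_vecF {a : ℕ} {x : Fin G.n → F} (h : ∀ i : Fin G.n, mem (a + i) = code (x i)) :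
    vecF.eval G mem [a] = vc code x := by
  rw [vecF, Exp.eval_iter _ _ _ _ _ _ (by simpa using T.n_lt.le)]
  exact T.iterMod_vec fun i hi z => by
    simp [h ⟨i, hi⟩, T.eval_powq hi]

theorem eval_vzeroF (x : ℕ) : vzeroF.eval G mem [x] = vc code (0 : Fin G.n → F) := by
  rw [vzeroF, Exp.eval_iter _ _ _ _ _ _ (by simpa using T.n_lt.le)]
  exact T.iterMod_vec fun i hi z => by
    simp [T.eval_zeroF, T.eval_powq hi]

theorem eval_unitF (j : Fin G.n) :
    unitF.eval G mem [j] = vc code (Pi.single j 1 : Fin G.n → F) := by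
  rw [unitF, Exp.eval_iter _ _ _ _ _ _ (by simpa using T.n_lt.le)]
  refine T.iterMod_vec fun i hi z => ?_
  by_cases h : i = j
  · subst h
    simp [T.eval_oneF, T.eval_powq hi]
  · have : (⟨i, hi⟩ : Fin G.n) ≠ j := fun e => h (congrArg Fin.val e)
    simp [T.eval_zeroF, T.eval_powq hi, h, this]

theorem eval_rowF {a : ℕ} {r : Fin G.n → F} (h : ∀ i : Fin G.n, mem (a + i) = code (r i))
    (x : Fin G.n → F) : rowF.eval G mem [a, vc code x] = code (r ⬝ᵥ x) := by
  rw [rowF, Exp.eval_iter _ _ _ _ _ _ (by simpa using T.n_lt.le)]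
  have hq := T.q_le
  have hM := T.N_lt
  have := iterMod_eq (M := G.M) (c := G.n)
    (f := fun i y => addF.eval G mem [y, mulF.eval G mem [mem (a + i),
      digF.eval G mem [G.q, vc code x, i]]])
    (fun i => code (∑ j ∈ Finset.range i, if hj : j < G.n then r ⟨j, hj⟩ * x ⟨j, hj⟩ else 0))
    (fun i hi => by
      rw [h ⟨i, hi⟩, T.eval_digit x hi, T.eval_mulF, T.eval_addF, Finset.sum_range_succ,
        dif_pos hi])
    (fun i hi => ((code _).2.trans_le hq).trans hM)
  simp only [Finset.range_zero, Finset.sum_empty] at this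
  simp only [List.getD_cons_succ, Exp.eval_app1, Exp.eval_app2, Exp.eval_app3, Exp.eval_load,
    Exp.eval_add, Exp.eval_var, List.cons_append, List.nil_append, List.getD_cons_zero,
    Exp.eval_n, Exp.eval_q, T.eval_zeroF]
  rw [this, Finset.sum_range]
  simp [dotProduct]

theorem eval_mvecF {a : ℕ} {A : Matrix (Fin G.n) (Fin G.n) F}
    (h : ∀ i j : Fin G.n, mem (a + i * G.n + j) = code (A i j))
    (x : Fin G.n → F) : mvecF.eval G mem [a, vc code x] = vc code (A *ᵥ x) := by
  rw [mvecF, Exp.eval_iter _ _ _ _ _ _ (by simpa using T.n_lt.le)]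
  refine T.iterMod_vec fun i hi z => ?_
  simp [T.eval_rowF (h ⟨i, hi⟩), T.eval_powq hi, mulVec]

/-- Evaluation of the code that composes the number of a matrix from its values. -/
theorem iterMod_pc {f : ℕ → ℕ → ℕ} {g : GL (Fin G.n) F}
    (hf : ∀ x : Fin G.n → F, ∀ y, f (vc code x) y = y +
      vc code ((g : Matrix (Fin G.n) (Fin G.n) F) *ᵥ x) * powF.eval G mem [G.N, vc code x]) :
    iterMod G.M f 0 G.N = pc code g := by
  refine iterMod_tab (fun i hi y => ?_) (fun i _ => T.act_lt g i) T.hM.le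
  have := hf (vec code i) y
  rwa [T.vc_vec hi, T.eval_powF le_rfl hi.le] at this

theorem eval_matF {a : ℕ} {g : GL (Fin G.n) F}
    (h : ∀ i j : Fin G.n, mem (a + i * G.n + j) = code ((g : Matrix _ _ F) i j)) :
    matF.eval G mem [a] = pc code g := by
  rw [matF, Exp.eval_iter _ _ _ _ _ _ (by simp)]
  exact T.iterMod_pc fun x y => by simp [T.eval_mvecF h]

theorem eval_appF (g : GL (Fin G.n) F) (x : Fin G.n → F) :
    appF.eval G mem [pc code g, vc code x] = vc code ((g : Matrix _ _ F) *ᵥ x) := by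
  have := T.vc_lt x
  simp only [appF, Exp.eval_app3, Exp.eval_N, Exp.eval_var, List.getD_cons_succ,
    List.getD_cons_zero]
  rw [T.eval_digF le_rfl this.le, T.pc_digit g this, act_vc]

theorem eval_compF (g h : GL (Fin G.n) F) :
    compF.eval G mem [pc code g, pc code h] = pc code (g * h) := by
  rw [compF, Exp.eval_iter _ _ _ _ _ _ (by simp)]
  exact T.iterMod_pc fun x y => by simp [T.eval_appF]

theorem eval_idF (x : ℕ) : idF.eval G mem [x] = pc code (1 : GL (Fin G.n) F) := by
  rw [idF, Exp.eval_iter _ _ _ _ _ _ (by simp)]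
  exact T.iterMod_pc fun x y => by simp

/-- The code tries all points; since `g` is a bijection, exactly one of them is a hit. Inverse
matrices are obtained from this without elimination. -/
theorem eval_preF (g : GL (Fin G.n) F) (y : Fin G.n → F) :
    preF.eval G mem [pc code g, vc code y]
      = vc code (((g⁻¹ : GL (Fin G.n) F) : Matrix _ _ F) *ᵥ y) := by
  rw [preF, Exp.eval_iter _ _ _ _ _ _ (by simp)]
  refine iterMod_search (P := fun i => appF.eval G mem [pc code g, i] = vc code y)
    (fun i _ x => by simp) (T.vc_lt _) (fun i hi => ?_) T.N_lt.le
  rw [← T.vc_vec hi, T.eval_appF, vc_injective.eq_iff, vc_injective.eq_iff]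
  constructor
  · rintro rfl
    rw [mulVec_mulVec, ← Units.val_mul, inv_mul_cancel, Units.val_one, one_mulVec]
  · intro h
    rw [h, mulVec_mulVec, ← Units.val_mul, mul_inv_cancel, Units.val_one, one_mulVec]

theorem eval_invF (g : GL (Fin G.n) F) : invF.eval G mem [pc code g] = pc code g⁻¹ := by
  rw [invF, Exp.eval_iter _ _ _ _ _ _ (by simp)]
  exact T.iterMod_pc fun x y => by
    simp only [Exp.eval_add, Exp.eval_mul, Exp.eval_app2, Exp.eval_var, List.cons_append,
      List.nil_append, List.getD_cons_succ, List.getD_cons_zero, Exp.eval_N, T.eval_preF]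

open Classical in
theorem eval_bitF (U : Submodule F (Fin G.n → F)) (x : Fin G.n → F) :
    bitF.eval G mem [bm code U, vc code x] = if x ∈ U then 1 else 0 := by
  rw [← T.bm_digit]
  simp only [bitF, Exp.eval_app3, Exp.eval_two, Exp.eval_var, List.getD_cons_succ,
    List.getD_cons_zero]
  exact T.eval_digF T.two_le (T.vc_lt x).le

open Classical in
-- Membership of `x` in `U + F y` means that `x + c y` is in `U` for one of the `q` scalars `c`, and
-- each of these is looked up in the characteristic function of `U`.
theorem eval_memF (U : Submodule F (Fin G.n → F)) (x y : Fin G.n → F) :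
    memF.eval G mem [bm code U, vc code x, vc code y]
      = if x ∈ U ⊔ Submodule.span F {y} then 1 else 0 := by
  rw [memF, Exp.eval_iter _ _ _ _ _ _ (by simpa using T.q_le)]
  have hM : 1 < G.M := by have := T.two_le; have := T.N_lt; omega
  have h1 := iterMod_exists (M := G.M) (c := G.q)
    (f := fun i z => if bitF.eval G mem [bm code U, vaddF.eval G mem [vc code x,
      smulF.eval G mem [i, vc code y]]] ≠ 0 then 1 else z)
    (P := fun i => bitF.eval G mem [bm code U, vaddF.eval G mem [vc code x,
      smulF.eval G mem [i, vc code y]]] ≠ 0) (fun _ _ _ => rfl) hM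
  simp only [Exp.eval_ite, Exp.eval_app2, Exp.eval_var, List.cons_append, List.nil_append,
    List.getD_cons_succ, List.getD_cons_zero, Exp.eval_q, Exp.eval_zero, Exp.eval_one]
  rw [h1]
  congr 1
  rw [eq_iff_iff]
  have h2 : ∀ c : F, bitF.eval G mem [bm code U, vaddF.eval G mem [vc code x,
      smulF.eval G mem [code c, vc code y]]] ≠ 0 ↔ x + c • y ∈ U := by
    intro c
    rw [T.eval_smulF, T.eval_vaddF, T.eval_bitF]
    split_ifs with h <;> simp [h]
  rw [Submodule.mem_sup]
  constructor
  · rintro ⟨i, hi, h⟩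
    obtain ⟨c, rfl⟩ : ∃ c : F, (code c : ℕ) = i := ⟨code.symm ⟨i, hi⟩, by simp⟩
    exact ⟨_, (h2 c).1 h, (-c) • y, Submodule.smul_mem _ _ (Submodule.mem_span_singleton_self y),
      by simp⟩
  · rintro ⟨u, hu, z, hz, rfl⟩
    obtain ⟨c, rfl⟩ := Submodule.mem_span_singleton.1 hz
    exact ⟨code (-c), (code _).2, (h2 _).2 (by simpa using hu)⟩

open Classical in
theorem eval_extF (U : Submodule F (Fin G.n → F)) (y : Fin G.n → F) :
    extF.eval G mem [bm code U, vc code y] = bm code (U ⊔ Submodule.span F {y}) := by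
  rw [extF, Exp.eval_iter _ _ _ _ _ _ (by simp)]
  refine iterMod_tab (fun i hi z => ?_) (fun p _ => T.bm_digit_lt _ p)
    (T.pow_lt T.two_le le_rfl).le
  have h1 := T.eval_memF U (vec code i) y
  rw [T.vc_vec hi] at h1
  have h2 := T.eval_powF T.two_le hi.le
  simp only [Exp.eval_add, Exp.eval_mul, Exp.eval_app2, Exp.eval_app3, Exp.eval_var,
    List.cons_append, List.nil_append, List.getD_cons_succ, List.getD_cons_zero,
    Exp.eval_two, h1, h2]

open Classical in
theorem eval_subF (U U' : Submodule F (Fin G.n → F)) :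
    subF.eval G mem [bm code U, bm code U'] = if U ≤ U' then 1 else 0 := by
  rw [subF, Exp.eval_iter _ _ _ _ _ _ (by simp)]
  have hM : 1 < G.M := by have := T.two_le; have := T.N_lt; omega
  have h1 := iterMod_forall (M := G.M) (c := G.N)
    (f := fun i z => if bitF.eval G mem [bm code U, i] ≠ 0 then
      (if bitF.eval G mem [bm code U', i] ≠ 0 then z else 0) else z)
    (P := fun i => vec code i ∈ U → vec code i ∈ U') (fun i hi z => by
      have h1 := T.eval_bitF U (vec code i)
      have h2 := T.eval_bitF U' (vec code i)
      rw [T.vc_vec hi] at h1 h2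
      rw [h1, h2]
      by_cases h : vec code i ∈ U <;> by_cases h' : vec code i ∈ U' <;> simp [h, h']) hM
  simp only [Exp.eval_ite, Exp.eval_app2, Exp.eval_var, List.cons_append, List.nil_append,
    List.getD_cons_succ, List.getD_cons_zero, Exp.eval_N, Exp.eval_zero, Exp.eval_one]
  rw [h1]
  congr 1
  rw [eq_iff_iff]
  constructor
  · intro h x hx
    have := h _ (T.vc_lt x)
    rw [vec_vc] at this
    exact this hx
  · exact fun h i _ hi => h hi

/-- The zero subspace has a single binary digit 1, at the number of the zero vector. That number
need not be 0, because the numbering of the field is arbitrary. -/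
theorem eval_bot : powF.eval G mem [2, vc code (0 : Fin G.n → F)]
    = bm code (⊥ : Submodule F (Fin G.n → F)) := by
  rw [T.eval_powF T.two_le (T.vc_lt _).le, bm, tab, Finset.sum_eq_single (vc code 0)]
  · simp [vec_vc]
  · intro p hp hne
    rw [if_neg, zero_mul]
    intro h
    rw [Submodule.mem_bot] at h
    rw [← h, T.vc_vec (Finset.mem_range.1 hp)] at hne
    exact hne rfl
  · intro h
    exact absurd (Finset.mem_range.2 (T.vc_lt _)) h

theorem eval_spanF {a j k : ℕ} {x : Fin k → Fin G.n → F} (hj : j ≤ k) (hk : k ≤ G.N)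
    (h : ∀ (l : Fin k) (i : Fin G.n), mem (a + l * G.n + i) = code (x l i)) :
    spanF.eval G mem [a, j] = bm code (flag x j) := by
  rw [spanF, Exp.eval_iter _ _ _ _ _ _ (by simpa using hj.trans hk)]
  have := iterMod_eq (M := G.M) (c := j)
    (f := fun i z => extF.eval G mem [z, vecF.eval G mem [a + i * G.n]])
    (fun i => bm code (flag x i))
    (fun i hi => by
      have := flag_succ x ⟨i, by omega⟩
      simp only at this ⊢
      rw [T.eval_vecF (h ⟨i, by omega⟩), T.eval_extF, this])
    (fun i hi => T.bm_lt_M _)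
  simp only [Exp.eval_add, Exp.eval_mul, Exp.eval_app1, Exp.eval_app2, Exp.eval_var,
    List.cons_append, List.nil_append, List.getD_cons_succ, List.getD_cons_zero, Exp.eval_zero,
    Exp.eval_two, Exp.eval_n, T.eval_vzeroF, T.eval_bot]
  rw [← this, flag_zero]

end Tables

end SubspTrans

/-! ### Memory layout and the program for sifting -/

namespace Ram

section run
variable (G : Globals) (ρ : List ℕ) (σ : Store) (a b c e : Exp) (p p' : Stm)

@[simp] theorem Stm.run_skip : Stm.skip.run G ρ σ = σ := rfl
@[simp] theorem Stm.run_store : (Stm.store a e).run G ρ σ =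
    ⟨Function.update σ.mem (a.eval G σ.mem ρ) (e.eval G σ.mem ρ % G.M), σ.out⟩ := rfl
@[simp] theorem Stm.run_emit : (Stm.emit e).run G ρ σ =
    ⟨σ.mem, σ.out ++ [e.eval G σ.mem ρ]⟩ := rfl
@[simp] theorem Stm.run_seq : (Stm.seq p p').run G ρ σ = p'.run G ρ (p.run G ρ σ) := rfl
@[simp] theorem Stm.run_ite : (Stm.ite c p p').run G ρ σ =
    if c.eval G σ.mem ρ ≠ 0 then p.run G ρ σ else p'.run G ρ σ := rfl
@[simp] theorem Stm.run_letIn : (Stm.letIn e p).run G ρ σ =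
    p.run G (ρ ++ [e.eval G σ.mem ρ]) σ := rfl
@[simp] theorem Stm.run_call1 : (Stm.call1 a p).run G ρ σ = p.run G [a.eval G σ.mem ρ] σ := rfl
@[simp] theorem Stm.run_call2 : (Stm.call2 a b p).run G ρ σ =
    p.run G [a.eval G σ.mem ρ, b.eval G σ.mem ρ] σ := rfl

theorem Stm.run_loop (h : c.eval G σ.mem ρ ≤ G.N) : (Stm.loop false c p).run G ρ σ =
    iterFrom (fun i σ => p.run G (ρ ++ [i]) σ) σ (c.eval G σ.mem ρ) := by
  simp only [Stm.run]
  rw [show G.get (loopGlob false) = G.N from rfl, min_eq_left h]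

theorem Stm.run_loop_long (h : c.eval G σ.mem ρ ≤ G.K) : (Stm.loop true c p).run G ρ σ =
    iterFrom (fun i σ => p.run G (ρ ++ [i]) σ) σ (c.eval G σ.mem ρ) := by
  simp only [Stm.run]
  rw [show G.get (loopGlob true) = G.K from rfl, min_eq_left h]

end run

/-- The entry `x` of the array `t`. The arrays are interleaved behind the input. -/
def adr (G : Globals) (t x : ℕ) : ℕ := G.base + 8 * x + t

/-- The address of an array entry. -/
def cell (t : ℕ) (x : Exp) : Exp := .glob .base + .lit 8 * x + .lit t

/-- The address of the entry of the `j`-th filter for a matrix that maps `p` to `w`. -/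
def ft (G : Globals) (j p w : ℕ) : ℕ := adr G 0 ((j * G.N + p) * G.N + w)

/-- The address of the transversal element for `x` on the `j`-th level. -/
def tr (G : Globals) (j x : ℕ) : ℕ := adr G 1 (j * G.N + x)

/-- The address of the transporter into a subspace. -/
def tt (G : Globals) (B : ℕ) : ℕ := adr G 2 B

/-- The address of the `i`-th subspace on the `j`-th level. -/
def li (G : Globals) (j i : ℕ) : ℕ := adr G 3 (i * G.N + j)

/-- The address of the number of subspaces on the `j`-th level. -/
def len (G : Globals) (j : ℕ) : ℕ := adr G 4 j

/-- The address of the matrix that is sifted. -/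
def cur (G : Globals) : ℕ := adr G 5 0

/-- Expression for `ft`. -/
def ftE (j p w : Exp) : Exp := cell 0 ((j * .glob .N + p) * .glob .N + w)
/-- Expression for `tr`. -/
def trE (j x : Exp) : Exp := cell 1 (j * .glob .N + x)
/-- Expression for `tt`. -/
def ttE (B : Exp) : Exp := cell 2 B
/-- Expression for `li`. -/
def liE (j i : Exp) : Exp := cell 3 (i * .glob .N + j)
/-- Expression for `len`. -/
def lenE (j : Exp) : Exp := cell 4 j
/-- Expression for `cur`. -/
def curE : Exp := cell 5 0

section
variable (G : Globals) (mem : ℕ → ℕ) (ρ : List ℕ) (a b c : Exp)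
@[simp] theorem eval_ftE : (ftE a b c).eval G mem ρ =
    ft G (a.eval G mem ρ) (b.eval G mem ρ) (c.eval G mem ρ) := rfl
@[simp] theorem eval_trE : (trE a b).eval G mem ρ =
    tr G (a.eval G mem ρ) (b.eval G mem ρ) := rfl
@[simp] theorem eval_ttE : (ttE a).eval G mem ρ = tt G (a.eval G mem ρ) := rfl
@[simp] theorem eval_liE : (liE a b).eval G mem ρ =
    li G (a.eval G mem ρ) (b.eval G mem ρ) := rfl
@[simp] theorem eval_lenE : (lenE a).eval G mem ρ = len G (a.eval G mem ρ) := rfl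
@[simp] theorem eval_curE : curE.eval G mem ρ = cur G := rfl
end

/-- The residue modulo 8 of the offset names the array. The arrays are thus disjoint without any
bound on their lengths, which matters since one of them is indexed by the numbers of subspaces. -/
theorem adr_inj {G : Globals} {t x t' x' : ℕ} (h : t < 8) (h' : t' < 8) :
    adr G t x = adr G t' x' ↔ t = t' ∧ x = x' := by
  unfold adr; omega

theorem pair_inj {N a b a' b' : ℕ} (h : b < N) (h' : b' < N) :
    a * N + b = a' * N + b' ↔ a = a' ∧ b = b' := by
  constructor
  · intro e
    have h1 : (a * N + b) / N = a := by
      rw [mul_comm, Nat.mul_add_div (by omega), Nat.div_eq_of_lt h, add_zero]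
    have h2 : (a' * N + b') / N = a' := by
      rw [mul_comm, Nat.mul_add_div (by omega), Nat.div_eq_of_lt h', add_zero]
    have h3 : a = a' := by rw [← h1, ← h2, e]
    subst h3
    exact ⟨rfl, by omega⟩
  · rintro ⟨rfl, rfl⟩; rfl

theorem ft_inj {G : Globals} {j p w j' p' w' : ℕ} (hp : p < G.N) (hp' : p' < G.N) (hw : w < G.N)
    (hw' : w' < G.N) : ft G j p w = ft G j' p' w' ↔ j = j' ∧ p = p' ∧ w = w' := by
  rw [ft, ft, adr_inj (by norm_num) (by norm_num), pair_inj hw hw', pair_inj hp hp']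
  tauto

theorem tr_inj {G : Globals} {j x j' x' : ℕ} (hx : x < G.N) (hx' : x' < G.N) :
    tr G j x = tr G j' x' ↔ j = j' ∧ x = x' := by
  rw [tr, tr, adr_inj (by norm_num) (by norm_num), pair_inj hx hx']
  tauto

/-- In contrast to the other arrays the level is the low part of the index, because the levels are
below `N` while the position in a list is not. -/
theorem li_inj {G : Globals} {j i j' i' : ℕ} (hx : j < G.N) (hx' : j' < G.N) :
    li G j i = li G j' i' ↔ j = j' ∧ i = i' := by
  rw [li, li, adr_inj (by norm_num) (by norm_num), pair_inj hx hx']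
  tauto

/-- `τ` arises from `σ` by changes of the cells in `A`. -/
structure Frame (A : Set ℕ) (σ τ : Store) : Prop where
  mem : ∀ a, a ∉ A → τ.mem a = σ.mem a
  out : τ.out = σ.out

theorem Frame.refl (A : Set ℕ) (σ : Store) : Frame A σ σ := ⟨fun _ _ => rfl, rfl⟩

theorem Frame.trans {A : Set ℕ} {σ τ υ : Store} (h : Frame A σ τ) (h' : Frame A τ υ) :
    Frame A σ υ :=
  ⟨fun a ha => (h'.mem a ha).trans (h.mem a ha), h'.out.trans h.out⟩

theorem Frame.mono {A B : Set ℕ} {σ τ : Store} (h : Frame A σ τ) (hAB : A ⊆ B) :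
    Frame B σ τ :=
  ⟨fun a ha => h.mem a fun h' => ha (hAB h'), h.out⟩

theorem Frame.update {A : Set ℕ} {σ : Store} {a : ℕ} (ha : a ∈ A) (v : ℕ) :
    Frame A σ ⟨Function.update σ.mem a v, σ.out⟩ :=
  ⟨fun b hb => Function.update_of_ne (fun e => hb (by rw [e]; exact ha)) _ _, rfl⟩

/-- Store `e` in the cell `a` and run `p` with every matrix of the `j`-th filter as the variable
`d + 2`, where `d` is the number of local variables. -/
def forGens (d : ℕ) (j : Exp) (p : Stm) : Stm :=
  .loop false (.glob .N) (.loop false (.glob .N)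
    -- Cells hold the number of a matrix plus one; the value 0 marks an empty cell.
    (.letIn (.load (ftE j (.var d) (.var (d + 1)))) (.ite (.var (d + 2)) p .skip)))

/-- Arguments `j, g`: sift the matrix `g` through the `j`-th filter. -/
def insertS : Stm :=
  -- The cell `cur` holds the matrix still to be sifted, again plus one, and becomes 0 when the
  -- matrix has found its place.
  .seq (.store curE (.var 1 + 1))
    (.loop false (.glob .N) (.ite (.load curE)
      (.letIn (.app2 appF (.load curE - 1) (.var 2))
        (.ite (.load (ftE (.var 0) (.var 2) (.var 3)))
          (.store curE (.app2 compF (.app1 invF (.load (ftE (.var 0) (.var 2) (.var 3)) - 1))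
            (.load curE - 1) + 1))
          (.seq (.store (ftE (.var 0) (.var 2) (.var 3)) (.load curE)) (.store curE 0))))
      .skip))

end Ram

/-! ### Correctness of the filter -/

namespace SubspTrans

open Ram Matrix

variable {F : Type} [Field F] {G : Globals} [NeZero G.q] {code : F ≃ Fin G.q}

/-- The memory has the shape of a filter on the level `j`: the entry for `p` and `w` is empty or
a matrix that fixes the points before `p` and maps `p` to `w`. -/
def Filt (code : F ≃ Fin G.q) (mem : ℕ → ℕ) (j : ℕ) : Prop :=
  ∀ p < G.N, ∀ w < G.N, mem (ft G j p w) = 0 ∨ ∃ g : GL (Fin G.n) F,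
    mem (ft G j p w) = pc code g + 1 ∧ (∀ p' < p, act code g p' = p') ∧ act code g p = w

/-- The matrices in the filter on the level `j`. -/
def fset (code : F ≃ Fin G.q) (mem : ℕ → ℕ) (j : ℕ) : Set (GL (Fin G.n) F) :=
  {g | ∃ p < G.N, ∃ w < G.N, mem (ft G j p w) = pc code g + 1}

/-- The cells of the filter on the level `j`. -/
def ftCells (G : Globals) (j : ℕ) : Set ℕ := {a | ∃ p < G.N, ∃ w < G.N, a = ft G j p w}

theorem Filt.congr {mem mem' : ℕ → ℕ} {j : ℕ} (h : Filt code mem j)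
    (e : ∀ p < G.N, ∀ w < G.N, mem' (ft G j p w) = mem (ft G j p w)) : Filt code mem' j := by
  intro p hp w hw
  rw [e p hp w hw]
  exact h p hp w hw

theorem fset_congr {mem mem' : ℕ → ℕ} {j : ℕ}
    (e : ∀ p < G.N, ∀ w < G.N, mem' (ft G j p w) = mem (ft G j p w)) :
    fset code mem' j = fset code mem j := by
  ext g
  constructor
  · rintro ⟨p, hp, w, hw, h⟩
    exact ⟨p, hp, w, hw, by rw [← e p hp w hw, h]⟩
  · rintro ⟨p, hp, w, hw, h⟩
    exact ⟨p, hp, w, hw, by rw [e p hp w hw, h]⟩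

theorem Tables.congr {mem mem' : ℕ → ℕ} (T : Tables G code mem)
    (e : ∀ a < G.base, mem' a = mem a) : Tables G code mem' where
  hq := T.hq
  hn := T.hn
  hN := T.hN
  hM := T.hM
  hbase := T.hbase
  add a b := by
    have h1 := (code a).2
    have h2 := (code b).2
    have h3 := T.hbase
    have h4 : ((code a : ℕ) + 1) * G.q ≤ G.q * G.q := Nat.mul_le_mul_right _ h1
    rw [e _ (by nlinarith), T.add]
  mul a b := by
    have h1 := (code a).2
    have h2 := (code b).2
    have h3 := T.hbase
    have h4 : ((code a : ℕ) + 1) * G.q ≤ G.q * G.q := Nat.mul_le_mul_right _ h1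
    rw [e _ (by nlinarith), T.mul]

theorem base_le_adr (G : Globals) (t x : ℕ) : G.base ≤ adr G t x := by unfold adr; omega

theorem _root_.Ram.Frame.below {A : Set ℕ} {σ τ : Store} (h : Frame A σ τ) (hA : ∀ a ∈ A, G.base ≤ a) :
    ∀ a < G.base, τ.mem a = σ.mem a :=
  fun a ha => h.mem a fun h' => by have := hA a h'; omega

namespace Tables

variable {mem : ℕ → ℕ} {σ : Store}

theorem pc_succ_lt (T : Tables G code mem) (g : GL (Fin G.n) F) : pc code g + 1 < G.M :=
  (Nat.succ_le_of_lt (T.pc_lt g)).trans_lt T.hM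

/-- The rule for loops over the matrices of a filter. -/
theorem forGens_rule (T : Tables G code σ.mem) {d j : ℕ} {ρ : List ℕ} {jE : Exp} {body : Stm} (hd : ρ.length = d)
    (hF : Filt code σ.mem j) (hj : ∀ mem ρ', jE.eval G mem (ρ ++ ρ') = j)
    (J : Store → Prop) (D : GL (Fin G.n) F → Store → Prop)
    (hJ : J σ) (hJft : ∀ τ, J τ → ∀ p < G.N, ∀ w < G.N, τ.mem (ft G j p w) = σ.mem (ft G j p w))
    (hs : ∀ p w, ∀ g ∈ fset code σ.mem j, ∀ τ, J τ →
      J (body.run G (ρ ++ [p, w, pc code g + 1]) τ) ∧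
      D g (body.run G (ρ ++ [p, w, pc code g + 1]) τ) ∧
      ∀ h, D h τ → D h (body.run G (ρ ++ [p, w, pc code g + 1]) τ)) :
    J ((forGens d jE body).run G ρ σ) ∧
      ∀ g ∈ fset code σ.mem j, D g ((forGens d jE body).run G ρ σ) := by
  -- `J` is the invariant of the loop, and `D g` says that `g` has been treated; it has to persist
  -- when further matrices are treated. The invariant also guarantees that the body leaves the
  -- filter itself unchanged.
  have key : ∀ p < G.N, ∀ w < G.N, ∀ τ, J τ →
      let τ' := (Stm.letIn (.load (ftE jE (.var d) (.var (d + 1))))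
        (.ite (.var (d + 2)) body .skip)).run G (ρ ++ [p] ++ [w]) τ
      J τ' ∧ (∀ h, D h τ → D h τ') ∧ ∀ g, σ.mem (ft G j p w) = pc code g + 1 → D g τ' := by
    intro p hp w hw τ hτ
    have e1 : jE.eval G τ.mem (ρ ++ ([p] ++ [w])) = j := hj _ _
    have e2 : (ρ ++ [p, w]).getD d 0 = p := by
      simp [List.getD_eq_getElem?_getD, ← hd]
    have e3 : (ρ ++ [p, w]).getD (d + 1) 0 = w := by
      simp [List.getD_eq_getElem?_getD, ← hd]
    have e4 : ∀ x, (ρ ++ [p, w, x]).getD (d + 2) 0 = x := by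
      simp [List.getD_eq_getElem?_getD, ← hd]
    simp only [List.cons_append, List.nil_append] at e1
    simp only [Stm.run_letIn, Stm.run_ite, Stm.run_skip, Exp.eval_load, eval_ftE, Exp.eval_var,
      List.append_assoc, List.cons_append, List.nil_append, e1, e2, e3, e4, hJft τ hτ p hp w hw]
    rcases hF p hp w hw with h0 | ⟨g, hg, -, -⟩
    · rw [h0]
      simp only [ne_eq, not_true_eq_false, if_false]
      exact ⟨hτ, fun _ h => h, fun g hg => by omega⟩
    · rw [hg, if_pos (by omega)]
      obtain ⟨h1, h2, h3⟩ := hs p w g ⟨p, hp, w, hw, hg⟩ τ hτ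
      refine ⟨h1, h3, fun g' hg' => ?_⟩
      rw [← T.pc_injective (Nat.succ_injective hg')]
      exact h2
  have h1 := iterFrom_induction (a := σ) (c := G.N)
    (f := fun p σ => (Stm.loop false (.glob .N)
      (.letIn (.load (ftE jE (.var d) (.var (d + 1)))) (.ite (.var (d + 2)) body .skip))).run G
        (ρ ++ [p]) σ)
    (fun p τ => J τ ∧ ∀ p' < p, ∀ w < G.N, ∀ g, σ.mem (ft G j p' w) = pc code g + 1 → D g τ)
    ⟨hJ, by omega⟩ (by
      rintro p hp τ ⟨hτ, hD⟩
      rw [Stm.run_loop _ _ _ _ _ (by simp)]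
      simp only [Exp.eval_N]
      have h2 := iterFrom_induction (a := τ) (c := G.N)
        (f := fun w σ => (Stm.letIn (.load (ftE jE (.var d) (.var (d + 1))))
          (.ite (.var (d + 2)) body .skip)).run G (ρ ++ [p] ++ [w]) σ)
        (fun w τ => J τ ∧
          (∀ p' < p, ∀ w < G.N, ∀ g, σ.mem (ft G j p' w) = pc code g + 1 → D g τ) ∧
          ∀ w' < w, ∀ g, σ.mem (ft G j p w') = pc code g + 1 → D g τ)
        ⟨hτ, hD, by omega⟩ (by
          rintro w hw υ ⟨hυ, hD1, hD2⟩
          obtain ⟨k1, k2, k3⟩ := key p hp w hw υ hυ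
          refine ⟨k1, fun p' hp' w' hw' g hg => k2 _ (hD1 p' hp' w' hw' g hg),
            fun w' hw' g hg => ?_⟩
          rcases Nat.lt_succ_iff_lt_or_eq.1 hw' with h | rfl
          · exact k2 _ (hD2 w' h g hg)
          · exact k3 g hg)
      obtain ⟨k1, k2, k3⟩ := h2
      refine ⟨k1, fun p' hp' w hw g hg => ?_⟩
      rcases Nat.lt_succ_iff_lt_or_eq.1 hp' with h | rfl
      · exact k2 p' h w hw g hg
      · exact k3 w hw g hg)
  rw [forGens, Stm.run_loop _ _ _ _ _ (by simp)]
  exact ⟨h1.1, fun g ⟨p, hp, w, hw, hg⟩ => h1.2 p hp w hw g hg⟩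

theorem cur_notMem_ftCells (j : ℕ) : cur G ∉ ftCells G j := by
  rintro ⟨p, _, w, _, e⟩
  rw [cur, ft, adr_inj (by norm_num) (by norm_num)] at e
  omega

/-- Sifting a matrix through a filter adds it to the group which the filter generates. -/
theorem insertS_spec (T : Tables G code σ.mem) {j : ℕ} (hF : Filt code σ.mem j)
    (g : GL (Fin G.n) F) :
    Filt code (insertS.run G [j, pc code g] σ).mem j ∧
      Subgroup.closure (fset code (insertS.run G [j, pc code g] σ).mem j)
        = Subgroup.closure (insert g (fset code σ.mem j)) ∧
      Frame (insert (cur G) (ftCells G j)) σ (insertS.run G [j, pc code g] σ) := by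
  have hcf : ∀ p < G.N, ∀ w < G.N, ft G j p w ≠ cur G := fun p hp w hw e =>
    cur_notMem_ftCells j ⟨p, hp, w, hw, e.symm⟩
  have hA : ∀ a ∈ insert (cur G) (ftCells G j), G.base ≤ a := by
    rintro a (rfl | ⟨p, -, w, -, rfl⟩) <;> exact base_le_adr _ _ _
  have hcur : cur G ∈ insert (cur G) (ftCells G j) := Set.mem_insert _ _
  simp only [insertS, Stm.run_seq, Stm.run_store, eval_curE, Exp.eval_add, Exp.eval_var,
    List.getD_cons_succ, List.getD_cons_zero, Exp.eval_one, Nat.mod_eq_of_lt (T.pc_succ_lt g)]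
  rw [Stm.run_loop _ _ _ _ _ (by simp)]
  simp only [Exp.eval_N]
  set σ₁ : Store := ⟨Function.update σ.mem (cur G) (pc code g + 1), σ.out⟩ with hσ₁
  have hft₁ : ∀ p < G.N, ∀ w < G.N, σ₁.mem (ft G j p w) = σ.mem (ft G j p w) :=
    fun p hp w hw => Function.update_of_ne (hcf p hp w hw) _ _
  have main := iterFrom_induction (a := σ₁) (c := G.N)
    (f := fun p σ => (Stm.ite (.load curE)
      (.letIn (.app2 appF (.load curE - 1) (.var 2))
        (.ite (.load (ftE (.var 0) (.var 2) (.var 3)))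
          (.store curE (.app2 compF (.app1 invF (.load (ftE (.var 0) (.var 2) (.var 3)) - 1))
            (.load curE - 1) + 1))
          (.seq (.store (ftE (.var 0) (.var 2) (.var 3)) (.load curE)) (.store curE 0))))
      .skip).run G ([j, pc code g] ++ [p]) σ)
    -- After `p` points, either the matrix has been absorbed, or a remainder `h` is left that fixes
    -- these points. In both cases the filter, with `h` if present, generates the group generated by
    -- the old filter and `g`.
    (fun p τ => Frame (insert (cur G) (ftCells G j)) σ τ ∧ Filt code τ.mem j ∧
      ((τ.mem (cur G) = 0 ∧ Subgroup.closure (fset code τ.mem j)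
          = Subgroup.closure (insert g (fset code σ.mem j))) ∨
        ∃ h : GL (Fin G.n) F, τ.mem (cur G) = pc code h + 1 ∧ (∀ p' < p, act code h p' = p') ∧
          Subgroup.closure (insert h (fset code τ.mem j))
            = Subgroup.closure (insert g (fset code σ.mem j))))
    ⟨Frame.update hcur _, hF.congr hft₁, .inr ⟨g, by simp [hσ₁], by omega, by
      rw [fset_congr hft₁]⟩⟩ (by
      rintro p hp τ ⟨hfr, hFτ, hc⟩
      have Tτ : Tables G code τ.mem := T.congr (hfr.below hA)
      simp only [Stm.run_letIn, Stm.run_ite, Stm.run_skip, Exp.eval_load, eval_ftE, Exp.eval_var,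
        eval_curE, Exp.eval_app2, Exp.eval_app1, Exp.eval_sub, Exp.eval_one, List.cons_append,
        List.nil_append, List.getD_cons_succ, List.getD_cons_zero, Stm.run_store, Stm.run_seq,
        Exp.eval_add, Exp.eval_zero]
      rcases hc with ⟨h0, hcl⟩ | ⟨h, hh, hfix, hcl⟩
      · rw [h0]
        simp only [ne_eq, not_true_eq_false, if_false]
        exact ⟨hfr, hFτ, .inl ⟨h0, hcl⟩⟩
      have happ : appF.eval G τ.mem [pc code h, p] = act code h p := by
        have := Tτ.eval_appF h (vec code p)
        rwa [Tτ.vc_vec hp] at this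
      have hw := Tτ.act_lt h p
      rw [hh, if_pos (by omega), Nat.add_sub_cancel, happ]
      rcases hFτ p hp _ hw with h0 | ⟨f, hf, hffix, hfp⟩
      · rw [h0]
        simp only [ne_eq, not_true_eq_false, if_false, Nat.mod_eq_of_lt (Tτ.pc_succ_lt h),
          Nat.zero_mod]
        have hcell : ∀ p' < G.N, ∀ w' < G.N,
            Function.update (Function.update τ.mem (ft G j p (act code h p)) (pc code h + 1))
              (cur G) 0 (ft G j p' w') =
            if p' = p ∧ w' = act code h p then pc code h + 1 else τ.mem (ft G j p' w') := by
          intro p' hp' w' hw'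
          rw [Function.update_of_ne (hcf p' hp' w' hw'), Function.update_apply]
          simp only [ft_inj hp' hp hw' hw, true_and]
        refine ⟨?_, ?_, .inl ⟨by simp, ?_⟩⟩
        · exact (hfr.trans (Frame.update (.inr ⟨p, hp, _, hw, rfl⟩) _)).trans
            (Frame.update hcur _)
        · intro p' hp' w' hw'
          rw [hcell p' hp' w' hw']
          split_ifs with e
          · obtain ⟨rfl, rfl⟩ := e
            exact .inr ⟨h, rfl, hfix, rfl⟩
          · exact hFτ p' hp' w' hw'
        · rw [← hcl]
          congr 1
          ext f
          constructor
          · rintro ⟨p', hp', w', hw', e⟩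
            rw [hcell p' hp' w' hw'] at e
            split_ifs at e with e'
            · exact .inl (Tτ.pc_injective (Nat.succ_injective e)).symm
            · exact .inr ⟨p', hp', w', hw', e⟩
          · rintro (rfl | ⟨p', hp', w', hw', e⟩)
            · refine ⟨p, hp, _, hw, ?_⟩
              rw [hcell p hp _ hw, if_pos ⟨rfl, rfl⟩]
            · refine ⟨p', hp', w', hw', ?_⟩
              rw [hcell p' hp' _ hw', if_neg, e]
              rintro ⟨rfl, rfl⟩
              omega
      -- The place is taken by some `f` that agrees with `h` on all points up to `p`. So `f⁻¹ * h`
      -- fixes one more point, and exchanging `h` for it does not change the generated group.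
      · rw [hf, if_pos (by omega), Nat.add_sub_cancel, Tτ.eval_invF, Tτ.eval_compF,
          Nat.mod_eq_of_lt (Tτ.pc_succ_lt _)]
        have hcell : ∀ p' < G.N, ∀ w' < G.N,
            Function.update τ.mem (cur G) (pc code (f⁻¹ * h) + 1) (ft G j p' w') =
              τ.mem (ft G j p' w') := fun p' hp' w' hw' =>
          Function.update_of_ne (hcf p' hp' w' hw') _ _
        refine ⟨hfr.trans (Frame.update hcur _), hFτ.congr hcell,
          .inr ⟨f⁻¹ * h, by simp, fun p' hp' => ?_, ?_⟩⟩
        · have hp'N : p' < G.N := by omega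
          rw [act_mul]
          rcases Nat.lt_succ_iff_lt_or_eq.1 hp' with hlt | rfl
          · rw [hfix p' hlt]
            nth_rewrite 1 [← hffix p' hlt]
            exact Tτ.act_inv hp'N f
          · rw [← hfp, Tτ.act_inv hp'N f]
        · rw [← hcl, fset_congr hcell]
          have hfm : f ∈ fset code τ.mem j := ⟨p, hp, _, hw, hf⟩
          apply le_antisymm
          · rw [Subgroup.closure_le]
            rintro x (rfl | hx)
            · exact mul_mem (inv_mem (Subgroup.subset_closure (.inr hfm)))
                (Subgroup.subset_closure (.inl rfl))
            · exact Subgroup.subset_closure (.inr hx)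
          · rw [Subgroup.closure_le]
            rintro x (rfl | hx)
            · have : f * (f⁻¹ * x) ∈ Subgroup.closure (insert (f⁻¹ * x) (fset code τ.mem j)) :=
                mul_mem (Subgroup.subset_closure (.inr hfm)) (Subgroup.subset_closure (.inl rfl))
              rwa [mul_inv_cancel_left] at this
            · exact Subgroup.subset_closure (.inr hx))
  obtain ⟨hfr, hFτ, hc⟩ := main
  refine ⟨hFτ, ?_, hfr⟩
  rcases hc with ⟨-, h⟩ | ⟨h, -, hfix, hcl⟩
  · exact h
  -- A remainder that has passed all `N` points is the identity, so dropping it loses nothing.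
  · have h1 : h = 1 := T.eq_of_act_eq fun p hp => by rw [hfix p hp, T.act_one hp]
    rw [← hcl, h1, Subgroup.closure_insert_one]

end Tables

end SubspTrans

/-! ### Programs for orbits of vectors and for Schreier generators -/

namespace Ram

/-- The address of the basis of the source. -/
def xA (G : Globals) : ℕ := 4 + 2 * (G.q * G.q) + G.m * (G.n * G.n)

/-- Expression for `xA`. -/
def xE : Exp := 4 + 2 * (.glob .q * .glob .q) + .glob .m * (.glob .n * .glob .n)

@[simp] theorem eval_xE (G : Globals) (mem : ℕ → ℕ) (ρ : List ℕ) : xE.eval G mem ρ = xA G := rfl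

/-- The step of the orbit computation for a point and a generator. -/
def orbitBody : Stm :=
  -- Variables: 0 the level, 1 the initial vector, 2 the round, 3 the point, 4 and 5 the place in
  -- the filter, 6 the generator plus one, 7 the image of the point.
  .letIn (.app2 appF (.var 6 - 1) (.var 3))
    (.ite (.load (trE (.var 0) (.var 7))) .skip
      (.store (trE (.var 0) (.var 7))
        (.app2 compF (.var 6 - 1) (.load (trE (.var 0) (.var 3)) - 1) + 1)))

/-- One round of the orbit computation. -/
def orbitRound : Stm :=
  .loop false (.glob .N)
    (.ite (.load (trE (.var 0) (.var 3))) (forGens 4 (.var 0) orbitBody) .skip)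

/-- Argument `j`: the orbit of the `j`-th vector under the group of the `j`-th filter. -/
def orbitS : Stm :=
  .letIn (.app1 vecF (xE + .var 0 * .glob .n))
    (.seq (.store (trE (.var 0) (.var 1)) (.app1 idF 0 + 1))
      (.loop false (.glob .N) orbitRound))

/-- Argument `j`: sift the Schreier generators of the stabilizer of the `j`-th vector through the
next filter. -/
def schreierS : Stm :=
  .loop false (.glob .N) (.letIn (.load (trE (.var 0) (.var 1))) (.ite (.var 2)
    (forGens 3 (.var 0) (.call2 (.var 0 + 1)
      -- The Schreier generator `t (s x)⁻¹ * (s * t x)`: the point `x` is variable 1, `t x` is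
      -- variable 2 and `s` is variable 5, the matrices being stored plus one.
      (.app2 compF (.app1 invF (.load (trE (.var 0) (.app2 appF (.var 5 - 1) (.var 1))) - 1))
        (.app2 compF (.var 5 - 1) (.var 2 - 1))) insertS))
    .skip))

end Ram

/-! ### Schreier's lemma and the correctness of the orbit computation -/

namespace SubspTrans

open Ram Matrix

/-- In a finite group inverses are powers, so the generated subgroup is the generated submonoid.
Orbits and Schreier generators therefore never need inverses of generators. -/
theorem closure_induction_of_finite {A : Type*} [Group A] [Finite A] {S : Set A}
    {P : A → Prop} (one : P 1)
    (mul : ∀ s ∈ S, ∀ g ∈ Subgroup.closure S, P g → P (s * g)) :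
    ∀ g ∈ Subgroup.closure S, P g := by
  intro g hg
  have hg' : g ∈ Submonoid.closure S := by
    rw [← Subgroup.closure_toSubmonoid_of_finite]; exact hg
  induction hg' using Submonoid.closure_induction_left with
  | one => exact one
  | mul_left s hs g h ih =>
    have hgS : g ∈ Subgroup.closure S := Subgroup.le_closure_toSubmonoid S h
    exact mul s hs g hgS (ih hgS)

variable {F : Type} [Field F] {G : Globals} [NeZero G.q] {code : F ≃ Fin G.q}

/-- The image of a vector. -/
def mv {n : ℕ} (g : GL (Fin n) F) (x : Fin n → F) : Fin n → F := (g : Matrix (Fin n) (Fin n) F) *ᵥ x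

@[simp] theorem mv_one {n : ℕ} (x : Fin n → F) : mv 1 x = x := by simp [mv]

theorem mv_mul {n : ℕ} (g h : GL (Fin n) F) (x : Fin n → F) : mv (g * h) x = mv g (mv h x) := by
  simp [mv]

theorem mv_inv_mv {n : ℕ} (g : GL (Fin n) F) (x : Fin n → F) : mv g⁻¹ (mv g x) = x := by
  rw [← mv_mul, inv_mul_cancel, mv_one]

theorem mv_mv_inv {n : ℕ} (g : GL (Fin n) F) (x : Fin n → F) : mv g (mv g⁻¹ x) = x := by
  rw [← mv_mul, mul_inv_cancel, mv_one]

/-- Schreier's lemma: quotients of transversal elements generate the stabilizer. -/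
theorem mem_of_schreier {n : ℕ} [Finite (GL (Fin n) F)] {S : Set (GL (Fin n) F)} {v : Fin n → F}
    {t : (Fin n → F) → GL (Fin n) F} {D : Subgroup (GL (Fin n) F)} (ht : t v = 1)
    (hD : ∀ h ∈ Subgroup.closure S, ∀ s ∈ S, (t (mv s (mv h v)))⁻¹ * (s * t (mv h v)) ∈ D)
    {g : GL (Fin n) F} (hg : g ∈ Subgroup.closure S) (hv : mv g v = v) : g ∈ D := by
  -- Multiplying `g` by a generator `s` on the left changes `(t (g v))⁻¹ g` by a Schreier generator
  -- on the left. For `g` fixing `v` the quotient is `g` itself, because `t v = 1`.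
  have := closure_induction_of_finite (S := S) (P := fun g => (t (mv g v))⁻¹ * g ∈ D)
    (by simp [ht]) (fun s hs g hg h => by
      have h1 := mul_mem (hD g hg s hs) h
      rw [mv_mul]
      convert h1 using 1
      group) g hg
  simpa [hv, ht] using this

/-- The memory holds an instance of the problem. -/
structure Input (G : Globals) [NeZero G.q] (code : F ≃ Fin G.q)
    (gens : Fin G.m → GL (Fin G.n) F)
    (x y : Fin G.k → Fin G.n → F) (mem : ℕ → ℕ) : Prop where
  tables : Tables G code mem
  hk : G.k ≤ G.n
  gens : ∀ (i : Fin G.m) (a b : Fin G.n), mem (4 + 2 * (G.q * G.q) + i * (G.n * G.n) + a * G.n + b)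
    = code ((gens i : Matrix _ _ F) a b)
  xs : ∀ (l : Fin G.k) (i : Fin G.n), mem (xA G + l * G.n + i) = code (x l i)
  ys : ∀ (l : Fin G.k) (i : Fin G.n), mem (xA G + G.k * G.n + l * G.n + i) = code (y l i)
  le_base : xA G + G.k * G.n + G.k * G.n ≤ G.base

theorem mul_add_lt_mul {k n l i : ℕ} (hl : l < k) (hi : i < n) : l * n + i < k * n := by
  have : (l + 1) * n ≤ k * n := Nat.mul_le_mul_right _ hl
  linarith

theorem Input.congr {gens : Fin G.m → GL (Fin G.n) F} {x y : Fin G.k → Fin G.n → F}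
    {mem mem' : ℕ → ℕ} (I : Input G code gens x y mem)
    (e : ∀ a < G.base, mem' a = mem a) : Input G code gens x y mem' where
  tables := I.tables.congr e
  hk := I.hk
  gens i a b := by
    have h1 := mul_add_lt_mul i.2 (mul_add_lt_mul a.2 b.2)
    have h2 := I.le_base
    rw [e _ (by unfold xA at h2; omega), I.gens]
  xs l i := by
    have h1 := mul_add_lt_mul l.2 i.2
    have h2 := I.le_base
    rw [e _ (by omega), I.xs]
  ys l i := by
    have h1 := mul_add_lt_mul l.2 i.2
    have h2 := I.le_base
    rw [e _ (by omega), I.ys]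
  le_base := I.le_base

/-- The memory holds the orbit of `v` under `H` on the level `j`, with a transversal. -/
structure Orbit (code : F ≃ Fin G.q) (mem : ℕ → ℕ) (j : ℕ) (H : Subgroup (GL (Fin G.n) F))
    (v : Fin G.n → F) : Prop where
  sound : ∀ x : Fin G.n → F, mem (tr G j (vc code x)) = 0 ∨
    ∃ g ∈ H, mem (tr G j (vc code x)) = pc code g + 1 ∧ mv g v = x
  full : ∀ g ∈ H, mem (tr G j (vc code (mv g v))) ≠ 0
  start : mem (tr G j (vc code v)) = pc code (1 : GL (Fin G.n) F) + 1

theorem Orbit.congr {mem mem' : ℕ → ℕ} {j : ℕ} {H : Subgroup (GL (Fin G.n) F)}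
    {v : Fin G.n → F} (h : Orbit code mem j H v)
    (e : ∀ x : Fin G.n → F, mem' (tr G j (vc code x)) = mem (tr G j (vc code x))) :
    Orbit code mem' j H v where
  sound x := by rw [e]; exact h.sound x
  full g hg := by rw [e]; exact h.full g hg
  start := by rw [e]; exact h.start

/-- The cells of the transversal on the level `j`. -/
def trCells (G : Globals) (j : ℕ) : Set ℕ := {a | ∃ x < G.N, a = tr G j x}

theorem finite_of_code (code : F ≃ Fin G.q) : Finite F := Finite.of_equiv _ code.symm

theorem finite_GL (code : F ≃ Fin G.q) : Finite (GL (Fin G.n) F) := by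
  have := finite_of_code code
  infer_instance

theorem card_vec (code : F ≃ Fin G.q) : Nat.card (Fin G.n → F) = G.q ^ G.n := by
  have := finite_of_code code
  rw [Nat.card_fun, Nat.card_congr code]
  simp

theorem ft_ne_tr {j p w j' x : ℕ} : ft G j p w ≠ tr G j' x := by
  rw [ft, tr, ne_eq, adr_inj (by norm_num) (by norm_num)]; omega

section
variable {σ : Store}

theorem appF_act {mem : ℕ → ℕ} (T : Tables G code mem) (g : GL (Fin G.n) F) (x : Fin G.n → F) :
    appF.eval G mem [pc code g, vc code x] = vc code (mv g x) := T.eval_appF g x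

/-- The invariant of the orbit computation. -/
structure OrbitInv (code : F ≃ Fin G.q) (j : ℕ) (H : Subgroup (GL (Fin G.n) F))
    (v : Fin G.n → F) (σ τ : Store) : Prop where
  frame : Frame (trCells G j) σ τ
  sound : ∀ x : Fin G.n → F, τ.mem (tr G j (vc code x)) = 0 ∨
    ∃ g ∈ H, τ.mem (tr G j (vc code x)) = pc code g + 1 ∧ mv g v = x
  start : τ.mem (tr G j (vc code v)) = pc code (1 : GL (Fin G.n) F) + 1

theorem trCells_base (j : ℕ) : ∀ a ∈ trCells G j, G.base ≤ a := by
  rintro a ⟨x, -, rfl⟩; exact base_le_adr _ _ _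

theorem tr_mem_trCells {mem : ℕ → ℕ} (T : Tables G code mem) (j : ℕ) (z : Fin G.n → F) :
    tr G j (vc code z) ∈ trCells G j := ⟨_, T.vc_lt z, rfl⟩

open Classical in
theorem update_tr {mem : ℕ → ℕ} (T : Tables G code mem) (mem' : ℕ → ℕ) (j val : ℕ)
    (u z : Fin G.n → F) :
    Function.update mem' (tr G j (vc code z)) val (tr G j (vc code u)) =
      if u = z then val else mem' (tr G j (vc code u)) := by
  rw [Function.update_apply]
  congr 1
  rw [tr_inj (T.vc_lt u) (T.vc_lt z), vc_injective.eq_iff, eq_iff_iff]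
  simp

/-- Every round applies all generators to all marked points. A set of marked points that a round
leaves unchanged is closed under the generators and hence contains the orbit. A point that is marked
keeps its first transversal element, so the initial vector keeps the identity. -/
theorem orbitS_spec {gens : Fin G.m → GL (Fin G.n) F} {x y : Fin G.k → Fin G.n → F}
    (I : Input G code gens x y σ.mem) (j : Fin G.k) (hF : Filt code σ.mem j)
    (h0 : ∀ p < G.N, σ.mem (tr G j p) = 0) :
    Orbit code (orbitS.run G [(j : ℕ)] σ).mem j (Subgroup.closure (fset code σ.mem j)) (x j) ∧
      Frame (trCells G j) σ (orbitS.run G [(j : ℕ)] σ) := by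
  classical
  have T := I.tables
  have := finite_GL code
  have := finite_of_code code
  set H := Subgroup.closure (fset code σ.mem j) with hH
  set v := x j with hv
  have hvec : vecF.eval G σ.mem [xA G + j * G.n] = vc code v := T.eval_vecF (I.xs j)
  simp only [orbitS, Stm.run_letIn, Stm.run_seq, Stm.run_store, eval_trE, Exp.eval_add,
    Exp.eval_var, Exp.eval_app1, eval_xE, Exp.eval_mul, Exp.eval_n, List.getD_cons_succ,
    List.getD_cons_zero, List.cons_append, List.nil_append, hvec, T.eval_idF, Exp.eval_one,
    Nat.mod_eq_of_lt (T.pc_succ_lt _)]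
  set σ₁ : Store := ⟨Function.update σ.mem (tr G j (vc code v))
    (pc code (1 : GL (Fin G.n) F) + 1), σ.out⟩ with hσ₁
  have J₁ : OrbitInv code j H v σ σ₁ := by
    refine ⟨Frame.update (tr_mem_trCells T j v) _, fun z => ?_, by simp [hσ₁]⟩
    rw [hσ₁]
    dsimp only
    rw [update_tr T]
    split_ifs with h
    · exact .inr ⟨1, one_mem _, rfl, by rw [mv_one, h]⟩
    · exact .inl (h0 _ (T.vc_lt z))
  let marked : Store → Set (Fin G.n → F) := fun τ => {z | τ.mem (tr G j (vc code z)) ≠ 0}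
  -- one step
  have step : ∀ r p w z, ∀ g ∈ fset code σ.mem j, ∀ τ, OrbitInv code j H v σ τ → z ∈ marked τ →
      let τ' := orbitBody.run G
                ([(j : ℕ), vc code v, r, vc code z] ++ [p, w, pc code g + 1]) τ
      OrbitInv code j H v σ τ' ∧ marked τ ⊆ marked τ' ∧ mv g z ∈ marked τ' := by
    intro r p w z g hg τ J hz
    have Tτ : Tables G code τ.mem := T.congr (J.frame.below (trCells_base _))
    obtain h1 | ⟨f, hf, hfz, hfv⟩ := J.sound z
    · exact absurd h1 hz
    simp only [orbitBody, Stm.run_letIn, Stm.run_ite, Stm.run_skip, Exp.eval_load, eval_trE, Exp.eval_var,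
        Exp.eval_app2, Exp.eval_sub, Exp.eval_one, List.cons_append,
        List.nil_append, List.getD_cons_succ, List.getD_cons_zero, Stm.run_store,
        Exp.eval_add, Nat.add_sub_cancel, appF_act Tτ, hfz, Tτ.eval_compF,
        Nat.mod_eq_of_lt (Tτ.pc_succ_lt _)]
    split_ifs with hm
    · exact ⟨J, subset_rfl, hm⟩
    · have e : ∀ u : Fin G.n → F, Function.update τ.mem (tr G j (vc code (mv g z)))
          (pc code (g * f) + 1) (tr G j (vc code u)) =
          if u = mv g z then pc code (g * f) + 1 else τ.mem (tr G j (vc code u)) :=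
        fun u => update_tr T _ _ _ _ _
      refine ⟨⟨J.frame.trans (Frame.update (tr_mem_trCells T j _) _), fun u => ?_, ?_⟩,
        fun u hu => ?_, ?_⟩
      · dsimp only
        rw [e u]
        split_ifs with hu
        · refine .inr ⟨g * f, mul_mem (Subgroup.subset_closure hg) hf, rfl, ?_⟩
          rw [mv_mul, hfv, hu]
        · exact J.sound u
      · dsimp only
        rw [e v, if_neg, J.start]
        intro hh
        rw [← hh, J.start] at hm
        omega
      · show Function.update _ _ _ _ ≠ 0
        rw [e u]
        split_ifs
        · omega
        · exact hu
      · show Function.update _ _ _ _ ≠ 0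
        rw [e, if_pos rfl]
        omega
  -- one round
  have round : ∀ r τ, OrbitInv code j H v σ τ →
      let τ' := orbitRound.run G [(j : ℕ), vc code v, r] τ
      OrbitInv code j H v σ τ' ∧ marked τ ⊆ marked τ' ∧
        ∀ z ∈ marked τ, ∀ g ∈ fset code σ.mem j, mv g z ∈ marked τ' := by
    intro r τ J
    dsimp only
    rw [orbitRound, Stm.run_loop _ _ _ _ _ (by simp)]
    simp only [Exp.eval_N]
    have h1 := iterFrom_induction (a := τ) (c := G.N)
      (f := fun i σ => (Stm.ite (.load (trE (.var 0) (.var 3)))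
        (forGens 4 (.var 0) orbitBody)
        .skip).run G ([(j : ℕ), vc code v, r] ++ [i]) σ)
      (fun i υ => OrbitInv code j H v σ υ ∧ marked τ ⊆ marked υ ∧
        ∀ z ∈ marked τ, vc code z < i → ∀ g ∈ fset code σ.mem j, mv g z ∈ marked υ)
      ⟨J, subset_rfl, by omega⟩ (by
        rintro i hi υ ⟨Jυ, hsub, hcl⟩
        set z : Fin G.n → F := vec code i with hz
        have hiz : i = vc code z := (T.vc_vec hi).symm
        rw [Stm.run_ite]
        simp only [Exp.eval_load, eval_trE, Exp.eval_var, List.cons_append, List.nil_append,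
          List.getD_cons_zero, List.getD_cons_succ]
        rw [hiz]
        have last : ∀ u, vc code u < vc code z + 1 → vc code u < vc code z ∨ u = z := by
          intro u hu
          rcases Nat.lt_succ_iff_lt_or_eq.1 hu with h | h
          · exact .inl h
          · exact .inr (vc_injective h)
        split_ifs with hm
        · have hft : ∀ τ', OrbitInv code j H v σ τ' → ∀ p < G.N, ∀ w < G.N,
              τ'.mem (ft G j p w) = σ.mem (ft G j p w) := fun τ' h p _ w _ =>
            h.frame.mem _ (by rintro ⟨u, -, h⟩; exact ft_ne_tr h)
          have hset : fset code υ.mem j = fset code σ.mem j := fset_congr (hft _ Jυ)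
          have := Tables.forGens_rule (σ := υ) (T.congr (Jυ.frame.below (trCells_base _)))
            (d := 4) (j := j) (ρ := [(j : ℕ), vc code v, r, vc code z]) (jE := .var 0)
            (body := orbitBody) rfl
            (hF.congr (hft _ Jυ)) (fun _ _ => rfl)
            (fun τ' => OrbitInv code j H v σ τ' ∧ marked υ ⊆ marked τ')
            (fun g τ' => mv g z ∈ marked τ') ⟨Jυ, subset_rfl⟩
            (fun τ' h p hp w hw => by rw [hft _ h.1 p hp w hw, hft _ Jυ p hp w hw])
            (fun p w g hg τ' h => by
              rw [hset] at hg
              obtain ⟨k1, k2, k3⟩ := step r p w z g hg τ' h.1 (h.2 hm)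
              exact ⟨⟨k1, h.2.trans k2⟩, k3, fun _ hh => k2 hh⟩)
          obtain ⟨⟨k1, k2⟩, k3⟩ := this
          refine ⟨k1, hsub.trans k2, fun u hu hlt g hg => ?_⟩
          rcases last u hlt with h | rfl
          · exact k2 (hcl u hu (hiz ▸ h) g hg)
          · exact k3 g (hset ▸ hg)
        · refine ⟨Jυ, hsub, fun u hu hlt g hg => ?_⟩
          rcases last u hlt with h | rfl
          · exact hcl u hu (hiz ▸ h) g hg
          · exact absurd (hsub hu) hm)
    exact ⟨h1.1, h1.2.1, fun z hz => h1.2.2 z hz (T.vc_lt z)⟩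
  rw [Stm.run_loop _ _ _ _ _ (by simp)]
  simp only [Exp.eval_N, List.cons_append, List.nil_append]
  -- As long as the orbit is incomplete, each round marks a new point. After `N` rounds there would
  -- be more than `N` marked points, which is impossible.
  have main := iterFrom_induction (a := σ₁) (c := G.N)
    (f := fun r σ => orbitRound.run G [(j : ℕ), vc code v, r] σ)
    (fun r τ => OrbitInv code j H v σ τ ∧
      ((∀ g ∈ H, mv g v ∈ marked τ) ∨ r + 1 ≤ (marked τ).ncard))
    ⟨J₁, .inr (by
      rw [zero_add, Nat.one_le_iff_ne_zero, ne_eq, Set.ncard_eq_zero]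
      intro h
      have : v ∈ marked σ₁ := by
        show _ ≠ 0
        rw [J₁.start]; omega
      rw [h] at this
      exact this)⟩ (by
      rintro r hr τ ⟨J, hc⟩
      obtain ⟨k1, k2, k3⟩ := round r τ J
      refine ⟨k1, ?_⟩
      rcases hc with hc | hc
      · exact .inl fun g hg => k2 (hc g hg)
      by_cases heq : marked τ = marked (orbitRound.run G [(j : ℕ), vc code v, r] τ)
      · refine .inl fun g hg => k2 ?_
        refine closure_induction_of_finite (P := fun g => mv g v ∈ marked τ) ?_ ?_ g hg
        · rw [mv_one]
          show _ ≠ 0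
          rw [J.start]; omega
        · intro s hs g _ h
          rw [mv_mul, heq]
          exact k3 _ h s hs
      · exact .inr ((Nat.succ_le_succ hc).trans
          (Set.ncard_lt_ncard (ssubset_of_subset_of_ne k2 heq))))
  obtain ⟨J, hc⟩ := main
  refine ⟨⟨J.sound, ?_, J.start⟩, J.frame⟩
  rcases hc with hc | hc
  · exact hc
  · have h1 := hc.trans (Set.ncard_le_card _)
    rw [card_vec code, ← T.hN] at h1
    omega

end

end SubspTrans

/-! ### The stabilizer of a vector -/

namespace SubspTrans

open Ram Matrix

variable {F : Type} [Field F] {G : Globals} [NeZero G.q] {code : F ≃ Fin G.q} {σ : Store}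

/-- The invertible matrices that fix a vector. -/
def fixer {n : ℕ} (v : Fin n → F) : Subgroup (GL (Fin n) F) where
  carrier := {g | mv g v = v}
  one_mem' := mv_one v
  mul_mem' := by
    intro a b ha hb
    change mv a v = v at ha
    change mv b v = v at hb
    show mv (a * b) v = v
    rw [mv_mul, hb, ha]
  inv_mem' := by
    intro a ha
    change mv a v = v at ha
    show mv a⁻¹ v = v
    nth_rewrite 1 [← ha]
    rw [mv_inv_mv]

theorem mem_fixer {n : ℕ} {v : Fin n → F} {g : GL (Fin n) F} : g ∈ fixer v ↔ mv g v = v := Iff.rfl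

/-- The cells which sifting changes. -/
def insCells (G : Globals) (j : ℕ) : Set ℕ := insert (cur G) (ftCells G j)

theorem insCells_base (j : ℕ) : ∀ a ∈ insCells G j, G.base ≤ a := by
  rintro a (rfl | ⟨p, -, w, -, rfl⟩) <;> exact base_le_adr _ _ _

theorem ft_notMem_insCells {j j' p w : ℕ} (hp : p < G.N) (hw : w < G.N) (h : j ≠ j') :
    ft G j p w ∉ insCells G j' := by
  rintro (e | ⟨p', hp', w', hw', e⟩)
  · rw [cur, ft, adr_inj (by norm_num) (by norm_num)] at e
    omega
  · exact h ((ft_inj hp hp' hw hw').1 e).1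

theorem adr_notMem_insCells {j t x : ℕ} (ht : t < 8) (h0 : t ≠ 0) (h5 : t ≠ 5) :
    adr G t x ∉ insCells G j := by
  rintro (e | ⟨p', hp', w', hw', e⟩)
  · rw [cur, adr_inj ht (by norm_num)] at e
    exact h5 e.1
  · rw [ft, adr_inj ht (by norm_num)] at e
    exact h0 e.1

theorem Tables.of_frame (T : Tables G code σ.mem) {A : Set ℕ} {τ : Store} (h : Frame A σ τ)
    (hA : ∀ a ∈ A, G.base ≤ a) : Tables G code τ.mem := T.congr (h.below hA)

theorem fset_eq_empty {mem : ℕ → ℕ} {j : ℕ}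
    (h : ∀ p < G.N, ∀ w < G.N, mem (ft G j p w) = 0) : fset code mem j = ∅ := by
  ext g
  simp only [Set.mem_empty_iff_false, iff_false]
  rintro ⟨p, hp, w, hw, e⟩
  rw [h p hp w hw] at e
  omega

/-- The sifted matrices are the Schreier generators for all points of the orbit and all matrices of
the filter `j`. Each of them fixes `v`, and by Schreier's lemma they generate the stabilizer of `v`.
There may be `N ^ 3` of them, but the new filter again has only `N ^ 2` cells. -/
theorem schreierS_spec (T : Tables G code σ.mem) {j : ℕ} {v : Fin G.n → F}
    (hF : Filt code σ.mem j)
    (hO : Orbit code σ.mem j (Subgroup.closure (fset code σ.mem j)) v)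
    (h0 : ∀ p < G.N, ∀ w < G.N, σ.mem (ft G (j + 1) p w) = 0) :
    Filt code (schreierS.run G [j] σ).mem (j + 1) ∧
      Subgroup.closure (fset code (schreierS.run G [j] σ).mem (j + 1))
        = Subgroup.closure (fset code σ.mem j) ⊓ fixer v ∧
      Frame (insCells G (j + 1)) σ (schreierS.run G [j] σ) := by
  have := finite_GL code
  set S := fset code σ.mem j with hS
  set H := Subgroup.closure S with hH
  -- A transversal as a function on all vectors; off the orbit its value is irrelevant.
  have hex : ∀ x : Fin G.n → F, ∃ f : GL (Fin G.n) F, σ.mem (tr G j (vc code x)) ≠ 0 →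
      f ∈ H ∧ σ.mem (tr G j (vc code x)) = pc code f + 1 ∧ mv f v = x := by
    intro x
    rcases hO.sound x with h | ⟨f, h1, h2, h3⟩
    · exact ⟨1, fun h' => absurd h h'⟩
    · exact ⟨f, fun _ => ⟨h1, h2, h3⟩⟩
  choose t ht using hex
  have htr : ∀ τ : Store, Frame (insCells G (j + 1)) σ τ → ∀ x, τ.mem (tr G j x) =
      σ.mem (tr G j x) := fun τ h x =>
    h.mem _ (adr_notMem_insCells (by norm_num) (by norm_num) (by norm_num))
  have hft : ∀ τ : Store, Frame (insCells G (j + 1)) σ τ → ∀ p < G.N, ∀ w < G.N,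
      τ.mem (ft G j p w) = σ.mem (ft G j p w) := fun τ h p hp w hw =>
    h.mem _ (ft_notMem_insCells hp hw (by omega))
  have hmark : ∀ x, σ.mem (tr G j (vc code x)) ≠ 0 → ∀ s ∈ S,
      σ.mem (tr G j (vc code (mv s x))) ≠ 0 := by
    intro x hx s hs
    obtain ⟨h1, -, h3⟩ := ht x hx
    rw [← h3, ← mv_mul]
    exact hO.full _ (mul_mem (Subgroup.subset_closure hs) h1)
  set c : Store → Subgroup (GL (Fin G.n) F) :=
    fun τ => Subgroup.closure (fset code τ.mem (j + 1)) with hc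
  set J : Store → Prop := fun τ => Frame (insCells G (j + 1)) σ τ ∧ Filt code τ.mem (j + 1) ∧
    c τ ≤ H ⊓ fixer v with hJ
  have step : ∀ x, σ.mem (tr G j (vc code x)) ≠ 0 → ∀ p w, ∀ s ∈ S, ∀ τ, J τ →
      let τ' := (Stm.call2 (.var 0 + 1)
      (.app2 compF (.app1 invF (.load (trE (.var 0) (.app2 appF (.var 5 - 1) (.var 1))) - 1))
        (.app2 compF (.var 5 - 1) (.var 2 - 1))) insertS).run G
          ([j, vc code x, pc code (t x) + 1] ++ [p, w, pc code s + 1]) τ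
      J τ' ∧ c τ ≤ c τ' ∧ (t (mv s x))⁻¹ * (s * t x) ∈ c τ' := by
    intro x hx p w s hs τ hτ
    have Tτ := T.of_frame hτ.1 (insCells_base _)
    obtain ⟨a1, a2, a3⟩ := ht x hx
    obtain ⟨b1, b2, b3⟩ := ht _ (hmark x hx s hs)
    simp only [Stm.run_call2, Exp.eval_add, Exp.eval_var, Exp.eval_one, Exp.eval_app2,
      Exp.eval_app1, Exp.eval_sub, Exp.eval_load, eval_trE, List.cons_append, List.nil_append,
      List.getD_cons_succ, List.getD_cons_zero, Nat.add_sub_cancel, appF_act Tτ, htr τ hτ.1, b2,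
      Tτ.eval_invF, Tτ.eval_compF]
    obtain ⟨k1, k2, k3⟩ := Tτ.insertS_spec hτ.2.1 ((t (mv s x))⁻¹ * (s * t x))
    refine ⟨⟨hτ.1.trans k3, k1, ?_⟩, ?_, ?_⟩
    · simp only [hc]
      rw [k2, Subgroup.closure_le]
      rintro g (rfl | hg)
      · refine Subgroup.mem_inf.2
          ⟨mul_mem (inv_mem b1) (mul_mem (Subgroup.subset_closure hs) a1), ?_⟩
        rw [mem_fixer, mv_mul, mv_mul, a3]
        nth_rewrite 2 [← b3]
        rw [mv_inv_mv]
      · exact hτ.2.2 (Subgroup.subset_closure hg)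
    · simp only [hc]
      rw [k2]
      exact Subgroup.closure_mono (Set.subset_insert _ _)
    · simp only [hc]
      rw [k2]
      exact Subgroup.subset_closure (Set.mem_insert _ _)
  rw [schreierS, Stm.run_loop _ _ _ _ _ (by simp)]
  simp only [Exp.eval_N]
  have main := iterFrom_induction (a := σ) (c := G.N)
    (f := fun i σ => (Stm.letIn (.load (trE (.var 0) (.var 1))) (.ite (.var 2)
    (forGens 3 (.var 0) (.call2 (.var 0 + 1)
      (.app2 compF (.app1 invF (.load (trE (.var 0) (.app2 appF (.var 5 - 1) (.var 1))) - 1))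
        (.app2 compF (.var 5 - 1) (.var 2 - 1))) insertS))
    .skip)).run G ([j] ++ [i]) σ)
    (fun i τ => J τ ∧ ∀ x, σ.mem (tr G j (vc code x)) ≠ 0 → vc code x < i → ∀ s ∈ S,
      (t (mv s x))⁻¹ * (s * t x) ∈ c τ)
    ⟨⟨Frame.refl _ _, fun p hp w hw => .inl (h0 p hp w hw), by
      simp [hc, fset_eq_empty h0]⟩, by omega⟩ (by
      rintro i hi τ ⟨hτ, hD⟩
      set z : Fin G.n → F := vec code i with hz
      have hiz : i = vc code z := (T.vc_vec hi).symm
      rw [hiz]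
      have last : ∀ u, vc code u < vc code z + 1 → vc code u < vc code z ∨ u = z := by
        intro u hu
        rcases Nat.lt_succ_iff_lt_or_eq.1 hu with h | h
        · exact .inl h
        · exact .inr (vc_injective h)
      simp only [Stm.run_letIn, Exp.eval_load, eval_trE, Exp.eval_var, List.cons_append,
        List.nil_append, List.getD_cons_succ, List.getD_cons_zero, htr τ hτ.1]
      rw [Stm.run_ite]
      simp only [Exp.eval_var, List.getD_cons_succ, List.getD_cons_zero]
      split_ifs with hm
      · obtain ⟨a1, a2, a3⟩ := ht z hm
        rw [a2]
        have hset : fset code τ.mem j = S := fset_congr (hft _ hτ.1)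
        obtain ⟨⟨k1, k2⟩, k3⟩ := Tables.forGens_rule (σ := τ) (T.of_frame hτ.1 (insCells_base _))
            (d := 3) (j := j) (ρ := [j, vc code z, pc code (t z) + 1]) (jE := .var 0)
            (body := (.call2 (.var 0 + 1)
      (.app2 compF (.app1 invF (.load (trE (.var 0) (.app2 appF (.var 5 - 1) (.var 1))) - 1))
        (.app2 compF (.var 5 - 1) (.var 2 - 1))) insertS)) rfl
            (hF.congr (hft _ hτ.1)) (fun _ _ => rfl)
            (fun υ => J υ ∧ c τ ≤ c υ)
            (fun s υ => (t (mv s z))⁻¹ * (s * t z) ∈ c υ) ⟨hτ, le_rfl⟩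
            (fun υ h p hp w hw => by rw [hft _ h.1.1 p hp w hw, hft _ hτ.1 p hp w hw])
            (fun p w g hg υ h => by
              rw [hset] at hg
              obtain ⟨k1, k2, k3⟩ := step z hm p w g hg υ h.1
              exact ⟨⟨k1, h.2.trans k2⟩, k3, fun _ hh => k2 hh⟩)
        refine ⟨k1, fun x hx hlt s hs => ?_⟩
        rcases last x hlt with h | rfl
        · exact k2 (hD x hx (hiz ▸ h) s hs)
        · exact k3 s (hset ▸ hs)
      · refine ⟨hτ, fun x hx hlt s hs => ?_⟩
        rcases last x hlt with h | rfl
        · exact hD x hx (hiz ▸ h) s hs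
        · exact absurd hx hm)
  obtain ⟨⟨k1, k2, k3⟩, hD⟩ := main
  refine ⟨k2, le_antisymm k3 ?_, k1⟩
  rintro g ⟨hg, hgv⟩
  have hbase := hO.start
  have htv : t v = 1 := by
    obtain ⟨-, h2, -⟩ := ht v (by rw [hbase]; omega)
    rw [hbase] at h2
    exact (T.pc_injective (Nat.succ_injective h2)).symm
  exact mem_of_schreier htv (fun h hh s hs => hD _ (hO.full h hh) (T.vc_lt _) s hs) hg hgv

end SubspTrans

/-! ### Program for the passage to the next level -/

namespace Ram

/-- Expression for the source. -/
def srcE : Exp := .app2 spanF xE (.glob .k)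

/-- Expression for the target. -/
def tgtE : Exp := .app2 spanF (xE + .glob .k * .glob .n) (.glob .k)

/-- Append a subspace to the list of the next level. The variable `0` is the level, the variable
`4` is the subspace, and the variable `6` is the transporter. -/
def recordS : Stm :=
  .ite (.load (ttE (.var 4))) .skip
    (.seq (.store (ttE (.var 4)) (.var 6 + 1))
      (.seq (.store (liE (.var 0 + 1) (.load (lenE (.var 0 + 1)))) (.var 4))
        (.store (lenE (.var 0 + 1)) (.load (lenE (.var 0 + 1)) + 1))))

/-- Extend the subspace in the variable `2` by the vector in the variable `3`. -/
def extendBody : Stm :=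
  -- Variables: 0 the level, 1 the position in the list, 2 the subspace `U`, 3 the vector `z`; then
  -- 4 becomes `U + F z`, 5 the transversal entry for `f⁻¹ z` with `f` the transporter of `U`, and 6
  -- the new transporter.
  .ite (.app2 bitF (.var 2) (.var 3)) .skip
    (.letIn (.app2 extF (.var 2) (.var 3))
      (.letIn (.load (trE (.var 0) (.app2 preF (.load (ttE (.var 2)) - 1) (.var 3))))
        (.ite (.var 5)
          -- The sum of the two truth values is nonzero exactly when the subspace lies in the source
          -- or in the target.
          (.ite (.app2 subF (.var 4) srcE + .app2 subF (.var 4) tgtE)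
            (.letIn (.app2 compF (.load (ttE (.var 2)) - 1) (.var 5 - 1))
              (.seq recordS
                (.ite ((Exp.var 4).same (.app2 spanF xE (.var 0 + 1)))
                  (.call2 (.var 0 + 1) (.var 6) insertS) .skip)))
            .skip)
          .skip)))

/-- Argument `j`: compute the next level. -/
def extendS : Stm :=
  .loop true (.load (lenE (.var 0)))
    (.letIn (.load (liE (.var 0) (.var 1))) (.loop false (.glob .N) extendBody))

end Ram

/-! ### Images of subspaces and the lists of a level -/

namespace SubspTrans

open Ram Matrix

section linear

variable {F : Type} [Field F] {n : ℕ}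

/-- The image of a subspace under an invertible matrix. -/
def smap (g : GL (Fin n) F) (U : Submodule F (Fin n → F)) : Submodule F (Fin n → F) :=
  U.map (Matrix.mulVecLin (g : Matrix (Fin n) (Fin n) F))

theorem mem_smap {g : GL (Fin n) F} {U : Submodule F (Fin n → F)} {x : Fin n → F} :
    x ∈ smap g U ↔ mv g⁻¹ x ∈ U := by
  rw [smap, Submodule.mem_map]
  constructor
  · rintro ⟨u, hu, rfl⟩
    have : mv g⁻¹ (mv g u) = u := mv_inv_mv g u
    rwa [← this] at hu
  · exact fun h => ⟨_, h, mv_mv_inv g x⟩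

theorem smap_mul (g h : GL (Fin n) F) (U : Submodule F (Fin n → F)) :
    smap (g * h) U = smap g (smap h U) := by
  ext x
  rw [mem_smap, mem_smap, mem_smap, _root_.mul_inv_rev, mv_mul]

@[simp] theorem smap_one (U : Submodule F (Fin n → F)) : smap 1 U = U := by
  ext x
  rw [mem_smap, inv_one, mv_one]

theorem smap_inv_eq {g : GL (Fin n) F} {U U' : Submodule F (Fin n → F)} (h : smap g U = U') :
    smap g⁻¹ U' = U := by
  rw [← h, ← smap_mul, inv_mul_cancel, smap_one]

theorem smap_sup_span (g : GL (Fin n) F) (U : Submodule F (Fin n → F)) (x : Fin n → F) :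
    smap g (U ⊔ Submodule.span F {x}) = smap g U ⊔ Submodule.span F {mv g x} := by
  rw [smap, Submodule.map_sup, Submodule.map_span, Set.image_singleton]
  rfl

theorem finrank_smap (g : GL (Fin n) F) (U : Submodule F (Fin n → F)) :
    Module.finrank F (smap g U) = Module.finrank F U := by
  apply le_antisymm (Submodule.finrank_map_le _ _)
  have h := Submodule.finrank_map_le
    (Matrix.mulVecLin ((g⁻¹ : GL (Fin n) F) : Matrix (Fin n) (Fin n) F)) (smap g U)
  have e : Submodule.map (Matrix.mulVecLin ((g⁻¹ : GL (Fin n) F) : Matrix (Fin n) (Fin n) F))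
    (smap g U) = U := smap_inv_eq rfl
  rwa [e] at h

/-- The stabilizer of a subspace in a matrix group. -/
def stab (A : Subgroup (GL (Fin n) F)) (U : Submodule F (Fin n → F)) :
    Subgroup (GL (Fin n) F) where
  carrier := {g | g ∈ A ∧ smap g U = U}
  one_mem' := ⟨one_mem _, smap_one U⟩
  mul_mem' := by
    rintro a b ⟨ha, ha'⟩ ⟨hb, hb'⟩
    exact ⟨mul_mem ha hb, by rw [smap_mul, hb', ha']⟩
  inv_mem' := by
    rintro a ⟨ha, ha'⟩
    exact ⟨inv_mem ha, smap_inv_eq ha'⟩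

theorem mem_stab {A : Subgroup (GL (Fin n) F)} {U : Submodule F (Fin n → F)}
    {g : GL (Fin n) F} : g ∈ stab A U ↔ g ∈ A ∧ smap g U = U := Iff.rfl

theorem finrank_flag {k : ℕ} {x : Fin k → Fin n → F} (hx : LinearIndependent F x) {j : ℕ}
    (hj : j ≤ k) : Module.finrank F (flag x j) = j := by
  have h1 : {y | ∃ i : Fin k, (i : ℕ) < j ∧ x i = y} = Set.range (x ∘ Fin.castLE hj) := by
    ext y
    simp only [Set.mem_ofPred_eq, Set.mem_range, Function.comp]
    constructor
    · rintro ⟨i, hi, rfl⟩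
      exact ⟨⟨i, hi⟩, rfl⟩
    · rintro ⟨i, rfl⟩
      exact ⟨_, i.2, rfl⟩
  rw [flag, h1, finrank_span_eq_card (hx.comp _ (Fin.castLE_injective hj)), Fintype.card_fin]

theorem notMem_flag {k : ℕ} {x : Fin k → Fin n → F} (hx : LinearIndependent F x) (j : Fin k) :
    x j ∉ flag x j := by
  intro h
  have h1 : flag x (j + 1) = flag x j := by
    rw [flag_succ, sup_eq_left, Submodule.span_le, Set.singleton_subset_iff]
    exact h
  have h2 := finrank_flag hx (show (j : ℕ) + 1 ≤ k by omega)
  rw [h1, finrank_flag hx (by omega)] at h2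
  omega

theorem flag_mono {k : ℕ} (x : Fin k → Fin n → F) {i j : ℕ} (h : i ≤ j) :
    flag x i ≤ flag x j :=
  Submodule.span_mono fun _ ⟨l, hl, e⟩ => ⟨l, by omega, e⟩

theorem smap_mono (g : GL (Fin n) F) {U U' : Submodule F (Fin n → F)} (h : U ≤ U') :
    smap g U ≤ smap g U' := Submodule.map_mono h

end linear

variable {F : Type} [Field F] {G : Globals} [NeZero G.q] {code : F ≃ Fin G.q} {σ : Store}

/-- The memory holds the list `us` of subspaces of the source or the target on the level `j`, with
transporters. -/
structure Listed (code : F ≃ Fin G.q) (A : Subgroup (GL (Fin G.n) F))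
    (x y : Fin G.k → Fin G.n → F) (mem : ℕ → ℕ) (j : ℕ)
    (us : List (Submodule F (Fin G.n → F))) : Prop where
  nodup : us.Nodup
  len : mem (len G j) = us.length
  li : ∀ i (h : i < us.length), mem (li G j i) = bm code us[i]
  good : ∀ U ∈ us, (U ≤ flag x G.k ∨ U ≤ flag y G.k) ∧ ∃ g ∈ A, smap g (flag x j) = U ∧
    mem (tt G (bm code U)) = pc code g + 1

/-- The list is complete. -/
def Complete (A : Subgroup (GL (Fin G.n) F)) (x y : Fin G.k → Fin G.n → F) (j : ℕ)
    (us : List (Submodule F (Fin G.n → F))) : Prop :=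
  ∀ g ∈ A, smap g (flag x j) ≤ flag x G.k ∨ smap g (flag x j) ≤ flag y G.k →
    smap g (flag x j) ∈ us

/-- The cells which the computation of the level `j` changes. -/
def extCells (G : Globals) [NeZero G.q] (code : F ≃ Fin G.q) (j : ℕ) : Set ℕ :=
  insCells G j ∪ ({a | ∃ U : Submodule F (Fin G.n → F), Module.finrank F U = j ∧
    a = tt G (bm code U)} ∪ ({len G j} ∪ {a | ∃ i, a = li G j i}))

theorem extCells_base (j : ℕ) : ∀ a ∈ extCells G code j, G.base ≤ a := by
  rintro a (h | ⟨U, -, rfl⟩ | rfl | ⟨i, rfl⟩)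
  · exact insCells_base j a h
  all_goals exact base_le_adr _ _ _

theorem tt_inj {mem : ℕ → ℕ} (T : Tables G code mem) {U U' : Submodule F (Fin G.n → F)} :
    tt G (bm code U) = tt G (bm code U') ↔ U = U' := by
  rw [tt, tt, adr_inj (by norm_num) (by norm_num), T.bm_injective.eq_iff]
  simp

theorem ft_notMem_extCells {j j' p w : ℕ} (hp : p < G.N) (hw : w < G.N) (h : j ≠ j') :
    ft G j p w ∉ extCells G code j' := by
  rintro (h' | ⟨U, -, e⟩ | e | ⟨i, e⟩)
  · exact ft_notMem_insCells hp hw h h'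
  · rw [ft, tt, adr_inj (by norm_num) (by norm_num)] at e; omega
  · rw [Set.mem_singleton_iff, ft, len, adr_inj (by norm_num) (by norm_num)] at e; omega
  · rw [ft, li, adr_inj (by norm_num) (by norm_num)] at e; omega

theorem tr_notMem_extCells {j j' x : ℕ} : tr G j x ∉ extCells G code j' := by
  rintro (h' | ⟨U, -, e⟩ | e | ⟨i, e⟩)
  · exact adr_notMem_insCells (by norm_num) (by norm_num) (by norm_num) h'
  · rw [tr, tt, adr_inj (by norm_num) (by norm_num)] at e; omega
  · rw [Set.mem_singleton_iff, tr, len, adr_inj (by norm_num) (by norm_num)] at e; omega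
  · rw [tr, li, adr_inj (by norm_num) (by norm_num)] at e; omega

theorem len_notMem_extCells {j j' : ℕ} (h : j ≠ j') : len G j ∉ extCells G code j' := by
  rintro (h' | ⟨U, -, e⟩ | e | ⟨i, e⟩)
  · exact adr_notMem_insCells (by norm_num) (by norm_num) (by norm_num) h'
  · rw [len, tt, adr_inj (by norm_num) (by norm_num)] at e; omega
  · rw [Set.mem_singleton_iff, len, len, adr_inj (by norm_num) (by norm_num)] at e; omega
  · rw [len, li, adr_inj (by norm_num) (by norm_num)] at e; omega

theorem li_notMem_extCells {j j' i : ℕ} (hj : j < G.N) (hj' : j' < G.N) (h : j ≠ j') :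
    li G j i ∉ extCells G code j' := by
  rintro (h' | ⟨U, -, e⟩ | e | ⟨i', e⟩)
  · exact adr_notMem_insCells (by norm_num) (by norm_num) (by norm_num) h'
  · rw [li, tt, adr_inj (by norm_num) (by norm_num)] at e; omega
  · rw [Set.mem_singleton_iff, li, len, adr_inj (by norm_num) (by norm_num)] at e; omega
  · exact h ((li_inj hj hj').1 e).1

/-- All levels share one array of transporters; the dimension of the subspace tells to which level
an entry belongs. -/
theorem tt_notMem_extCells {mem : ℕ → ℕ} (T : Tables G code mem) {j' : ℕ}
    {U : Submodule F (Fin G.n → F)} (h : Module.finrank F U ≠ j') :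
    tt G (bm code U) ∉ extCells G code j' := by
  rintro (h' | ⟨U', hU', e⟩ | e | ⟨i', e⟩)
  · exact adr_notMem_insCells (by norm_num) (by norm_num) (by norm_num) h'
  · rw [tt_inj T] at e
    subst e
    exact h hU'
  · rw [Set.mem_singleton_iff, tt, len, adr_inj (by norm_num) (by norm_num)] at e; omega
  · rw [tt, li, adr_inj (by norm_num) (by norm_num)] at e; omega

/-- A crude bound, needed only to see that the stored length of a list stays below `M`. The bound
that governs the running time is `Listed.length_le`. -/
theorem length_le_of_nodup {mem : ℕ → ℕ} (T : Tables G code mem)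
    {us : List (Submodule F (Fin G.n → F))} (h : us.Nodup) : us.length ≤ 2 ^ G.N := by
  classical
  have h1 : (us.map (bm code)).Nodup := h.map T.bm_injective
  have h2 : (us.map (bm code)).toFinset ⊆ Finset.range (2 ^ G.N) := by
    intro a ha
    rw [List.mem_toFinset, List.mem_map] at ha
    obtain ⟨U, -, rfl⟩ := ha
    exact Finset.mem_range.2 (T.bm_lt U)
  have h3 := Finset.card_le_card h2
  rwa [List.toFinset_card_of_nodup h1, List.length_map, Finset.card_range] at h3

theorem Input.k_lt {gens : Fin G.m → GL (Fin G.n) F} {x y : Fin G.k → Fin G.n → F}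
    {mem : ℕ → ℕ} (I : Input G code gens x y mem) : G.k < G.N :=
  I.hk.trans_lt I.tables.n_lt

theorem Input.eval_span {gens : Fin G.m → GL (Fin G.n) F} {x y : Fin G.k → Fin G.n → F}
    {mem : ℕ → ℕ} (I : Input G code gens x y mem) {j : ℕ} (hj : j ≤ G.k) :
    spanF.eval G mem [xA G, j] = bm code (flag x j) :=
  I.tables.eval_spanF hj I.k_lt.le I.xs

theorem Input.eval_src {gens : Fin G.m → GL (Fin G.n) F} {x y : Fin G.k → Fin G.n → F}
    {mem : ℕ → ℕ} (I : Input G code gens x y mem) (ρ : List ℕ) :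
    srcE.eval G mem ρ = bm code (flag x G.k) := I.eval_span le_rfl

theorem Input.eval_tgt {gens : Fin G.m → GL (Fin G.n) F} {x y : Fin G.k → Fin G.n → F}
    {mem : ℕ → ℕ} (I : Input G code gens x y mem) (ρ : List ℕ) :
    tgtE.eval G mem ρ = bm code (flag y G.k) :=
  I.tables.eval_spanF le_rfl I.k_lt.le I.ys

/-- Recording a subspace on the next level. -/
theorem recordS_spec {A : Subgroup (GL (Fin G.n) F)} {x y : Fin G.k → Fin G.n → F}
    (T : Tables G code σ.mem) {j : ℕ} (hj : j + 1 < G.N)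
    {us : List (Submodule F (Fin G.n → F))} (hus : Listed code A x y σ.mem (j + 1) us)
    (hun : ∀ U : Submodule F (Fin G.n → F), Module.finrank F U = j + 1 → U ∉ us →
      σ.mem (tt G (bm code U)) = 0)
    {U' : Submodule F (Fin G.n → F)} (hU' : Module.finrank F U' = j + 1)
    (hle : U' ≤ flag x G.k ∨ U' ≤ flag y G.k)
    {g : GL (Fin G.n) F} (hg : g ∈ A) (hgU : smap g (flag x (j + 1)) = U')
    (a b c d : ℕ) :
    let τ := recordS.run G [j, a, b, c, bm code U', d, pc code g] σ
    Frame ({a | ∃ U : Submodule F (Fin G.n → F), Module.finrank F U = j + 1 ∧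
      a = tt G (bm code U)} ∪ ({len G (j + 1)} ∪ {a | ∃ i, a = li G (j + 1) i})) σ τ ∧
      (∃ us', Listed code A x y τ.mem (j + 1) us' ∧
        ∀ U : Submodule F (Fin G.n → F), Module.finrank F U = j + 1 → U ∉ us' →
          τ.mem (tt G (bm code U)) = 0) ∧
      (∀ U : Submodule F (Fin G.n → F), σ.mem (tt G (bm code U)) ≠ 0 →
        τ.mem (tt G (bm code U)) ≠ 0) ∧ τ.mem (tt G (bm code U')) ≠ 0 := by
  classical
  intro τ
  by_cases h0 : σ.mem (tt G (bm code U')) = 0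
  swap
  · have : τ = σ := by simp [τ, recordS, h0]
    rw [this]
    exact ⟨Frame.refl _ _, ⟨us, hus, hun⟩, fun _ h => h, h0⟩
  have hnot : U' ∉ us := by
    intro h
    obtain ⟨-, f, -, -, e⟩ := hus.good U' h
    rw [h0] at e
    omega
  have hnd : (us ++ [U']).Nodup := by
    rw [List.nodup_append_comm]
    exact List.nodup_cons.2 ⟨hnot, hus.nodup⟩
  have hlen : us.length + 1 < G.M := by
    have h1 := length_le_of_nodup T hnd
    rw [List.length_append, List.length_singleton] at h1
    exact h1.trans_lt (T.pow_lt T.two_le le_rfl)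
  have n1 : len G (j + 1) ≠ tt G (bm code U') := by
    rw [len, tt, ne_eq, adr_inj (by norm_num) (by norm_num)]; omega
  have n2 : ∀ i, len G (j + 1) ≠ li G (j + 1) i := by
    intro i
    rw [len, li, ne_eq, adr_inj (by norm_num) (by norm_num)]; omega
  have n3 : ∀ i U, tt G (bm code U) ≠ li G (j + 1) i := by
    intro i U
    rw [tt, li, ne_eq, adr_inj (by norm_num) (by norm_num)]; omega
  have n4 : ∀ U, tt G (bm code U) ≠ len G (j + 1) := by
    intro U
    rw [tt, len, ne_eq, adr_inj (by norm_num) (by norm_num)]; omega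
  have hτ : τ = ⟨Function.update (Function.update (Function.update σ.mem (tt G (bm code U'))
      (pc code g + 1)) (li G (j + 1) us.length) (bm code U')) (len G (j + 1)) (us.length + 1),
      σ.out⟩ := by
    simp [τ, recordS, h0, Function.update_of_ne n1, Function.update_of_ne (n2 _), hus.len,
      Nat.mod_eq_of_lt (T.pc_succ_lt g), Nat.mod_eq_of_lt hlen, Nat.mod_eq_of_lt (T.bm_lt_M U')]
  have c1 : ∀ U, τ.mem (tt G (bm code U)) =
      if U = U' then pc code g + 1 else σ.mem (tt G (bm code U)) := by
    intro U
    rw [hτ]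
    dsimp only
    rw [Function.update_of_ne (n4 U), Function.update_of_ne (n3 _ U), Function.update_apply]
    congr 1
    rw [tt_inj T]
  have c2 : τ.mem (len G (j + 1)) = us.length + 1 := by rw [hτ]; simp
  have c3 : ∀ i, τ.mem (li G (j + 1) i) =
      if i = us.length then bm code U' else σ.mem (li G (j + 1) i) := by
    intro i
    rw [hτ]
    dsimp only
    rw [Function.update_of_ne (n2 i).symm, Function.update_apply,
      Function.update_of_ne (n3 i U').symm]
    congr 1
    rw [li_inj hj hj]
    simp
  refine ⟨?_, ⟨us ++ [U'], ⟨hnd, ?_, ?_, ?_⟩, ?_⟩, ?_, ?_⟩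
  · rw [hτ]
    exact ((Frame.update (.inl ⟨U', hU', rfl⟩) _).trans (Frame.update (.inr (.inr ⟨_, rfl⟩)) _)).trans
      (Frame.update (.inr (.inl rfl)) _)
  · rw [c2]; simp
  · intro i hi
    rw [c3]
    split_ifs with h
    · subst h; simp
    · have : i < us.length := by
        rw [List.length_append, List.length_singleton] at hi; omega
      rw [List.getElem_append_left this]
      exact hus.li i this
  · intro U hU
    rw [c1]
    split_ifs with h
    · rw [h]
      exact ⟨hle, g, hg, hgU, rfl⟩
    · apply hus.good
      rw [List.mem_append, List.mem_singleton] at hU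
      exact hU.resolve_right h
  · intro U hU hU2
    rw [List.mem_append, List.mem_singleton, not_or] at hU2
    rw [c1, if_neg hU2.2]
    exact hun U hU hU2.1
  · intro U hU
    rw [c1]
    split_ifs
    · omega
    · exact hU
  · rw [c1, if_pos rfl]; omega

end SubspTrans

/-! ### Correctness of the passage to the next level -/

namespace SubspTrans

open Ram Matrix

variable {F : Type} [Field F] {G : Globals} [NeZero G.q] {code : F ≃ Fin G.q} {σ : Store}

theorem Listed.congr {A : Subgroup (GL (Fin G.n) F)} {x y : Fin G.k → Fin G.n → F}
    {mem mem' : ℕ → ℕ} {j : ℕ} {us : List (Submodule F (Fin G.n → F))}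
    (h : Listed code A x y mem j us) (h1 : mem' (Ram.len G j) = mem (Ram.len G j))
    (h2 : ∀ i, mem' (Ram.li G j i) = mem (Ram.li G j i))
    (h3 : ∀ U ∈ us, mem' (tt G (bm code U)) = mem (tt G (bm code U))) :
    Listed code A x y mem' j us where
  nodup := h.nodup
  len := by rw [h1, h.len]
  li i hi := by rw [h2, h.li i hi]
  good U hU := by
    obtain ⟨k1, g, k2, k3, k4⟩ := h.good U hU
    exact ⟨k1, g, k2, k3, by rw [h3 U hU, k4]⟩

/-- The invariant of the computation of the next level. -/
structure Stage (code : F ≃ Fin G.q) (A : Subgroup (GL (Fin G.n) F))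
    (x y : Fin G.k → Fin G.n → F) (σ : Store) (j : Fin G.k) (τ : Store) : Prop where
  frame : Frame (extCells G code (j + 1)) σ τ
  filt : Filt code τ.mem (j + 1)
  lower : stab A (flag x j) ⊓ fixer (x j) ≤ Subgroup.closure (fset code τ.mem (j + 1))
  upper : Subgroup.closure (fset code τ.mem (j + 1)) ≤ stab A (flag x (j + 1))
  listed : ∃ us, Listed code A x y τ.mem (j + 1) us ∧
    ∀ U : Submodule F (Fin G.n → F), Module.finrank F U = j + 1 → U ∉ us →
      τ.mem (tt G (bm code U)) = 0

/-- The subspaces and matrices that have been found are kept. -/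
structure Grow (code : F ≃ Fin G.q) (j : ℕ) (τ τ' : Store) : Prop where
  tt : ∀ U : Submodule F (Fin G.n → F), τ.mem (tt G (bm code U)) ≠ 0 →
    τ'.mem (Ram.tt G (bm code U)) ≠ 0
  closure : Subgroup.closure (fset code τ.mem (j + 1)) ≤
    Subgroup.closure (fset code τ'.mem (j + 1))

theorem Grow.refl (j : ℕ) (τ : Store) : Grow code j τ τ := ⟨fun _ h => h, le_rfl⟩

theorem Grow.trans {j : ℕ} {τ τ' τ'' : Store} (h : Grow code j τ τ') (h' : Grow code j τ' τ'') :
    Grow code j τ τ'' := ⟨fun U hU => h'.tt U (h.tt U hU), h.closure.trans h'.closure⟩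

theorem insertS_stage {A : Subgroup (GL (Fin G.n) F)} {x y : Fin G.k → Fin G.n → F} {j : Fin G.k}
    {τ : Store} (T : Tables G code τ.mem) (h : Stage code A x y σ j τ) {g : GL (Fin G.n) F}
    (hg : g ∈ stab A (flag x (j + 1))) :
    Stage code A x y σ j (insertS.run G [(j : ℕ) + 1, pc code g] τ) ∧
      Grow code j τ (insertS.run G [(j : ℕ) + 1, pc code g] τ) ∧
      g ∈ Subgroup.closure (fset code (insertS.run G [(j : ℕ) + 1, pc code g] τ).mem (j + 1)) := by
  obtain ⟨k1, k2, k3⟩ := T.insertS_spec h.filt g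
  obtain ⟨us, h1, h2⟩ := h.listed
  have e : ∀ t i, t < 8 → t ≠ 0 → t ≠ 5 → (insertS.run G [(j : ℕ) + 1, pc code g] τ).mem
      (adr G t i) = τ.mem (adr G t i) := fun t i ht h0 h5 =>
    k3.mem _ (adr_notMem_insCells ht h0 h5)
  refine ⟨⟨h.frame.trans (k3.mono Set.subset_union_left), k1, ?_, ?_, us, h1.congr ?_ ?_ ?_, ?_⟩,
    ⟨?_, ?_⟩, ?_⟩
  · rw [k2]
    exact h.lower.trans (Subgroup.closure_mono (Set.subset_insert _ _))
  · rw [k2, Subgroup.closure_le]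
    rintro f (rfl | hf)
    · exact hg
    · exact h.upper (Subgroup.subset_closure hf)
  · exact e _ _ (by norm_num) (by norm_num) (by norm_num)
  · exact fun i => e _ _ (by norm_num) (by norm_num) (by norm_num)
  · exact fun U _ => e _ _ (by norm_num) (by norm_num) (by norm_num)
  · intro U hU hU'
    rw [← h2 U hU hU']
    exact e _ _ (by norm_num) (by norm_num) (by norm_num)
  · intro U hU
    rw [tt, e _ _ (by norm_num) (by norm_num) (by norm_num)]
    exact hU
  · rw [k2]
    exact Subgroup.closure_mono (Set.subset_insert _ _)
  · rw [k2]
    exact Subgroup.subset_closure (Set.mem_insert _ _)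

theorem recordS_stage {A : Subgroup (GL (Fin G.n) F)} {x y : Fin G.k → Fin G.n → F} {j : Fin G.k}
    {τ : Store} (T : Tables G code τ.mem) (hj : (j : ℕ) + 1 < G.N) (h : Stage code A x y σ j τ)
    {U' : Submodule F (Fin G.n → F)} (hU' : Module.finrank F U' = j + 1)
    (hle : U' ≤ flag x G.k ∨ U' ≤ flag y G.k)
    {g : GL (Fin G.n) F} (hg : g ∈ A) (hgU : smap g (flag x (j + 1)) = U')
    (a b c d : ℕ) :
    Stage code A x y σ j (recordS.run G [(j : ℕ), a, b, c, bm code U', d, pc code g] τ) ∧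
      Grow code j τ (recordS.run G [(j : ℕ), a, b, c, bm code U', d, pc code g] τ) ∧
      (recordS.run G [(j : ℕ), a, b, c, bm code U', d, pc code g] τ).mem (tt G (bm code U')) ≠ 0 := by
  obtain ⟨us, h1, h2⟩ := h.listed
  obtain ⟨k1, k2, k3, k4⟩ := recordS_spec T hj h1 h2 hU' hle hg hgU a b c d
  set τ' := recordS.run G [(j : ℕ), a, b, c, bm code U', d, pc code g] τ
  have e : ∀ p < G.N, ∀ w < G.N, τ'.mem (ft G (j + 1) p w) = τ.mem (ft G (j + 1) p w) := by
    intro p hp w hw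
    apply k1.mem
    rintro (⟨U, -, e⟩ | e | ⟨i, e⟩)
    · rw [ft, tt, adr_inj (by norm_num) (by norm_num)] at e; omega
    · rw [Set.mem_singleton_iff, ft, len, adr_inj (by norm_num) (by norm_num)] at e; omega
    · rw [ft, li, adr_inj (by norm_num) (by norm_num)] at e; omega
  refine ⟨⟨h.frame.trans (k1.mono Set.subset_union_right), h.filt.congr e, ?_, ?_, k2⟩,
    ⟨k3, ?_⟩, k4⟩
  · rw [fset_congr e]; exact h.lower
  · rw [fset_congr e]; exact h.upper
  · rw [fset_congr e]

/-- The heart of the algorithm. Let `g` in `A` carry `flag x (j + 1)` into the source or the target.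
Then `U = g (flag x j)` also lies there and is listed with some `f`; the matrix `f⁻¹ g` stabilizes
`flag x j`, so `f⁻¹ g x_j = t x_j` for a transversal element `t`, and the pair `(U, g x_j)` records
`g (flag x (j + 1))`. If this image is `flag x (j + 1)` itself, then `f t` has been sifted, and `g`
differs from it by a matrix that stabilizes `flag x j` and fixes `x_j`; such matrices were in the
filter from the start. -/
theorem extendS_spec {gens : Fin G.m → GL (Fin G.n) F} {x y : Fin G.k → Fin G.n → F}
    (I : Input G code gens x y σ.mem) {A : Subgroup (GL (Fin G.n) F)} (j : Fin G.k)
    (hx : LinearIndependent F x) {us : List (Submodule F (Fin G.n → F))}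
    (hL : Listed code A x y σ.mem j us) (hC : Complete A x y j us) (hK : us.length ≤ G.K)
    (hO : Orbit code σ.mem j (stab A (flag x j)) (x j)) (hF : Filt code σ.mem (j + 1))
    (hcl : Subgroup.closure (fset code σ.mem (j + 1)) = stab A (flag x j) ⊓ fixer (x j))
    (htt : ∀ U : Submodule F (Fin G.n → F), Module.finrank F U = j + 1 →
      σ.mem (tt G (bm code U)) = 0)
    (hlen : σ.mem (len G (j + 1)) = 0) :
    Filt code (extendS.run G [(j : ℕ)] σ).mem (j + 1) ∧
      Subgroup.closure (fset code (extendS.run G [(j : ℕ)] σ).mem (j + 1))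
        = stab A (flag x (j + 1)) ∧
      (∃ us', Listed code A x y (extendS.run G [(j : ℕ)] σ).mem (j + 1) us' ∧
        Complete A x y (j + 1) us' ∧
        ∀ U : Submodule F (Fin G.n → F), Module.finrank F U = j + 1 → U ∉ us' →
          (extendS.run G [(j : ℕ)] σ).mem (tt G (bm code U)) = 0) ∧
      Frame (extCells G code (j + 1)) σ (extendS.run G [(j : ℕ)] σ) := by
  classical
  have T := I.tables
  have hjN : (j : ℕ) + 1 < G.N := by have := I.k_lt; omega
  have hflag : ∀ g : GL (Fin G.n) F, smap g (flag x (j + 1)) =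
      smap g (flag x j) ⊔ Submodule.span F {mv g (x j)} := fun g => by
    rw [flag_succ, smap_sup_span]
  have hrank : ∀ g : GL (Fin G.n) F, Module.finrank F (smap g (flag x (j + 1))) = j + 1 :=
    fun g => by rw [finrank_smap, finrank_flag hx (by omega)]
  have hexf : ∀ U : Submodule F (Fin G.n → F), ∃ f : GL (Fin G.n) F, U ∈ us →
      f ∈ A ∧ smap f (flag x j) = U ∧ σ.mem (tt G (bm code U)) = pc code f + 1 := by
    intro U
    by_cases h : U ∈ us
    · obtain ⟨-, f, h1, h2, h3⟩ := hL.good U h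
      exact ⟨f, fun _ => ⟨h1, h2, h3⟩⟩
    · exact ⟨1, fun h' => absurd h' h⟩
  choose f hf using hexf
  have hext : ∀ z : Fin G.n → F, ∃ t : GL (Fin G.n) F, σ.mem (tr G j (vc code z)) ≠ 0 →
      t ∈ stab A (flag x j) ∧ σ.mem (tr G j (vc code z)) = pc code t + 1 ∧ mv t (x j) = z := by
    intro z
    rcases hO.sound z with h | ⟨t, h1, h2, h3⟩
    · exact ⟨1, fun h' => absurd h h'⟩
    · exact ⟨t, fun _ => ⟨h1, h2, h3⟩⟩
  choose t ht using hext
  -- what has to hold after the treatment of a pair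
  let Done : Submodule F (Fin G.n → F) → (Fin G.n → F) → Store → Prop := fun U z τ =>
    z ∉ U → σ.mem (tr G j (vc code (mv (f U)⁻¹ z))) ≠ 0 →
      (U ⊔ Submodule.span F {z} ≤ flag x G.k ∨ U ⊔ Submodule.span F {z} ≤ flag y G.k) →
      τ.mem (tt G (bm code (U ⊔ Submodule.span F {z}))) ≠ 0 ∧
      (U ⊔ Submodule.span F {z} = flag x (j + 1) →
        f U * t (mv (f U)⁻¹ z) ∈ Subgroup.closure (fset code τ.mem (j + 1)))
  have hDone : ∀ U z τ τ', Grow code j τ τ' → Done U z τ → Done U z τ' :=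
    fun U z τ τ' hg hd h1 h2 h3 => ⟨hg.tt _ (hd h1 h2 h3).1, fun h4 =>
      hg.closure ((hd h1 h2 h3).2 h4)⟩
  have step : ∀ U ∈ us, ∀ (z : Fin G.n → F) i τ, Stage code A x y σ j τ →
      let τ' := extendBody.run G [(j : ℕ), i, bm code U, vc code z] τ
      Stage code A x y σ j τ' ∧ Grow code j τ τ' ∧ Done U z τ' := by
    intro U hU z i τ hτ
    have Iτ := I.congr (hτ.frame.below (extCells_base _))
    have Tτ := Iτ.tables
    obtain ⟨f1, f2, f3⟩ := hf U hU
    have hUrank : Module.finrank F U = j := by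
      rw [← f2, finrank_smap, finrank_flag hx j.2.le]
    have e1 : τ.mem (tt G (bm code U)) = pc code (f U) + 1 := by
      rw [← f3]
      exact hτ.frame.mem _ (tt_notMem_extCells T (by omega))
    have e2 : ∀ a, τ.mem (tr G j a) = σ.mem (tr G j a) := fun a =>
      hτ.frame.mem _ tr_notMem_extCells
    simp only [extendBody, Stm.run_ite, Stm.run_letIn, Exp.eval_app2, Exp.eval_var,
      Exp.eval_load, Exp.eval_sub, Exp.eval_add, Exp.eval_one, eval_ttE, eval_trE, Stm.run_seq,
      Stm.run_skip, Stm.run_call2, Exp.eval_same, eval_xE, List.cons_append, List.nil_append,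
      List.getD_cons_succ, List.getD_cons_zero, Tτ.eval_bitF, e1, Nat.add_sub_cancel,
      Tτ.eval_extF, Tτ.eval_preF, Iτ.eval_src, Iτ.eval_tgt, Tτ.eval_subF, e2]
    by_cases hzU : z ∈ U
    · rw [if_pos hzU, if_pos one_ne_zero]
      exact ⟨hτ, Grow.refl _ _, fun h => absurd hzU h⟩
    rw [if_neg hzU, if_neg (by simp)]
    by_cases hm : σ.mem (tr G j (vc code (((f U)⁻¹ : GL (Fin G.n) F).val *ᵥ z))) = 0
    · rw [if_neg (by simpa using hm)]
      exact ⟨hτ, Grow.refl _ _, fun _ h => absurd hm h⟩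
    rw [if_pos hm]
    obtain ⟨t1, t2, t3⟩ := ht (mv (f U)⁻¹ z) hm
    set U' := U ⊔ Submodule.span F {z} with hU'
    by_cases hle : U' ≤ flag x G.k ∨ U' ≤ flag y G.k
    swap
    · rw [not_or] at hle
      rw [if_neg (by simp [hle.1, hle.2])]
      exact ⟨hτ, Grow.refl _ _, fun _ _ h => absurd h (not_or.2 hle)⟩
    rw [if_pos (by rcases hle with h | h <;> simp [h])]
    have t2' : σ.mem (tr G j (vc code (((f U)⁻¹ : GL (Fin G.n) F).val *ᵥ z)))
      = pc code (t (mv (f U)⁻¹ z)) + 1 := t2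
    simp only [t2', Nat.add_sub_cancel, Tτ.eval_compF]
    set g := f U * t (mv (f U)⁻¹ z) with hg
    have hgA : g ∈ A := mul_mem f1 t1.1
    have hgj : smap g (flag x j) = U := by rw [hg, smap_mul, t1.2, f2]
    have hgv : mv g (x j) = z := by rw [hg, mv_mul, t3, mv_mv_inv]
    have hgU : smap g (flag x (j + 1)) = U' := by rw [hflag, hgj, hgv]
    have hU'rank : Module.finrank F U' = j + 1 := by rw [← hgU, hrank]
    obtain ⟨r1, r2, r3⟩ := recordS_stage Tτ hjN hτ hU'rank hle hgA hgU i (bm code U) (vc code z)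
      (pc code (t (mv (f U)⁻¹ z)) + 1)
    set τ₁ := recordS.run G [(j : ℕ), i, bm code U, vc code z, bm code U',
      pc code (t (mv (f U)⁻¹ z)) + 1, pc code g] τ
    have I₁ := I.congr (r1.frame.below (extCells_base _))
    rw [I₁.eval_span (show (j : ℕ) + 1 ≤ G.k by omega)]
    simp only [T.bm_injective.eq_iff]
    by_cases hs : U' = flag x (j + 1)
    · rw [if_pos hs, if_pos one_ne_zero]
      obtain ⟨q1, q2, q3⟩ := insertS_stage I₁.tables r1 (g := g) ⟨hgA, by rw [hgU, hs]⟩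
      exact ⟨q1, r2.trans q2, fun _ _ _ => ⟨q2.tt _ r3, fun _ => q3⟩⟩
    · rw [if_neg hs, if_neg (by simp)]
      exact ⟨r1, r2, fun _ _ _ => ⟨r3, fun h => absurd h hs⟩⟩
  have hstart : Stage code A x y σ j σ := by
    refine ⟨Frame.refl _ _, hF, hcl.ge, ?_, [], ⟨List.nodup_nil, by simpa using hlen, ?_, ?_⟩,
      fun U hU _ => htt U hU⟩
    -- A matrix that stabilizes `flag x j` and fixes `x j` stabilizes their sum `flag x (j + 1)`.
    · rw [hcl]
      rintro g ⟨⟨h1, h2⟩, h3⟩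
      refine ⟨h1, ?_⟩
      rw [hflag, h2, show mv g (x j) = x j from h3, flag_succ]
    · intro i hi; simp at hi
    · intro U hU; simp at hU
  rw [extendS, Stm.run_loop_long _ _ _ _ _ (by simpa [hL.len] using hK)]
  simp only [Exp.eval_load, eval_lenE, Exp.eval_var, List.getD_cons_zero, hL.len]
  have main := iterFrom_induction (a := σ) (c := us.length)
    (f := fun i σ => (Stm.letIn (.load (liE (.var 0) (.var 1)))
      (.loop false (.glob .N) extendBody)).run G ([(j : ℕ)] ++ [i]) σ)
    (fun i τ => Stage code A x y σ j τ ∧ ∀ l (hl : l < us.length), l < i → ∀ z, Done us[l] z τ)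
    ⟨hstart, by omega⟩ (by
      rintro i hi τ ⟨hτ, hD⟩
      have e1 : τ.mem (li G j i) = bm code us[i] := by
        rw [hτ.frame.mem _ (li_notMem_extCells (by omega) hjN (by omega)), hL.li i hi]
      simp only [Stm.run_letIn, Exp.eval_load, eval_liE, Exp.eval_var, List.cons_append,
        List.nil_append, List.getD_cons_succ, List.getD_cons_zero, e1]
      rw [Stm.run_loop _ _ _ _ _ (by simp)]
      simp only [Exp.eval_N]
      obtain ⟨k1, k2, k3⟩ := iterFrom_induction (a := τ) (c := G.N)
        (f := fun p σ => extendBody.run G ([(j : ℕ), i, bm code us[i]] ++ [p]) σ)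
        (fun p υ => Stage code A x y σ j υ ∧ Grow code j τ υ ∧
          ∀ z, vc code z < p → Done us[i] z υ)
        ⟨hτ, Grow.refl _ _, by omega⟩ (by
          rintro p hp υ ⟨h1, h2, h3⟩
          have hpz : p = vc code (vec code p : Fin G.n → F) := (T.vc_vec hp).symm
          set z : Fin G.n → F := vec code p
          rw [hpz]
          obtain ⟨k1, k2, k3⟩ := step us[i] (List.getElem_mem hi) z i υ h1
          refine ⟨k1, h2.trans k2, fun u hu => ?_⟩
          rcases Nat.lt_succ_iff_lt_or_eq.1 hu with h | h
          · exact hDone _ _ _ _ k2 (h3 u (hpz ▸ h))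
          · rw [vc_injective h]; exact k3)
      refine ⟨k1, fun l hl hli z => ?_⟩
      rcases Nat.lt_succ_iff_lt_or_eq.1 hli with h | rfl
      · exact hDone _ _ _ _ k2 (hD l hl h z)
      · exact k3 z (T.vc_lt z))
  obtain ⟨hτ, hD⟩ := main
  set τ := iterFrom (fun i σ => (Stm.letIn (.load (liE (.var 0) (.var 1)))
      (.loop false (.glob .N) extendBody)).run G ([(j : ℕ)] ++ [i]) σ) σ us.length
  obtain ⟨us', hus', hzero⟩ := hτ.listed
  have hD' : ∀ U ∈ us, ∀ z, Done U z τ := by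
    intro U hU z
    obtain ⟨l, hl, rfl⟩ := List.getElem_of_mem hU
    exact hD l hl hl z
  -- every matrix is reached
  have reach : ∀ g ∈ A, smap g (flag x (j + 1)) ≤ flag x G.k ∨
      smap g (flag x (j + 1)) ≤ flag y G.k →
      let U := smap g (flag x j)
      U ∈ us ∧ mv g (x j) ∉ U ∧ (f U)⁻¹ * g ∈ stab A (flag x j) ∧
        σ.mem (tr G j (vc code (mv (f U)⁻¹ (mv g (x j))))) ≠ 0 := by
    intro g hg hle U
    -- Lying in the source or in the target is inherited by smaller subspaces; this is why the list
    -- of the previous level suffices.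
    have hUle : U ≤ smap g (flag x (j + 1)) := smap_mono g (flag_mono x (by omega))
    have hU : U ∈ us := hC g hg (hle.imp hUle.trans hUle.trans)
    obtain ⟨f1, f2, f3⟩ := hf U hU
    have hst : (f U)⁻¹ * g ∈ stab A (flag x j) := by
      refine ⟨mul_mem (inv_mem f1) hg, ?_⟩
      rw [smap_mul]
      exact smap_inv_eq f2
    refine ⟨hU, ?_, hst, ?_⟩
    · intro h
      rw [mem_smap, mv_inv_mv] at h
      exact notMem_flag hx j h
    · rw [← mv_mul]
      exact hO.full _ hst
  refine ⟨hτ.filt, le_antisymm hτ.upper ?_, ⟨us', hus', ?_, hzero⟩, hτ.frame⟩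
  · rintro g ⟨hg, hgs⟩
    have hle : smap g (flag x (j + 1)) ≤ flag x G.k ∨ smap g (flag x (j + 1)) ≤ flag y G.k := by
      left
      rw [hgs]
      exact flag_mono x (by omega)
    obtain ⟨hU, hv, hst, hm⟩ := reach g hg hle
    have hd := hD' _ hU _ hv hm (by rw [← hflag]; exact hle)
    set U := smap g (flag x j) with hUdef
    obtain ⟨t1, t2, t3⟩ := ht _ hm
    obtain ⟨f1, f2, f3⟩ := hf U hU
    have h1 := hd.2 (by rw [← hflag, hgs])
    -- Both `t` and `f⁻¹ g` carry `x j` to the same vector, so their quotient fixes it.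
    have h2 : (t (mv (f U)⁻¹ (mv g (x j))))⁻¹ * ((f U)⁻¹ * g) ∈
        stab A (flag x j) ⊓ fixer (x j) := by
      refine Subgroup.mem_inf.2 ⟨mul_mem (inv_mem t1) hst, ?_⟩
      rw [mem_fixer, mv_mul, mv_mul]
      nth_rewrite 2 [← t3]
      rw [mv_inv_mv]
    have h3 := mul_mem h1 (hτ.lower h2)
    convert h3 using 1
    group
  · intro g hg hle
    obtain ⟨hU, hv, hst, hm⟩ := reach g hg hle
    have hd := hD' _ hU _ hv hm (by rw [← hflag]; exact hle)
    by_contra hne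
    rw [← hflag] at hd
    exact hd.1 (hzero _ (hrank g) hne)

end SubspTrans

/-! ### Counting subspaces -/

namespace SubspTrans

open Ram Matrix

/-- Count ordered bases. A `j`-dimensional space has `∏ (q ^ j - q ^ i)` of them, and each factor is
at least `q ^ (j - 1)` because `q ≥ 2`. Bases of different subspaces are different `j`-tuples of
vectors in `V`, since a basis determines its span. -/
theorem card_mul_pow_le {F E : Type} [Field F] [Fintype F] [AddCommGroup E] [Module F E]
    (V : Submodule F E) [FiniteDimensional F V] {j : ℕ} (S : Finset (Submodule F E))
    (hS : ∀ U ∈ S, U ≤ V ∧ Module.finrank F U = j) :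
    S.card * Fintype.card F ^ (j * (j - 1)) ≤ Fintype.card F ^ (Module.finrank F V * j) := by
  have : Finite V := Module.finite_of_finite F
  have hfin : ∀ U : S, FiniteDimensional F U.1 := fun U =>
    Submodule.finiteDimensional_of_le (hS U.1 U.2).1
  have hfin' : ∀ U : S, Finite U.1 := fun U => Module.finite_of_finite F
  have hq : 2 ≤ Fintype.card F := Fintype.one_lt_card
  let ι : (Σ U : S, {s : Fin j → U.1 // LinearIndependent F s}) → (Fin j → V) := fun p i =>
    ⟨(p.2.1 i : E), (hS p.1.1 p.1.2).1 (p.2.1 i).2⟩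
  have hι : Function.Injective ι := by
    rintro ⟨U, s, hs⟩ ⟨U', s', hs'⟩ h
    have h1 : ∀ i, (s i : E) = s' i := fun i => congrArg Subtype.val (congrFun h i)
    have key : ∀ (U : S) (s : Fin j → U.1), LinearIndependent F s →
        U.1 = Submodule.span F (Set.range fun i => (s i : E)) := by
      intro U s hs
      have h2 : Submodule.span F (Set.range s) = ⊤ :=
        hs.span_eq_top_of_card_eq_finrank' (by
          rw [Fintype.card_fin, (hS U.1 U.2).2])
      have h3 := congrArg (Submodule.map U.1.subtype) h2
      rw [Submodule.map_span, ← Set.range_comp, Submodule.map_subtype_top] at h3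
      exact h3.symm
    have hU : U = U' := by
      apply Subtype.ext
      rw [key U s hs, key U' s' hs', funext h1]
    subst hU
    have : s = s' := funext fun i => Subtype.ext (h1 i)
    subst this
    rfl
  have h1 := Nat.card_le_card_of_injective ι hι
  rw [Nat.card_sigma, Nat.card_fun, Nat.card_eq_fintype_card (α := Fin j), Fintype.card_fin,
    Module.natCard_eq_pow_finrank (K := F) (V := V), ← pow_mul, Nat.card_eq_fintype_card] at h1
  refine le_trans ?_ h1
  rw [← Fintype.card_coe, ← smul_eq_mul, ← Finset.card_univ]
  apply Finset.card_nsmul_le_sum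
  intro U _
  rw [card_linearIndependent (by rw [(hS U.1 U.2).2]), (hS U.1 U.2).2, mul_comm, pow_mul]
  calc ((Fintype.card F) ^ (j - 1)) ^ j = ∏ i : Fin j, (Fintype.card F) ^ (j - 1) := by simp
    _ ≤ _ := by
      apply Finset.prod_le_prod' 
      intro i _
      have h2 : Fintype.card F ^ (i : ℕ) ≤ Fintype.card F ^ (j - 1) :=
        Nat.pow_le_pow_right (by omega) (by omega)
      have h3 : Fintype.card F ^ j = Fintype.card F ^ (j - 1) * Fintype.card F := by
        have := i.2; rw [← pow_succ]; congr 1; omega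
      have h4 : Fintype.card F ^ (j - 1) * 2 ≤ Fintype.card F ^ (j - 1) * Fintype.card F :=
        Nat.mul_le_mul_left _ hq
      rw [h3]
      exact Nat.le_sub_of_add_le (by linarith)

/-- A bound for the number of subspaces of a given dimension. -/
theorem card_subspaces_le {F E : Type} [Field F] [Fintype F] [AddCommGroup E] [Module F E]
    (V : Submodule F E) [FiniteDimensional F V] {j k : ℕ} (hV : Module.finrank F V = k)
    (hj : j ≤ k) (S : Finset (Submodule F E))
    (hS : ∀ U ∈ S, U ≤ V ∧ Module.finrank F U = j) :
    S.card ≤ Fintype.card F ^ (k * k / 4 + k) := by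
  have hq : 1 ≤ Fintype.card F := Fintype.card_pos
  have h1 := card_mul_pow_le V S hS
  -- With `d = k - j` the claim is `j * d + j ≤ k * k / 4 + k`, and `j * d ≤ (j + d) ^ 2 / 4` is the
  -- inequality of arithmetic and geometric means.
  have h2 : Module.finrank F V * j ≤ (k * k / 4 + k) + j * (j - 1) := by
    rw [hV]
    obtain ⟨d, rfl⟩ := Nat.exists_eq_add_of_le hj
    have h3 : j * d ≤ (j + d) * (j + d) / 4 := by
      rw [Nat.le_div_iff_mul_le (by norm_num)]
      zify
      nlinarith [sq_nonneg ((j : ℤ) - d)]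
    have h4 : j * (j - 1) + j = j * j := by
      cases j with
      | zero => rfl
      | succ j => simp; ring
    nlinarith
  have h3 := h1.trans (Nat.pow_le_pow_right hq h2)
  rw [pow_add] at h3
  exact Nat.le_of_mul_le_mul_right h3 (by positivity)

variable {F : Type} [Field F] {G : Globals} [NeZero G.q] {code : F ≃ Fin G.q}

/-- Every listed subspace lies in the source or in the target, both of dimension `k`, so the count
is applied twice. Listing all images in the whole space would bring `n` in place of `k` into the
leading term of the exponent. -/
theorem Listed.length_le {A : Subgroup (GL (Fin G.n) F)} {x y : Fin G.k → Fin G.n → F}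
    (hx : LinearIndependent F x) (hy : LinearIndependent F y)
    {mem : ℕ → ℕ} {j : ℕ} {us : List (Submodule F (Fin G.n → F))}
    (h : Listed code A x y mem j us) (hj : j ≤ G.k) :
    us.length ≤ 2 * G.q ^ (G.k * G.k / 4 + G.k) := by
  classical
  let _ : Fintype F := Fintype.ofEquiv _ code.symm
  have hq : Fintype.card F = G.q := by rw [Fintype.card_congr code, Fintype.card_fin]
  have hr : ∀ U ∈ us, Module.finrank F U = j := by
    intro U hU
    obtain ⟨-, g, -, hg, -⟩ := h.good U hU
    rw [← hg, finrank_smap, finrank_flag hx hj]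
  have h1 := card_subspaces_le (flag x G.k) (finrank_flag hx le_rfl) hj
    (us.toFinset.filter (· ≤ flag x G.k)) (by
      intro U hU
      rw [Finset.mem_filter, List.mem_toFinset] at hU
      exact ⟨hU.2, hr U hU.1⟩)
  have h2 := card_subspaces_le (flag y G.k) (finrank_flag hy le_rfl) hj
    (us.toFinset.filter (· ≤ flag y G.k)) (by
      intro U hU
      rw [Finset.mem_filter, List.mem_toFinset] at hU
      exact ⟨hU.2, hr U hU.1⟩)
  have h3 : us.toFinset ⊆ us.toFinset.filter (· ≤ flag x G.k) ∪
      us.toFinset.filter (· ≤ flag y G.k) := by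
    intro U hU
    rw [Finset.mem_union, Finset.mem_filter, Finset.mem_filter]
    exact (h.good U (List.mem_toFinset.1 hU)).1.imp (⟨hU, ·⟩) (⟨hU, ·⟩)
  have h4 := (Finset.card_le_card h3).trans (Finset.card_union_le _ _)
  rw [List.toFinset_card_of_nodup h.nodup] at h4
  rw [hq] at h1 h2
  omega

end SubspTrans

/-! ### The main loop -/

namespace Ram

/-- Argument `j`: pass from the level `j` to the level `j + 1`. -/
def levelS : Stm := .seq orbitS (.seq schreierS extendS)

/-- Expression for the zero subspace. -/
def botE : Exp := .app2 powF 2 (.app1 vzeroF 0)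

/-- Sift the generators through the first filter and list the zero subspace. -/
def initS : Stm :=
  .seq (.loop true (.glob .m) (.call2 0
      (.app1 matF (4 + 2 * (.glob .q * .glob .q) + .var 0 * (.glob .n * .glob .n))) insertS))
    (.seq (.store (ttE botE) (.app1 idF 0 + 1))
      (.seq (.store (liE 0 0) botE) (.store (lenE 0) 1)))

/-- Compute the last level. -/
def searchS : Stm := .seq initS (.loop false (.glob .k) (.call1 (.var 0) levelS))

end Ram

/-! ### Correctness of the search -/

namespace SubspTrans

open Ram Matrix

variable {F : Type} [Field F] {G : Globals} [NeZero G.q] {code : F ≃ Fin G.q}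

/-- The invariant of the main loop. -/
structure Level (code : F ≃ Fin G.q) (A : Subgroup (GL (Fin G.n) F))
    (x y : Fin G.k → Fin G.n → F) (mem : ℕ → ℕ) (j : ℕ) : Prop where
  filt : Filt code mem j
  closure : Subgroup.closure (fset code mem j) = stab A (flag x j)
  listed : ∃ us, Listed code A x y mem j us ∧ Complete A x y j us ∧
    ∀ U : Submodule F (Fin G.n → F), Module.finrank F U = j → U ∉ us →
      mem (tt G (bm code U)) = 0
  -- The cells of the later levels are still blank; this replaces any initialization of the arrays.
  ft_zero : ∀ j' > j, ∀ p < G.N, ∀ w < G.N, mem (ft G j' p w) = 0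
  tr_zero : ∀ j' ≥ j, ∀ p < G.N, mem (tr G j' p) = 0
  len_zero : ∀ j' > j, mem (len G j') = 0
  tt_zero : ∀ U : Submodule F (Fin G.n → F), j < Module.finrank F U →
    mem (tt G (bm code U)) = 0

/-- Orbit, Schreier generators and extension write to different arrays or to different levels of the
same array, apart from the scratch cell `cur`, so each finds what the earlier ones have prepared. -/
theorem levelS_spec {σ : Store} {gens : Fin G.m → GL (Fin G.n) F} {x y : Fin G.k → Fin G.n → F}
    (I : Input G code gens x y σ.mem) {A : Subgroup (GL (Fin G.n) F)} (j : Fin G.k)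
    (hx : LinearIndependent F x) (hy : LinearIndependent F y)
    (hK : 2 * G.q ^ (G.k * G.k / 4 + G.k) ≤ G.K) (h : Level code A x y σ.mem j) :
    Level code A x y (levelS.run G [(j : ℕ)] σ).mem (j + 1) ∧
      Frame {a | G.base ≤ a} σ (levelS.run G [(j : ℕ)] σ) := by
  obtain ⟨us, hL, hC, -⟩ := h.listed
  have hjN : (j : ℕ) + 1 < G.N := by have := I.k_lt; omega
  have T := I.tables
  obtain ⟨a1, a2⟩ := orbitS_spec I j h.filt (h.tr_zero j le_rfl)
  set σ₁ := orbitS.run G [(j : ℕ)] σ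
  have T₁ : Tables G code σ₁.mem := T.of_frame a2 (trCells_base _)
  have ea : ∀ t i, t < 8 → t ≠ 1 → σ₁.mem (adr G t i) = σ.mem (adr G t i) := by
    intro t i ht h1
    apply a2.mem
    rintro ⟨p, hp, e⟩
    rw [tr, adr_inj ht (by norm_num)] at e
    exact h1 e.1
  have hF₁ : Filt code σ₁.mem j :=
    h.filt.congr fun p _ w _ => ea _ _ (by norm_num) (by norm_num)
  have hS₁ : fset code σ₁.mem j = fset code σ.mem j :=
    fset_congr fun p _ w _ => ea _ _ (by norm_num) (by norm_num)
  obtain ⟨b1, b2, b3⟩ := schreierS_spec T₁ hF₁ (by rw [hS₁]; exact a1) (by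
    intro p hp w hw
    rw [ft, ea _ _ (by norm_num) (by norm_num)]
    exact h.ft_zero _ (by omega) p hp w hw)
  set σ₂ := schreierS.run G [(j : ℕ)] σ₁
  have eb : ∀ t i, t < 8 → t ≠ 0 → t ≠ 5 → σ₂.mem (adr G t i) = σ₁.mem (adr G t i) :=
    fun t i ht h0 h5 => b3.mem _ (adr_notMem_insCells ht h0 h5)
  have f₁₂ : Frame {a | G.base ≤ a} σ σ₂ :=
    (a2.mono (trCells_base _)).trans (b3.mono (insCells_base _))
  have I₂ : Input G code gens x y σ₂.mem := I.congr (f₁₂.below fun _ h => h)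
  have ett : ∀ U : Submodule F (Fin G.n → F), σ₂.mem (tt G (bm code U))
      = σ.mem (tt G (bm code U)) := fun U => by
    rw [tt, eb _ _ (by norm_num) (by norm_num) (by norm_num), ea _ _ (by norm_num) (by norm_num)]
  have eli : ∀ i j, σ₂.mem (li G j i) = σ.mem (li G j i) := fun i j => by
    rw [li, eb _ _ (by norm_num) (by norm_num) (by norm_num), ea _ _ (by norm_num) (by norm_num)]
  have elen : ∀ j, σ₂.mem (len G j) = σ.mem (len G j) := fun j => by
    rw [len, eb _ _ (by norm_num) (by norm_num) (by norm_num), ea _ _ (by norm_num) (by norm_num)]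
  obtain ⟨c1, c2, c3, c4⟩ := extendS_spec I₂ j hx
    (hL.congr (elen _) (fun i => eli i _) (fun U _ => ett U)) hC
    ((hL.length_le hx hy j.2.le).trans hK)
    (by
      rw [← h.closure]
      exact a1.congr fun z => eb _ _ (by norm_num) (by norm_num) (by norm_num))
    b1 (by rw [b2, hS₁, h.closure])
    (fun U hU => by rw [ett]; exact h.tt_zero U (by omega))
    (by rw [elen]; exact h.len_zero _ (by omega))
  refine ⟨⟨c1, c2, c3, ?_, ?_, ?_, ?_⟩, f₁₂.trans (c4.mono (extCells_base _))⟩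
  · intro j' hj' p hp w hw
    rw [levelS, Stm.run_seq, Stm.run_seq, c4.mem _ (ft_notMem_extCells hp hw (by omega)),
      b3.mem _ (ft_notMem_insCells hp hw (by omega)), ft, ea _ _ (by norm_num) (by norm_num)]
    exact h.ft_zero _ (by omega) p hp w hw
  · intro j' hj' p hp
    rw [levelS, Stm.run_seq, Stm.run_seq, c4.mem _ tr_notMem_extCells,
      tr, eb _ _ (by norm_num) (by norm_num) (by norm_num), ← tr, a2.mem]
    · exact h.tr_zero _ (by omega) p hp
    · rintro ⟨p', hp', e⟩
      rw [tr_inj hp hp'] at e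
      omega
  · intro j' hj'
    rw [levelS, Stm.run_seq, Stm.run_seq, c4.mem _ (len_notMem_extCells (by omega)), elen]
    exact h.len_zero _ (by omega)
  · intro U hU
    rw [levelS, Stm.run_seq, Stm.run_seq, c4.mem _ (tt_notMem_extCells T (by omega)), ett]
    exact h.tt_zero _ (by omega)

theorem stab_bot {n : ℕ} (A : Subgroup (GL (Fin n) F)) : stab A ⊥ = A := by
  ext g
  simp [mem_stab, smap]

/-- The zero subspace is its own only image and its stabilizer is the whole group, so level 0 is
obtained by sifting the given generators. After this step only a filter with `N ^ 2` cells remains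
of the `m` generators. -/
theorem initS_spec {σ : Store} {gens : Fin G.m → GL (Fin G.n) F} {x y : Fin G.k → Fin G.n → F}
    (I : Input G code gens x y σ.mem) (hm : G.m ≤ G.K) (h0 : ∀ a ≥ G.base, σ.mem a = 0) :
    Level code (Subgroup.closure (Set.range gens)) x y (initS.run G [] σ).mem 0 ∧
      Frame {a | G.base ≤ a} σ (initS.run G [] σ) := by
  have T := I.tables
  have hz : ∀ t i, σ.mem (adr G t i) = 0 := fun t i => h0 _ (base_le_adr _ _ _)
  rw [initS, Stm.run_seq, Stm.run_loop_long _ _ _ _ _ (by simpa using hm)]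
  simp only [Exp.eval_m]
  have main := iterFrom_induction (a := σ) (c := G.m)
    (f := fun i σ => (Stm.call2 0
      (.app1 matF (4 + 2 * (.glob .q * .glob .q) + .var 0 * (.glob .n * .glob .n)))
      insertS).run G ([] ++ [i]) σ)
    (fun i τ => Filt code τ.mem 0 ∧ Frame (insCells G 0) σ τ ∧
      Subgroup.closure (fset code τ.mem 0) = Subgroup.closure {g | ∃ l : Fin G.m, l < i ∧ gens l = g})
    ⟨fun p _ w _ => .inl (hz _ _), Frame.refl _ _, by
      rw [fset_eq_empty fun p _ w _ => hz _ _]; simp⟩ (by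
      rintro i hi τ ⟨h1, h2, h3⟩
      have Iτ : Input G code gens x y τ.mem := I.congr (h2.below (insCells_base _))
      have e : matF.eval G τ.mem [4 + 2 * (G.q * G.q) + i * (G.n * G.n)] =
          pc code (gens ⟨i, hi⟩) := Iτ.tables.eval_matF (Iτ.gens ⟨i, hi⟩)
      simp only [Stm.run_call2, Exp.eval_app1, Exp.eval_add, Exp.eval_mul, Exp.eval_two,
        Exp.eval_four, Exp.eval_q, Exp.eval_n, Exp.eval_var, List.nil_append,
        List.getD_cons_zero, Exp.eval_zero, e]
      obtain ⟨k1, k2, k3⟩ := Iτ.tables.insertS_spec h1 (gens ⟨i, hi⟩)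
      refine ⟨k1, h2.trans k3, ?_⟩
      rw [k2, Set.insert_eq, Subgroup.closure_union, h3, ← Subgroup.closure_union]
      congr 1
      ext g
      simp only [Set.mem_union, Set.mem_singleton_iff, Set.mem_ofPred_eq]
      constructor
      · rintro (rfl | ⟨l, hl, rfl⟩)
        · exact ⟨⟨i, hi⟩, Nat.lt_succ_self i, rfl⟩
        · exact ⟨l, by omega, rfl⟩
      · rintro ⟨l, hl, rfl⟩
        rcases Nat.lt_succ_iff_lt_or_eq.1 hl with h | h
        · exact .inr ⟨l, h, rfl⟩
        · exact .inl (congrArg gens (Fin.ext h)))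
  set τ := iterFrom (fun i σ => (Stm.call2 0
      (.app1 matF (4 + 2 * (.glob .q * .glob .q) + .var 0 * (.glob .n * .glob .n)))
      insertS).run G ([] ++ [i]) σ) σ G.m
  obtain ⟨h1, h2, h3⟩ := main
  have Tτ : Tables G code τ.mem := T.of_frame h2 (insCells_base _)
  have hτ : ∀ t i, t < 8 → t ≠ 0 → t ≠ 5 → τ.mem (adr G t i) = 0 := fun t i ht h0 h5 => by
    rw [h2.mem _ (adr_notMem_insCells ht h0 h5), hz]
  have hM := T.two_le
  have hM' := T.N_lt
  have T1 : Tables G code (Function.update τ.mem (tt G (bm code ⊥))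
      (pc code (1 : GL (Fin G.n) F) + 1)) :=
    Tτ.congr fun a ha => Function.update_of_ne
      (ne_of_lt (ha.trans_le (base_le_adr G 2 (bm code ⊥)))) _ _
  have n1 : len G 0 ≠ li G 0 0 := by
    rw [len, li, ne_eq, adr_inj (by norm_num) (by norm_num)]; omega
  have n2 : ∀ U, tt G (bm code U) ≠ li G 0 0 := by
    intro U
    rw [tt, li, ne_eq, adr_inj (by norm_num) (by norm_num)]; omega
  have n3 : ∀ U, tt G (bm code U) ≠ len G 0 := by
    intro U
    rw [tt, len, ne_eq, adr_inj (by norm_num) (by norm_num)]; omega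
  have hrun : (Stm.seq (.store (ttE botE) (.app1 idF 0 + 1))
      (.seq (.store (liE 0 0) botE) (.store (lenE 0) 1))).run G [] τ =
      ⟨Function.update (Function.update (Function.update τ.mem (tt G (bm code ⊥))
        (pc code (1 : GL (Fin G.n) F) + 1)) (li G 0 0) (bm code ⊥)) (len G 0) 1, τ.out⟩ := by
    simp [botE, Tτ.eval_vzeroF, Tτ.eval_bot, Tτ.eval_idF, T1.eval_vzeroF, T1.eval_bot,
      Nat.mod_eq_of_lt (T.pc_succ_lt _), Nat.mod_eq_of_lt (T.bm_lt_M _),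
      Nat.mod_eq_of_lt (show 1 < G.M by omega)]
  rw [hrun]
  set υ : Store := ⟨Function.update (Function.update (Function.update τ.mem (tt G (bm code ⊥))
        (pc code (1 : GL (Fin G.n) F) + 1)) (li G 0 0) (bm code ⊥)) (len G 0) 1, τ.out⟩ with hυ
  have e1 : ∀ t i, t < 8 → t ≠ 2 → t ≠ 3 → t ≠ 4 → υ.mem (adr G t i) = τ.mem (adr G t i) := by
    intro t i ht h2 h3 h4
    rw [hυ]
    dsimp only
    rw [Function.update_of_ne, Function.update_of_ne, Function.update_of_ne]
    · rw [tt, ne_eq, adr_inj ht (by norm_num)]; tauto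
    · rw [li, ne_eq, adr_inj ht (by norm_num)]; tauto
    · rw [len, ne_eq, adr_inj ht (by norm_num)]; tauto
  have e2 : ∀ U, υ.mem (tt G (bm code U)) =
      if U = ⊥ then pc code (1 : GL (Fin G.n) F) + 1 else 0 := by
    intro U
    rw [hυ]
    dsimp only
    rw [Function.update_of_ne (n3 U), Function.update_of_ne (n2 U), Function.update_apply]
    simp only [tt_inj T]
    rw [tt, hτ _ _ (by norm_num) (by norm_num) (by norm_num)]
  have e3 : υ.mem (len G 0) = 1 := by simp [hυ]
  have e4 : υ.mem (li G 0 0) = bm code ⊥ := by simp [hυ, Function.update_of_ne n1.symm]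
  have e5 : ∀ p < G.N, ∀ w < G.N, υ.mem (ft G 0 p w) = τ.mem (ft G 0 p w) := fun p _ w _ =>
    e1 _ _ (by norm_num) (by norm_num) (by norm_num) (by norm_num)
  have hgens : {g | ∃ l : Fin G.m, (l : ℕ) < G.m ∧ gens l = g} = Set.range gens := by
    ext g
    exact ⟨fun ⟨l, _, h⟩ => ⟨l, h⟩, fun ⟨l, h⟩ => ⟨l, l.2, h⟩⟩
  refine ⟨⟨h1.congr e5, ?_, ⟨[⊥], ⟨List.nodup_singleton _, by simpa using e3, ?_, ?_⟩, ?_, ?_⟩,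
    ?_, ?_, ?_, ?_⟩, ?_⟩
  · rw [fset_congr e5, h3, flag_zero, stab_bot, hgens]
  · intro i hi
    have : i = 0 := by simpa using hi
    subst this
    exact e4
  · intro U hU
    rw [List.mem_singleton] at hU
    subst hU
    exact ⟨.inl bot_le, 1, one_mem _, by rw [smap_one, flag_zero], by rw [e2, if_pos rfl]⟩
  · intro g hg _
    rw [flag_zero, List.mem_singleton]
    exact Submodule.map_bot _
  · intro U hU hU'
    rw [List.mem_singleton, ← Submodule.finrank_eq_zero (R := F)] at hU'
    exact absurd hU hU'
  · intro j' hj' p hp w hw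
    rw [ft, e1 _ _ (by norm_num) (by norm_num) (by norm_num) (by norm_num), ← ft,
      h2.mem _ (ft_notMem_insCells hp hw (by omega)), ft, hz]
  · intro j' hj' p hp
    rw [tr, e1 _ _ (by norm_num) (by norm_num) (by norm_num) (by norm_num),
      hτ _ _ (by norm_num) (by norm_num) (by norm_num)]
  · intro j' hj'
    rw [hυ]
    dsimp only
    rw [Function.update_of_ne, Function.update_of_ne, Function.update_of_ne, len,
      hτ _ _ (by norm_num) (by norm_num) (by norm_num)]
    · rw [len, tt, ne_eq, adr_inj (by norm_num) (by norm_num)]; omega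
    · rw [len, li, ne_eq, adr_inj (by norm_num) (by norm_num)]; omega
    · rw [len, len, ne_eq, adr_inj (by norm_num) (by norm_num)]; omega
  · intro U hU
    rw [e2, if_neg]
    rintro rfl
    simp at hU
  · refine (h2.mono (insCells_base _)).trans ?_
    exact ((Frame.update (base_le_adr _ _ _) _).trans
      (Frame.update (base_le_adr _ _ _) _)).trans (Frame.update (base_le_adr _ _ _) _)

/-- The search computes the last level. -/
theorem searchS_spec {σ : Store} {gens : Fin G.m → GL (Fin G.n) F} {x y : Fin G.k → Fin G.n → F}
    (I : Input G code gens x y σ.mem) (hx : LinearIndependent F x) (hy : LinearIndependent F y)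
    (hm : G.m ≤ G.K) (hK : 2 * G.q ^ (G.k * G.k / 4 + G.k) ≤ G.K)
    (h0 : ∀ a ≥ G.base, σ.mem a = 0) :
    Level code (Subgroup.closure (Set.range gens)) x y (searchS.run G [] σ).mem G.k ∧
      Frame {a | G.base ≤ a} σ (searchS.run G [] σ) := by
  obtain ⟨h1, h2⟩ := initS_spec I hm h0
  rw [searchS, Stm.run_seq, Stm.run_loop _ _ _ _ _ (by simpa using I.k_lt.le)]
  simp only [Exp.eval_k]
  refine iterFrom_induction (fun j τ => Level code (Subgroup.closure (Set.range gens)) x y τ.mem j ∧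
      Frame {a | G.base ≤ a} σ τ) ⟨h1, h2⟩ ?_
  rintro j hj τ ⟨k1, k2⟩
  obtain ⟨l1, l2⟩ := levelS_spec (I.congr (k2.below fun _ h => h)) ⟨j, hj⟩ hx hy hK k1
  exact ⟨l1, k2.trans l2⟩

end SubspTrans

/-! ### Writing the answer -/

namespace Ram

theorem iterFrom_out {f : ℕ → Store → Store} {mem : ℕ → ℕ} {c : ℕ} (l : Fin c → List ℕ)
    (h : ∀ i (hi : i < c) (out : List ℕ), f i ⟨mem, out⟩ = ⟨mem, out ++ l ⟨i, hi⟩⟩)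
    (out : List ℕ) : iterFrom f ⟨mem, out⟩ c = ⟨mem, out ++ (List.ofFn l).flatten⟩ := by
  induction c with
  | zero => simp [iterFrom]
  | succ c ih =>
    rw [iterFrom, ih (fun i => l i.castSucc) (fun i hi out => h i (by omega) out), h c (by omega),
      List.ofFn_succ']
    simp [List.concat_eq_append, Fin.last]

/-- Argument `g`: write the matrix with the table `g`. -/
def emitMatS : Stm :=
  .loop false (.glob .n) (.loop false (.glob .n)
    -- An entry is recovered from the table of the matrix as a coordinate of the image of a unit
    -- vector.
    (.emit (.app3 digF (.glob .q) (.app2 appF (.var 0) (.app1 unitF (.var 2))) (.var 1))))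

/-- Write a coset. -/
def outputS : Stm :=
  .letIn (.load (ttE tgtE)) (.ite (.var 0)
    -- The number of generators has to be written before them. To avoid counting, all `N * N` cells
    -- of the last filter are written, an empty one as the identity.
    (.seq (.emit 1) (.seq (.emit (.glob .N * .glob .N)) (.seq (.call1 (.var 0 - 1) emitMatS)
      (.loop false (.glob .N) (.loop false (.glob .N)
        (.letIn (.load (ftE (.glob .k) (.var 1) (.var 2)))
          (.ite (.var 3) (.call1 (.var 3 - 1) emitMatS) (.call1 (.app1 idF 0) emitMatS))))))))
    (.emit 0))

end Ram

/-! ### Correctness of the output -/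

namespace SubspTrans

open Ram Matrix

theorem flatten_ofFn_singleton {α : Type*} {c : ℕ} (f : Fin c → α) :
    (List.ofFn fun i => [f i]).flatten = List.ofFn f := by
  induction c with
  | zero => simp
  | succ c ih => rw [List.ofFn_succ, List.flatten_cons, ih, List.ofFn_succ]; rfl

theorem flatten_ofFn_mul {α : Type*} {a b : ℕ} (f : ℕ → ℕ → List α) :
    (List.ofFn fun i : Fin (a * b) => f (i / b) (i % b)).flatten =
      (List.ofFn fun i : Fin a => (List.ofFn fun j : Fin b => f i j).flatten).flatten := by
  have h : (List.ofFn fun i : Fin (a * b) => f (i / b) (i % b)) =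
      (List.ofFn fun i : Fin a => List.ofFn fun j : Fin b => f i j).flatten := by
    rw [List.ofFn_mul]
    congr 2
    funext i
    congr 1
    funext j
    have hb : 0 < b := j.pos
    have e1 : ((i : ℕ) * b + j) / b = i := by
      rw [mul_comm, Nat.mul_add_div hb, Nat.div_eq_of_lt j.2, add_zero]
    have e2 : ((i : ℕ) * b + j) % b = j := by
      rw [mul_comm, Nat.mul_add_mod, Nat.mod_eq_of_lt j.2]
    simp only [e1, e2]
  rw [h, List.flatten_flatten]
  congr 1
  simp [List.map_ofFn, Function.comp_def]

variable {F : Type} [Field F] {G : Globals} [NeZero G.q] {code : F ≃ Fin G.q}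

theorem emitMatS_spec {mem : ℕ → ℕ} (T : Tables G code mem) (g : GL (Fin G.n) F)
    (out : List ℕ) : emitMatS.run G [pc code g] ⟨mem, out⟩ =
      ⟨mem, out ++ encMatrix code (g : Matrix (Fin G.n) (Fin G.n) F)⟩ := by
  rw [emitMatS, Stm.run_loop _ _ _ _ _ (by simpa using T.n_lt.le)]
  simp only [Exp.eval_n]
  refine iterFrom_out _ (fun i hi out => ?_) out
  rw [Stm.run_loop _ _ _ _ _ (by simpa using T.n_lt.le), ← flatten_ofFn_singleton]
  simp only [Exp.eval_n]
  refine iterFrom_out _ (fun j hj out => ?_) out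
  have e1 : unitF.eval G mem [j] = vc code (Pi.single ⟨j, hj⟩ 1 : Fin G.n → F) :=
    T.eval_unitF ⟨j, hj⟩
  simp only [Stm.run_emit, Exp.eval_app3, Exp.eval_app2, Exp.eval_app1, Exp.eval_q, Exp.eval_var,
    List.cons_append, List.nil_append, List.getD_cons_succ, List.getD_cons_zero, e1,
    T.eval_appF, T.eval_digit _ hi, Matrix.mulVec_single_one]
  rfl

theorem transporter_eq_coset {n : ℕ} {A : Subgroup (GL (Fin n) F)}
    {V W : Submodule F (Fin n → F)} {g : GL (Fin n) F} (hg : g ∈ A) (h : smap g V = W) :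
    transporter A V W = {x | ∃ y ∈ stab A V, x = g * y} := by
  ext x
  constructor
  · rintro ⟨hx, hxW⟩
    change smap x V = W at hxW
    refine ⟨g⁻¹ * x, ⟨mul_mem (inv_mem hg) hx, ?_⟩, by group⟩
    rw [smap_mul, hxW]
    exact smap_inv_eq h
  · rintro ⟨y, ⟨hy, hyV⟩, rfl⟩
    refine ⟨mul_mem hg hy, ?_⟩
    change smap (g * y) V = W
    rw [smap_mul, hyV, h]

/-- The list of level `k` is complete, so the target is an image of the source exactly when it is
listed. Its recorded transporter is then a representative of the coset, and the last filter
generates the stabilizer of the source. -/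
theorem outputS_spec {σ : Store} {gens : Fin G.m → GL (Fin G.n) F} {x y : Fin G.k → Fin G.n → F}
    (I : Input G code gens x y σ.mem) (hy : LinearIndependent F y)
    {A : Subgroup (GL (Fin G.n) F)} (h : Level code A x y σ.mem G.k) :
    ∃ output, outputS.run G [] σ = ⟨σ.mem, σ.out ++ output⟩ ∧
      DescribesCoset code (transporter A (flag x G.k) (flag y G.k)) output := by
  classical
  have T := I.tables
  obtain ⟨us, hL, hC, h0⟩ := h.listed
  have e1 : (Exp.load (ttE tgtE)).eval G σ.mem [] = σ.mem (tt G (bm code (flag y G.k))) := by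
    rw [Exp.eval_load, eval_ttE, I.eval_tgt]
  by_cases hW : flag y G.k ∈ us
  swap
  · refine ⟨[0], ?_, .inl ⟨?_, rfl⟩⟩
    · simp [outputS, e1, h0 _ (finrank_flag hy le_rfl) hW]
    · ext g
      simp only [Set.mem_empty_iff_false, iff_false]
      rintro ⟨hg, hgW⟩
      change smap g (flag x G.k) = flag y G.k at hgW
      apply hW
      rw [← hgW]
      exact hC g hg (.inr (by rw [hgW]))
  obtain ⟨-, g, hg, hgW, hc⟩ := hL.good _ hW
  have hex : ∀ p w : ℕ, ∃ f : GL (Fin G.n) F, p < G.N → w < G.N →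
      ((σ.mem (ft G G.k p w) = 0 ∧ f = 1) ∨ σ.mem (ft G G.k p w) = pc code f + 1) := by
    intro p w
    by_cases hpw : p < G.N ∧ w < G.N
    · rcases h.filt p hpw.1 w hpw.2 with h | ⟨f, hf, -, -⟩
      · exact ⟨1, fun _ _ => .inl ⟨h, rfl⟩⟩
      · exact ⟨f, fun _ _ => .inr hf⟩
    · exact ⟨1, fun h1 h2 => absurd ⟨h1, h2⟩ hpw⟩
  choose f hf using hex
  refine ⟨[1, G.N * G.N] ++ encMatrix code (g : Matrix (Fin G.n) (Fin G.n) F) ++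
    encGens code (fun i : Fin (G.N * G.N) => f (i / G.N) (i % G.N)), ?_,
    .inr ⟨g, _, _, ?_, rfl⟩⟩
  · simp only [outputS, Stm.run_letIn, Stm.run_ite, Stm.run_seq, Stm.run_emit, Stm.run_call1,
      e1, hc, Exp.eval_var, List.nil_append, List.getD_cons_zero, Exp.eval_one, Exp.eval_mul,
      Exp.eval_N, Exp.eval_sub, Nat.add_sub_cancel]
    rw [if_pos (Nat.succ_ne_zero _), emitMatS_spec T, Stm.run_loop _ _ _ _ _ (by simp)]
    simp only [Exp.eval_N]
    rw [encGens, flatten_ofFn_mul fun p w =>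
      encMatrix code (f p w : Matrix (Fin G.n) (Fin G.n) F)]
    rw [iterFrom_out (fun p : Fin G.N => (List.ofFn fun w : Fin G.N =>
      encMatrix code (f p w : Matrix (Fin G.n) (Fin G.n) F)).flatten)]
    · simp
    intro p hp out
    rw [Stm.run_loop _ _ _ _ _ (by simp)]
    simp only [Exp.eval_N]
    refine iterFrom_out _ (fun w hw out => ?_) out
    simp only [Stm.run_letIn, Stm.run_ite, Stm.run_call1, Exp.eval_load, eval_ftE, Exp.eval_k,
      Exp.eval_var, List.cons_append, List.nil_append, List.getD_cons_succ, List.getD_cons_zero,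
      Exp.eval_sub, Exp.eval_one, Exp.eval_app1, T.eval_idF]
    rcases hf p w hp hw with ⟨h1, h2⟩ | h1
    · rw [h1, if_neg (by simp), emitMatS_spec T, h2]
    · rw [h1, if_pos (Nat.succ_ne_zero _), Nat.add_sub_cancel, emitMatS_spec T]
  · rw [transporter_eq_coset hg hgW, ← h.closure]
    congr 1
    ext z
    have hcl : Subgroup.closure (fset code σ.mem G.k) = Subgroup.closure
        (Set.range fun i : Fin (G.N * G.N) => f (i / G.N) (i % G.N)) := by
      apply le_antisymm
      · refine Subgroup.closure_mono ?_
        rintro s ⟨p, hp, w, hw, hs⟩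
        have hN : 0 < G.N := by omega
        refine ⟨⟨p * G.N + w, mul_add_lt_mul hp hw⟩, ?_⟩
        dsimp only
        rw [mul_comm p, Nat.mul_add_div hN, Nat.div_eq_of_lt hw, add_zero, Nat.mul_add_mod,
          Nat.mod_eq_of_lt hw]
        rcases hf p w hp hw with ⟨h1, -⟩ | h1
        · omega
        · exact T.pc_injective (by omega)
      · rw [Subgroup.closure_le]
        rintro _ ⟨i, rfl⟩
        have hN : 0 < G.N := by have := T.two_le; omega
        have h1 : (i : ℕ) / G.N < G.N := Nat.div_lt_of_lt_mul i.2
        have h2 : (i : ℕ) % G.N < G.N := Nat.mod_lt _ hN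
        dsimp only
        rcases hf _ _ h1 h2 with ⟨-, h3⟩ | h3
        · rw [h3]; exact one_mem _
        · exact Subgroup.subset_closure ⟨_, h1, _, h2, h3⟩
    rw [hcl]

/-- The main program. -/
def _root_.Ram.solveS : Stm := .seq searchS outputS

theorem solveS_spec {mem : ℕ → ℕ} {gens : Fin G.m → GL (Fin G.n) F}
    {x y : Fin G.k → Fin G.n → F} (I : Input G code gens x y mem)
    (hx : LinearIndependent F x) (hy : LinearIndependent F y) (hm : G.m ≤ G.K)
    (hK : 2 * G.q ^ (G.k * G.k / 4 + G.k) ≤ G.K) (h0 : ∀ a ≥ G.base, mem a = 0) :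
    DescribesCoset code (transporter (Subgroup.closure (Set.range gens)) (flag x G.k) (flag y G.k))
      (solveS.run G [] ⟨mem, []⟩).out := by
  obtain ⟨h1, h2⟩ := searchS_spec (σ := ⟨mem, []⟩) I hx hy hm hK h0
  obtain ⟨output, h3, h4⟩ := outputS_spec (I.congr (h2.below fun _ h => h)) hy h1
  rw [solveS, Stm.run_seq, h3, h2.out]
  exact h4

end SubspTrans

/-! ### Straight-line machine code and powers -/

namespace Ram

/-- A measure for the size of an expression. -/
def Expr.size : Expr → ℕ
  | .lit a => charge a
  | .reg _ => 1
  | .load e => e.size + 1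
  | .op _ a b => a.size + b.size

/-- All numbers in the registers and in the memory have charge at most `L`. -/
structure Small (s : State) (L : ℕ) : Prop where
  reg : ∀ r, charge (s.reg r) ≤ L
  mem : ∀ a, charge (s.mem a) ≤ L

theorem Small.pos {s : State} {L : ℕ} (h : Small s L) : 1 ≤ L :=
  (one_le_charge _).trans (h.reg 0)

theorem Expr.size_pos (e : Expr) : 1 ≤ e.size := by
  cases e with
  | lit a => exact one_le_charge a
  | reg _ => exact le_rfl
  | load e => simp [Expr.size]
  | op _ a b => have := a.size_pos; simp only [Expr.size]; omega

theorem Expr.charge_eval_le {s : State} {L : ℕ} (h : Small s L) (e : Expr) :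
    charge (e.eval s) ≤ e.size * L := by
  have hL := h.pos
  induction e with
  | lit a => exact Nat.le_mul_of_pos_right _ hL
  | reg r => simpa [Expr.size, Expr.eval] using h.reg r
  | load e =>
    have := h.mem (e.eval s)
    simp only [Expr.size, Expr.eval]
    nlinarith
  | op o a b iha ihb =>
    simp only [Expr.size, Expr.eval]
    have := charge_op_le o (a.eval s) (b.eval s)
    nlinarith

/-- The cube is superadditive with room to spare: the mixed terms of `(a + b) ^ 3` cover the product
that an operation costs. -/
theorem Expr.cost_le {s : State} {L : ℕ} (h : Small s L) (e : Expr) :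
    e.cost s ≤ e.size ^ 3 * L ^ 2 := by
  have hL := h.pos
  have hL2 : L ≤ L ^ 2 := Nat.le_self_pow (by norm_num) L
  induction e with
  | lit a =>
    have h1 : charge a ≤ charge a ^ 3 := Nat.le_self_pow (by norm_num) _
    exact h1.trans (Nat.le_mul_of_pos_right _ (by positivity))
  | reg r => simpa [Expr.size, Expr.cost] using (h.reg r).trans hL2
  | load e ih =>
    have h1 := e.charge_eval_le h
    have h2 := h.mem (e.eval s)
    simp only [Expr.size, Expr.cost]
    have h3 : e.size * L ≤ e.size * L ^ 2 := Nat.mul_le_mul_left _ hL2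
    have h4 : (e.size + 1) ^ 3 * L ^ 2 =
        e.size ^ 3 * L ^ 2 + 3 * (e.size ^ 2 * L ^ 2) + 3 * (e.size * L ^ 2) + L ^ 2 := by ring
    rw [h4]
    have h5 : 0 ≤ e.size ^ 2 * L ^ 2 := Nat.zero_le _
    omega
  | op o a b iha ihb =>
    have h1 := Nat.mul_le_mul (a.charge_eval_le h) (b.charge_eval_le h)
    have ha := a.size_pos
    have hb := b.size_pos
    simp only [Expr.size, Expr.cost]
    have h2 : a.size * L * (b.size * L) = a.size * b.size * L ^ 2 := by ring
    have h3 : a.size * b.size ≤ 3 * a.size ^ 2 * b.size := by nlinarith [Nat.mul_pos ha hb]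
    have h4 := Nat.mul_le_mul_right (L ^ 2) h3
    have h5 : (a.size + b.size) ^ 3 * L ^ 2 = a.size ^ 3 * L ^ 2 + 3 * a.size ^ 2 * b.size * L ^ 2 +
        3 * (a.size * b.size ^ 2 * L ^ 2) + b.size ^ 3 * L ^ 2 := by ring
    rw [h5]
    omega

/-- `s'` arises from `s` by putting `v` into the register `d`, except for changes of registers
from `8` on. -/
structure Sets (d v : ℕ) (s s' : State) : Prop where
  mem : s'.mem = s.mem
  out : s'.out = s.out
  val : s'.reg d = v
  reg : ∀ r < 8, r ≠ d → s'.reg r = s.reg r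

theorem Small.update {s : State} {L : ℕ} (h : Small s L) (d : ℕ) {v : ℕ} (hv : charge v ≤ L) :
    Small { s with reg := Function.update s.reg d v } L where
  reg r := by
    simp only [Function.update_apply]
    split_ifs
    · exact hv
    · exact h.reg r
  mem := h.mem

theorem assign_spec {s : State} {L : ℕ} (h : Small s L) (d : ℕ) (e : Expr)
    (hv : charge (e.eval s) ≤ L) :
    ∃ s', Run (.assign d e) s s' (e.size ^ 3 * L ^ 2 + L) ∧ Sets d (e.eval s) s s' ∧ Small s' L :=
  ⟨_, (Run.assign s d e).mono (add_le_add (e.cost_le h) hv),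
    ⟨rfl, rfl, by simp, fun r _ hr => by simp [Function.update_of_ne hr]⟩, h.update d hv⟩

/-- Put a power of the register `r` into the register `d`. -/
def powP (d r : ℕ) (e : Expr) : Prog :=
  .seq (.assign 9 e) (.seq (.assign d (.lit 1)) (.seq (.assign 8 (.lit 0))
    (.loop (.op .lt (.reg 8) (.reg 9))
      (.seq (.assign d (.op .mul (.reg d) (.reg r)))
        (.assign 8 (.op .add (.reg 8) (.lit 1)))))))

/-- Repeated multiplication is fast enough because the exponent, as a number, is below `L`. The base
is positive, so all intermediate powers are bounded by the last one. -/
theorem powP_spec {s : State} {L : ℕ} (h : Small s L) {d r : ℕ} (hd : d < 8) (hr : r < 8)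
    (hdr : r ≠ d) (e : Expr) (hv : charge (s.reg r ^ e.eval s) ≤ L) (h0 : 0 < s.reg r)
    (he : charge (e.eval s) ≤ L) (heL : e.eval s + 1 ≤ L) (hs : e.size ≤ 10) (hL : 100 ≤ L) :
    ∃ s', Run (powP d r e) s s' (L ^ 5) ∧ Sets d (s.reg r ^ e.eval s) s s' ∧ Small s' L := by
  have c0 : charge 0 ≤ L := by have : charge 0 = 1 := rfl; omega
  have c1 : charge 1 ≤ L := by have : charge 1 = 2 := rfl; omega
  have z1 : (Expr.lit 1).size = 2 := rfl
  have z0 : (Expr.lit 0).size = 1 := rfl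
  obtain ⟨s₁, r₁, e₁, k₁⟩ := assign_spec h 9 e he
  obtain ⟨s₂, r₂, e₂, k₂⟩ := assign_spec k₁ d (.lit 1) c1
  set b := s.reg r with hb
  set v := e.eval s with hv'
  -- `Sets` says nothing about the scratch registers from 8 on, so the exponent in register 9 is
  -- traced through the execution itself.
  have hs₂ : s₂.reg 9 = v := by
    have h1 : s₂ = { s₁ with reg := Function.update s₁.reg d 1 } := by
      obtain ⟨t, -, ht⟩ := r₂
      cases ht; rfl
    rw [h1]
    simp only
    rw [Function.update_of_ne (by omega), e₁.val]
  obtain ⟨s₃, r₃, e₃, k₃⟩ := assign_spec k₂ 8 (.lit 0) c0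
  have hs₃ : s₃.reg 9 = v := by
    have h1 : s₃ = { s₂ with reg := Function.update s₂.reg 8 0 } := by
      obtain ⟨t, -, ht⟩ := r₃
      cases ht; rfl
    rw [h1]
    simp [hs₂]
  let I : ℕ → State → Prop := fun j t => t.mem = s.mem ∧ t.out = s.out ∧ t.reg d = b ^ j ∧
    (∀ x < 8, x ≠ d → t.reg x = s.reg x) ∧ t.reg 8 = j ∧ t.reg 9 = v ∧ Small t L
  have hI : I 0 s₃ := by
    refine ⟨by rw [e₃.mem, e₂.mem, e₁.mem], by rw [e₃.out, e₂.out, e₁.out], ?_, ?_, ?_, hs₃, k₃⟩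
    · rw [e₃.reg d hd (by omega), e₂.val, pow_zero, Expr.eval]
    · intro x hx hxd
      rw [e₃.reg x hx (by omega), e₂.reg x hx hxd, e₁.reg x hx (by omega)]
    · rw [e₃.val, Expr.eval]
  obtain ⟨s₄, r₄, m1, m2, m3, m4, -, -, k₄⟩ := Run.count_loop (T := 40 * L ^ 2) (i := 8) (b := 9)
    (cnt := v)
    (body := .seq (.assign d (.op .mul (.reg d) (.reg r))) (.assign 8 (.op .add (.reg 8) (.lit 1))))
    I (fun j t ht => ⟨ht.2.2.2.2.1, ht.2.2.2.2.2.1⟩)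
    (by
      rintro j hj t ⟨i1, i2, i3, i4, i5, i6, i7⟩
      have hval : (Expr.op .mul (.reg d) (.reg r)).eval t = b ^ (j + 1) := by
        simp only [Expr.eval, Op.eval, i3, i4 r hr hdr, pow_succ, ← hb]
      have hc : charge (b ^ (j + 1)) ≤ L :=
        (charge_mono (Nat.pow_le_pow_right h0 (show j + 1 ≤ v by omega))).trans hv
      set t₁ : State := { t with reg := Function.update t.reg d (b ^ (j + 1)) } with ht₁
      have q₁ : Small t₁ L := i7.update d hc
      have p₁ : Run (.assign d (.op .mul (.reg d) (.reg r))) t t₁ (8 * L ^ 2 + L) := by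
        have := Run.assign t d (.op .mul (.reg d) (.reg r))
        rw [hval] at this
        refine this.mono (add_le_add ?_ hc)
        exact Expr.cost_le i7 _
      have hval' : (Expr.op .add (.reg 8) (.lit 1)).eval t₁ = j + 1 := by
        simp only [Expr.eval, Op.eval, ht₁]
        rw [Function.update_of_ne (by omega), i5]
      have hc' : charge (j + 1) ≤ L := (charge_mono (show j + 1 ≤ v by omega)).trans he
      have p₂ : Run (.assign 8 (.op .add (.reg 8) (.lit 1))) t₁
          { t₁ with reg := Function.update t₁.reg 8 (j + 1) } (27 * L ^ 2 + L) := by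
        have := Run.assign t₁ 8 (.op .add (.reg 8) (.lit 1))
        rw [hval'] at this
        refine this.mono (add_le_add ?_ hc')
        exact Expr.cost_le q₁ _
      refine ⟨_, (p₁.seq p₂).mono ?_, i1, i2, ?_, ?_, ?_, ?_, q₁.update 8 hc'⟩
      · nlinarith
      · simp only [ht₁]
        rw [Function.update_of_ne (by omega), Function.update_self]
      · intro x hx hxd
        simp only [ht₁]
        rw [Function.update_of_ne (by omega), Function.update_of_ne hxd, i4 x hx hxd]
      · simp
      · simp only [ht₁]
        rw [Function.update_of_ne (by omega), Function.update_of_ne (by omega), i6])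
    (s := s₃) hI
  refine ⟨s₄, (r₁.seq (r₂.seq (r₃.seq r₄))).mono ?_, ⟨m1, m2, m3, m4⟩, k₄⟩
  have t1 : e.size ^ 3 * L ^ 2 ≤ 1000 * L ^ 2 :=
    Nat.mul_le_mul_right _ (Nat.pow_le_pow_left hs 3)
  have t2 : (v + 1) * (40 * L ^ 2 + (2 * charge v + charge v * charge v + 1)) ≤ L * (50 * L ^ 2) := by
    apply Nat.mul_le_mul heL
    have : charge v * charge v ≤ L * L := Nat.mul_le_mul he he
    nlinarith
  rw [z1, z0]
  have step : ∀ i, 100 * L ^ i ≤ L ^ (i + 1) := fun i => by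
    rw [pow_succ, mul_comm]
    exact Nat.mul_le_mul_left _ hL
  have p2 : 100 * L ≤ L ^ 2 := by simpa using step 1
  have p3 : 100 * L ^ 2 ≤ L ^ 3 := step 2
  have p4 : 100 * L ^ 3 ≤ L ^ 4 := step 3
  have p5 : 100 * L ^ 4 ≤ L ^ 5 := step 4
  have t3 : L * (50 * L ^ 2) = 50 * L ^ 3 := by ring
  omega

end Ram

/-! ### Computing the parameters of an instance -/

namespace Ram

/-- The parameters for an instance. -/
abbrev params (q n k m : ℕ) : Globals where
  N := q ^ n
  -- One factor `N` more than `N ^ N`, which makes the inequality required in `Tables` strict.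
  M := (q ^ n) ^ (q ^ n + 1)
  -- Covers both long loops: the one over the given generators and the one over a list of subspaces.
  K := m + 2 * q ^ (k * k / 4 + k)
  base := 4 + 2 * (q * q) + m * (n * n) + 2 * (k * n)
  n := n
  k := k
  m := m
  q := q

/-- Compute the parameters. -/
def preludeP : Prog :=
  .seq (.assign 5 (.load (.lit 1))) (.seq (.assign 6 (.load (.lit 2)))
    (.seq (.assign 7 (.load (.lit 3))) (.seq (powP 0 7 (.reg 4))
      (.seq (powP 1 0 (.op .add (.reg 0) (.lit 1)))
        (.seq (powP 2 7 (.op .add (.op .div (.op .mul (.reg 5) (.reg 5)) (.lit 4)) (.reg 5)))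
          (.seq (.assign 2 (.op .add (.reg 6) (.op .mul (.lit 2) (.reg 2))))
            (.assign 3 (.op .add (.op .add (.op .add (.lit 4)
                (.op .mul (.lit 2) (.op .mul (.reg 7) (.reg 7))))
                (.op .mul (.reg 6) (.op .mul (.reg 4) (.reg 4))))
              (.op .mul (.lit 2) (.op .mul (.reg 5) (.reg 4)))))))))))

theorem preludeP_spec {s : State} {q n k m L : ℕ} (h : Small s L) (hL : 100 ≤ L)
    (hn : s.reg 4 = n) (hk : s.mem 1 = k) (hm : s.mem 2 = m) (hq : s.mem 3 = q) (hq0 : 0 < q)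
    (hG : ∀ x, charge ((params q n k m).get x) ≤ L) (hnL : n + 1 ≤ L)
    (hNL : q ^ n + 2 ≤ L) (hkL : k * k / 4 + k + 1 ≤ L) :
    ∃ s', Run preludeP s s' (L ^ 6) ∧ Ready (params q n k m) [] 8 s' L ∧
      s'.mem = s.mem ∧ s'.out = s.out := by
  have cN : charge (q ^ n) ≤ L := hG .N
  have cM : charge ((q ^ n) ^ (q ^ n + 1)) ≤ L := hG .M
  have cK : charge (m + 2 * q ^ (k * k / 4 + k)) ≤ L := hG .K
  have cB : charge (4 + 2 * (q * q) + m * (n * n) + 2 * (k * n)) ≤ L := hG .base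
  have ck : charge k ≤ L := hG .k
  have cm : charge m ≤ L := hG .m
  have cq : charge q ≤ L := hG .q
  have cP : charge (q ^ (k * k / 4 + k)) ≤ L := (charge_mono (by omega)).trans cK
  obtain ⟨s₁, r₁, e₁, k₁⟩ := assign_spec h 5 (.load (.lit 1)) (by simpa [Expr.eval, hk] using ck)
  obtain ⟨s₂, r₂, e₂, k₂⟩ := assign_spec k₁ 6 (.load (.lit 2))
    (by simpa [Expr.eval, e₁.mem, hm] using cm)
  obtain ⟨s₃, r₃, e₃, k₃⟩ := assign_spec k₂ 7 (.load (.lit 3))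
    (by simpa [Expr.eval, e₁.mem, e₂.mem, hq] using cq)
  have a5 : s₁.reg 5 = k := by rw [e₁.val]; simpa [Expr.eval] using hk
  have a6 : s₂.reg 6 = m := by rw [e₂.val]; simpa [Expr.eval, e₁.mem] using hm
  have a7 : s₃.reg 7 = q := by rw [e₃.val]; simpa [Expr.eval, e₁.mem, e₂.mem] using hq
  have b4 : s₃.reg 4 = n := by
    rw [e₃.reg 4 (by norm_num) (by norm_num), e₂.reg 4 (by norm_num) (by norm_num),
      e₁.reg 4 (by norm_num) (by norm_num), hn]
  have b5 : s₃.reg 5 = k := by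
    rw [e₃.reg 5 (by norm_num) (by norm_num), e₂.reg 5 (by norm_num) (by norm_num), a5]
  have b6 : s₃.reg 6 = m := by rw [e₃.reg 6 (by norm_num) (by norm_num), a6]
  have v4 : (Expr.reg 4).eval s₃ = n := b4
  obtain ⟨s₄, r₄, e₄, k₄⟩ := powP_spec k₃ (d := 0) (r := 7) (by norm_num) (by norm_num)
    (by norm_num) (.reg 4) (by rw [a7, v4]; exact cN) (by rw [a7]; exact hq0)
    (by rw [v4]; exact (charge_le_self n).trans hnL) (by rw [v4]; exact hnL)
    (by simp [Expr.size]) hL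
  rw [a7, v4] at e₄
  have c0 : s₄.reg 0 = q ^ n := e₄.val
  have v5 : (Expr.op .add (.reg 0) (.lit 1)).eval s₄ = q ^ n + 1 := by
    simp [Expr.eval, Op.eval, c0]
  obtain ⟨s₅, r₅, e₅, k₅⟩ := powP_spec k₄ (d := 1) (r := 0) (by norm_num) (by norm_num)
    (by norm_num) (.op .add (.reg 0) (.lit 1)) (by rw [c0, v5]; exact cM)
    (by rw [c0]; positivity) (by rw [v5]; exact (charge_le_self _).trans hNL)
    (by rw [v5]; exact hNL) (by decide) hL
  rw [c0, v5] at e₅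
  have d7 : s₅.reg 7 = q := by
    rw [e₅.reg 7 (by norm_num) (by norm_num), e₄.reg 7 (by norm_num) (by norm_num), a7]
  have d5 : s₅.reg 5 = k := by
    rw [e₅.reg 5 (by norm_num) (by norm_num), e₄.reg 5 (by norm_num) (by norm_num), b5]
  have d6 : s₅.reg 6 = m := by
    rw [e₅.reg 6 (by norm_num) (by norm_num), e₄.reg 6 (by norm_num) (by norm_num), b6]
  have d4 : s₅.reg 4 = n := by
    rw [e₅.reg 4 (by norm_num) (by norm_num), e₄.reg 4 (by norm_num) (by norm_num), b4]
  have d0 : s₅.reg 0 = q ^ n := by rw [e₅.reg 0 (by norm_num) (by norm_num), c0]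
  have v6 : (Expr.op .add (.op .div (.op .mul (.reg 5) (.reg 5)) (.lit 4)) (.reg 5)).eval s₅ =
      k * k / 4 + k := by
    simp [Expr.eval, Op.eval, d5]
  obtain ⟨s₆, r₆, e₆, k₆⟩ := powP_spec k₅ (d := 2) (r := 7) (by norm_num) (by norm_num)
    (by norm_num) (.op .add (.op .div (.op .mul (.reg 5) (.reg 5)) (.lit 4)) (.reg 5))
    (by rw [d7, v6]; exact cP) (by rw [d7]; exact hq0)
    (by rw [v6]; exact (charge_le_self _).trans hkL) (by rw [v6]; exact hkL) (by decide) hL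
  rw [d7, v6] at e₆
  have v7 : (Expr.op .add (.reg 6) (.op .mul (.lit 2) (.reg 2))).eval s₆ =
      m + 2 * q ^ (k * k / 4 + k) := by
    simp [Expr.eval, Op.eval, e₆.val, e₆.reg 6 (by norm_num) (by norm_num), d6]
  obtain ⟨s₇, r₇, e₇, k₇⟩ := assign_spec k₆ 2 _ (by rw [v7]; exact cK)
  rw [v7] at e₇
  have f : ∀ r < 8, r ≠ 2 → s₇.reg r = s₅.reg r := fun r hr hr2 => by
    rw [e₇.reg r hr hr2, e₆.reg r hr hr2]
  have v8 : (Expr.op .add (.op .add (.op .add (.lit 4)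
      (.op .mul (.lit 2) (.op .mul (.reg 7) (.reg 7))))
      (.op .mul (.reg 6) (.op .mul (.reg 4) (.reg 4))))
      (.op .mul (.lit 2) (.op .mul (.reg 5) (.reg 4)))).eval s₇ =
      4 + 2 * (q * q) + m * (n * n) + 2 * (k * n) := by
    simp [Expr.eval, Op.eval, f, d4, d5, d6, d7]
  obtain ⟨s₈, r₈, e₈, k₈⟩ := assign_spec k₇ 3 _ (by rw [v8]; exact cB)
  rw [v8] at e₈
  have hmem : s₈.mem = s.mem := by
    rw [e₈.mem, e₇.mem, e₆.mem, e₅.mem, e₄.mem, e₃.mem, e₂.mem, e₁.mem]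
  have hout : s₈.out = s.out := by
    rw [e₈.out, e₇.out, e₆.out, e₅.out, e₄.out, e₃.out, e₂.out, e₁.out]
  refine ⟨s₈, (r₁.seq (r₂.seq (r₃.seq (r₄.seq (r₅.seq (r₆.seq (r₇.seq r₈))))))).mono ?_,
    ⟨hL, ?_, ?_, hG, ?_, le_rfl, by simp, k₈.mem⟩, hmem, hout⟩
  · have step : ∀ i, 100 * L ^ i ≤ L ^ (i + 1) := fun i => by
      rw [pow_succ, mul_comm]
      exact Nat.mul_le_mul_left _ hL
    have p2 : 100 * L ≤ L ^ 2 := by simpa using step 1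
    have p3 : 100 * L ^ 2 ≤ L ^ 3 := step 2
    have p4 : 100 * L ^ 3 ≤ L ^ 4 := step 3
    have p5 : 100 * L ^ 4 ≤ L ^ 5 := step 4
    have p6 : 100 * L ^ 5 ≤ L ^ 6 := step 5
    have z1 : (Expr.load (.lit 1)).size = 3 := by decide
    have z2 : (Expr.load (.lit 2)).size = 4 := by decide
    have z3 : (Expr.load (.lit 3)).size = 4 := by decide
    have z7 : (Expr.op .add (.reg 6) (.op .mul (.lit 2) (.reg 2))).size = 5 := by decide
    have z8 : (Expr.op .add (.op .add (.op .add (.lit 4)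
      (.op .mul (.lit 2) (.op .mul (.reg 7) (.reg 7))))
      (.op .mul (.reg 6) (.op .mul (.reg 4) (.reg 4))))
      (.op .mul (.lit 2) (.op .mul (.reg 5) (.reg 4)))).size = 17 := by decide
    rw [z1, z2, z3, z7, z8]
    omega
  · exact (Nat.le_add_right _ 2).trans hNL
  · show 0 < (q ^ n) ^ (q ^ n + 1)
    positivity
  · intro x
    cases x
    · show s₈.reg 0 = q ^ n
      rw [e₈.reg 0 (by norm_num) (by norm_num), f 0 (by norm_num) (by norm_num), d0]
    · show s₈.reg 1 = (q ^ n) ^ (q ^ n + 1)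
      rw [e₈.reg 1 (by norm_num) (by norm_num), f 1 (by norm_num) (by norm_num), e₅.val]
    · show s₈.reg 2 = m + 2 * q ^ (k * k / 4 + k)
      rw [e₈.reg 2 (by norm_num) (by norm_num), e₇.val]
    · exact e₈.val
    · show s₈.reg 4 = n
      rw [e₈.reg 4 (by norm_num) (by norm_num), f 4 (by norm_num) (by norm_num), d4]
    · show s₈.reg 5 = k
      rw [e₈.reg 5 (by norm_num) (by norm_num), f 5 (by norm_num) (by norm_num), d5]
    · show s₈.reg 6 = m
      rw [e₈.reg 6 (by norm_num) (by norm_num), f 6 (by norm_num) (by norm_num), d6]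
    · show s₈.reg 7 = q
      rw [e₈.reg 7 (by norm_num) (by norm_num), f 7 (by norm_num) (by norm_num), d7]

end Ram

/-! ### Reading the input word -/

namespace SubspTrans

open Ram Matrix

theorem length_flatten_ofFn {α : Type*} {a b : ℕ} (l : Fin a → List α)
    (h : ∀ i, (l i).length = b) : (List.ofFn l).flatten.length = a * b := by
  induction a with
  | zero => simp
  | succ a ih =>
    rw [List.ofFn_succ, List.flatten_cons, List.length_append, h, ih _ fun i => h _]
    ring

theorem getD_flatten_ofFn {α : Type*} {a b : ℕ} (l : Fin a → List α)
    (h : ∀ i, (l i).length = b) (i : Fin a) {j : ℕ} (hj : j < b) (d : α) :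
    (List.ofFn l).flatten.getD (i * b + j) d = (l i).getD j d := by
  induction a with
  | zero => exact i.elim0
  | succ a ih =>
    rw [List.ofFn_succ, List.flatten_cons]
    induction i using Fin.cases with
    | zero => rw [List.getD_append _ _ _ _ (by simpa [h] using hj)]; simp
    | succ i =>
      rw [List.getD_append_right _ _ _ _ (by rw [h, Fin.val_succ]; nlinarith), h, ← ih _ fun i => h _]
      congr 1
      rw [Fin.val_succ]
      have : ((i : ℕ) + 1) * b + j = i * b + j + b := by ring
      omega

section
variable {F : Type} {q : ℕ} (code : F ≃ Fin q)

theorem length_encMatrix {a b : ℕ} (A : Matrix (Fin a) (Fin b) F) :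
    (encMatrix code A).length = a * b := length_flatten_ofFn _ fun _ => by simp

theorem getD_encMatrix {a b : ℕ} (A : Matrix (Fin a) (Fin b) F) (i : Fin a) (j : Fin b) :
    (encMatrix code A).getD (i * b + j) 0 = code (A i j) := by
  rw [encMatrix, getD_flatten_ofFn _ (fun _ => by simp) i j.2]
  simp

theorem lt_of_mem_encMatrix {a b : ℕ} {A : Matrix (Fin a) (Fin b) F} {v : ℕ}
    (h : v ∈ encMatrix code A) : v < q := by
  rw [encMatrix, List.mem_flatten] at h
  obtain ⟨l, hl, hv⟩ := h
  rw [List.mem_ofFn] at hl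
  obtain ⟨i, rfl⟩ := hl
  rw [List.mem_ofFn] at hv
  obtain ⟨j, rfl⟩ := hv
  exact (code _).2

end

section
variable {F : Type} [Field F] {q n k m : ℕ} (code : F ≃ Fin q)
  (gens : Fin m → GL (Fin n) F) {V W : Submodule F (Fin n → F)}
  (bV : Module.Basis (Fin k) F V) (bW : Module.Basis (Fin k) F W)

theorem length_encGens : (encGens code gens).length = m * (n * n) :=
  length_flatten_ofFn _ fun _ => length_encMatrix code _

theorem getD_encGens (i : Fin m) (a b : Fin n) :
    (encGens code gens).getD (i * (n * n) + a * n + b) 0 = code ((gens i : Matrix _ _ F) a b) := by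
  rw [encGens, add_assoc, getD_flatten_ofFn _ (fun _ => length_encMatrix code _) i
    (mul_add_lt_mul a.2 b.2), getD_encMatrix]

theorem length_encInput : (encInput code gens bV bW).length =
    4 + 2 * (q * q) + m * (n * n) + 2 * (k * n) := by
  simp only [encInput, encTable, List.length_append, length_encMatrix, length_encGens,
    List.length_cons, List.length_nil]
  ring

theorem encInput_le {v : ℕ} (h : v ∈ encInput code gens bV bW) :
    v = n ∨ v = k ∨ v = m ∨ v ≤ q := by
  simp only [encInput, encTable, List.mem_append, List.mem_cons, List.not_mem_nil, or_false] at h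
  rcases h with ((((h | h) | h) | h) | h) | h
  · rcases h with h | h | h | h
    · exact .inl h
    · exact .inr (.inl h)
    · exact .inr (.inr (.inl h))
    · exact .inr (.inr (.inr h.le))
  · exact .inr (.inr (.inr (lt_of_mem_encMatrix code h).le))
  · exact .inr (.inr (.inr (lt_of_mem_encMatrix code h).le))
  · rw [encGens, List.mem_flatten] at h
    obtain ⟨l, hl, hv⟩ := h
    rw [List.mem_ofFn] at hl
    obtain ⟨i, rfl⟩ := hl
    exact .inr (.inr (.inr (lt_of_mem_encMatrix code hv).le))
  · exact .inr (.inr (.inr (lt_of_mem_encMatrix code h).le))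
  · exact .inr (.inr (.inr (lt_of_mem_encMatrix code h).le))

theorem getD_append_shift {α : Type*} (l l' : List α) (c : ℕ) (hc : l.length = c) (i : ℕ) (d : α) :
    (l ++ l').getD (c + i) d = l'.getD i d := by
  subst hc
  rw [List.getD_append_right _ _ _ _ (Nat.le_add_right _ _), Nat.add_sub_cancel_left]

/-- The initial memory holds the instance. -/
theorem input_init [NeZero q] (hq : 2 ≤ q) (hn : 1 ≤ n) (hk : k ≤ n) :
    Input (params q n k m) code gens (fun i => (bV i : Fin n → F)) (fun i => (bW i : Fin n → F))
      (State.init (encInput code gens bV bW)).mem := by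
  have hN : 2 ≤ q ^ n := hq.trans (Nat.le_self_pow (by omega) _)
  have lT : ∀ f : F → F → F, (encTable code f).length = q * q := fun f => length_encMatrix code _
  have lG := length_encGens code gens
  have lM : ∀ A : Matrix (Fin k) (Fin n) F, (encMatrix code A).length = k * n := fun A =>
    length_encMatrix code A
  have gT : ∀ (f : F → F → F) (a b : F),
      (encTable code f).getD ((code a : ℕ) * q + code b) 0 = code (f a b) := fun f a b => by
    rw [encTable, getD_encMatrix]; simp
  constructor
  · constructor
    · exact hq
    · exact hn
    · rfl
    · exact Nat.pow_lt_pow_right hN (Nat.lt_succ_self _)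
    · show 4 + 2 * (q * q) ≤ 4 + 2 * (q * q) + m * (n * n) + 2 * (k * n)
      omega
    · intro a b
      show (encInput code gens bV bW).getD (4 + (code a : ℕ) * q + code b) 0 = _
      have hlt := mul_add_lt_mul (code a).2 (code b).2
      rw [encInput, List.append_assoc, List.append_assoc, List.append_assoc, List.append_assoc,
        add_assoc, getD_append_shift _ _ 4 rfl, List.getD_append _ _ _ _ (by rw [lT]; exact hlt), gT]
    · intro a b
      show (encInput code gens bV bW).getD (4 + q * q + (code a : ℕ) * q + code b) 0 = _
      have hlt := mul_add_lt_mul (code a).2 (code b).2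
      rw [encInput, List.append_assoc, List.append_assoc, List.append_assoc,
        add_assoc, getD_append_shift _ _ (4 + q * q) (by rw [List.length_append, lT]; rfl),
        List.getD_append _ _ _ _ (by rw [lT]; exact hlt), gT]
  · exact hk
  · intro i a b
    show (encInput code gens bV bW).getD (4 + 2 * (q * q) + (i : ℕ) * (n * n) + a * n + b) 0 = _
    have hlt := mul_add_lt_mul i.2 (mul_add_lt_mul a.2 b.2)
    rw [encInput, List.append_assoc, List.append_assoc, add_assoc, add_assoc,
      getD_append_shift _ _ (4 + 2 * (q * q))
        (by rw [List.length_append, List.length_append, lT, lT, two_mul, ← add_assoc]; rfl),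
      List.getD_append _ _ _ _ (by rw [lG]; exact hlt), ← add_assoc, getD_encGens]
  · intro l i
    show (encInput code gens bV bW).getD (4 + 2 * (q * q) + m * (n * n) + (l : ℕ) * n + i) 0 = _
    have hlt := mul_add_lt_mul l.2 i.2
    rw [encInput, List.append_assoc, add_assoc,
      getD_append_shift _ _ (4 + 2 * (q * q) + m * (n * n))
        (by rw [List.length_append, List.length_append, List.length_append, lT, lT, lG, two_mul,
          ← add_assoc]; rfl),
      List.getD_append _ _ _ _ (by rw [lM]; exact hlt), getD_encMatrix]
    rfl
  · intro l i
    show (encInput code gens bV bW).getD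
      (4 + 2 * (q * q) + m * (n * n) + k * n + (l : ℕ) * n + i) 0 = _
    rw [encInput, add_assoc,
      getD_append_shift _ _ (4 + 2 * (q * q) + m * (n * n) + k * n)
        (by rw [List.length_append, List.length_append, List.length_append, List.length_append,
          lT, lT, lG, lM, two_mul, ← add_assoc]; rfl), getD_encMatrix]
    rfl
  · show 4 + 2 * (q * q) + m * (n * n) + k * n + k * n ≤
      4 + 2 * (q * q) + m * (n * n) + 2 * (k * n)
    omega

theorem flag_basis : flag (fun i => (bV i : Fin n → F)) k = V := by
  rw [flag_of_ge _ le_rfl]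
  have h := congrArg (Submodule.map V.subtype) bV.span_eq
  rw [Submodule.map_span, ← Set.range_comp, Submodule.map_subtype_top] at h
  exact h

theorem linearIndependent_basis : LinearIndependent F fun i => (bV i : Fin n → F) :=
  bV.linearIndependent.map' V.subtype V.ker_subtype

end

end SubspTrans

/-! ### Arithmetic of the time bound and the final program -/

namespace Ram

theorem charge_pow_le (a e : ℕ) : charge (a ^ e) ≤ e * charge a + 2 := by
  induction e with
  | zero => simp [show charge 1 = 2 from rfl]
  | succ e ih =>
    rw [pow_succ]
    have h1 := charge_mul_le (a ^ e) a
    have h2 : (e + 1) * charge a = e * charge a + charge a := by ring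
    omega

/-- Although `M` and `K` are huge, their bit lengths are polynomial in `N = q ^ n` and the bit
length of `m`: for `M` the length is about `N` times that of `N`, for `K` it is governed by `k ^ 2`
times the length of `q`. -/
theorem charge_params_le {q n k m : ℕ} (hq : 2 ≤ q) (hn : 1 ≤ n) (hk : k ≤ n) (x : Glob) :
    charge ((params q n k m).get x) ≤ (q ^ n + Nat.size m + 10) ^ 4 := by
  set N := q ^ n with hN
  set S := Nat.size m with hS
  set Z := N + S + 10 with hZ
  have hqN : q ≤ N := Nat.le_self_pow (by omega) _
  have hnN : n < N := Nat.lt_pow_self hq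
  have hcm : charge m = S + 1 := rfl
  have z10 : 10 ≤ Z := by omega
  have h2 : 10 * Z ≤ Z ^ 2 := by rw [pow_two]; exact Nat.mul_le_mul_right _ z10
  have h3 : 10 * Z ^ 2 ≤ Z ^ 3 := by rw [pow_succ Z 2, mul_comm]; exact Nat.mul_le_mul_left _ z10
  have h4 : 10 * Z ^ 3 ≤ Z ^ 4 := by rw [pow_succ Z 3, mul_comm]; exact Nat.mul_le_mul_left _ z10
  have cN := charge_le_self N
  have cq := charge_le_self q
  have cn := charge_le_self n
  have ck := charge_le_self k
  have c2 : charge 2 = 3 := rfl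
  have c4 : charge 4 = 4 := rfl
  cases x with
  | N => show charge N ≤ _; omega
  | M =>
    show charge (N ^ (N + 1)) ≤ _
    have h := charge_pow_le N (N + 1)
    have h' : (N + 1) * charge N ≤ Z * Z := Nat.mul_le_mul (by omega) (by omega)
    rw [← pow_two] at h'
    omega
  | K =>
    show charge (m + 2 * q ^ (k * k / 4 + k)) ≤ _
    have h := charge_add_le m (2 * q ^ (k * k / 4 + k))
    have h' := charge_mul_le 2 (q ^ (k * k / 4 + k))
    have h'' := charge_pow_le q (k * k / 4 + k)
    have e1 : k * k / 4 + k ≤ Z * Z := by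
      have h : k * k / 4 ≤ k * k := Nat.div_le_self _ _
      have h' : k * (k + 1) ≤ Z * Z := Nat.mul_le_mul (by omega) (by omega)
      rw [mul_add, mul_one] at h'
      omega
    have e2 : (k * k / 4 + k) * charge q ≤ Z * Z * Z := Nat.mul_le_mul e1 (by omega)
    have e3 : Z * Z * Z = Z ^ 3 := by ring
    omega
  | base =>
    show charge (4 + 2 * (q * q) + m * (n * n) + 2 * (k * n)) ≤ _
    have a1 := charge_add_le (4 + 2 * (q * q) + m * (n * n)) (2 * (k * n))
    have a2 := charge_add_le (4 + 2 * (q * q)) (m * (n * n))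
    have a3 := charge_add_le 4 (2 * (q * q))
    have a4 := charge_mul_le 2 (k * n)
    have a5 := charge_mul_le k n
    have a6 := charge_mul_le m (n * n)
    have a7 := charge_mul_le n n
    have a8 := charge_mul_le 2 (q * q)
    have a9 := charge_mul_le q q
    omega
  | n => show charge n ≤ _; omega
  | k => show charge k ≤ _; omega
  | m => show charge m ≤ _; omega
  | q => show charge q ≤ _; omega

theorem sq_le_two_pow (s : ℕ) : s * s ≤ 2 ^ (s + 1) := by
  induction s with
  | zero => simp
  | succ s ih =>
    have h : s + 1 ≤ 2 ^ s := Nat.lt_two_pow_self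
    rw [pow_succ] at ih ⊢
    rw [pow_succ 2 s]
    nlinarith

/-- Here `m ≥ 2 ^ N` with `N = q ^ n`. If `s` is the bit length of `N`, then `n + 1 ≤ s`, so the
left side is at most `2 ^ (s * s)`, and `s * s ≤ 2 ^ (s + 1) ≤ 4 * N`. Quasipolynomial growth in `N`
is thus dominated by a power of `m`. -/
theorem pow_le_of_lt_size {q n m : ℕ} (hq : 2 ≤ q) (h : q ^ n < Nat.size m) :
    (q ^ n) ^ (n + 1) ≤ m ^ 4 := by
  set N := q ^ n with hN
  set s := Nat.size N with hs
  have hm : 2 ^ N ≤ m := Nat.lt_size.1 h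
  have h1 : 2 ^ n ≤ N := Nat.pow_le_pow_left hq n
  have h2 : n + 1 ≤ s := Nat.lt_size.2 h1
  have h3 : 2 ^ (s - 1) ≤ N := Nat.lt_size.1 (by omega)
  have h4 : 2 ^ (s + 1) = 4 * 2 ^ (s - 1) := by
    rw [show s + 1 = 2 + (s - 1) by omega, pow_add]; rfl
  calc N ^ (n + 1) ≤ (2 ^ s) ^ (n + 1) := Nat.pow_le_pow_left (Nat.lt_size_self N).le _
    _ ≤ (2 ^ s) ^ s := Nat.pow_le_pow_right (by positivity) h2
    _ = 2 ^ (s * s) := (pow_mul _ _ _).symm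
    _ ≤ 2 ^ (N * 4) := Nat.pow_le_pow_right (by norm_num) (by have := sq_le_two_pow s; omega)
    _ = (2 ^ N) ^ 4 := pow_mul _ _ _
    _ ≤ m ^ 4 := Nat.pow_le_pow_left hm 4

/-- If the bit length of `m` is at most `N = q ^ n`, the first factor is a power `A` of `N`, and the
mixed term is split by `A * m ≤ A * A + m * m`. Otherwise `m` is exponentially large compared with
`N`, and everything, including the number of subspaces, is at most a power of `m`. The constant `8 *
d` comes from `A * A` with `A = N ^ (4 * d)`, and the 5 from the second case. -/
theorem time_bound (d : ℕ) {q n k m : ℕ} (hq : 2 ≤ q) (hn : 1 ≤ n) (hk : k ≤ n) :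
    (q ^ n + Nat.size m + 10) ^ d * (m + 2 * q ^ (k * k / 4 + k) + 1) ≤
      4 * (q ^ (k * k / 4 + (8 * d + 5) * n) + m ^ (8 * d + 5)) := by
  set N := q ^ n with hN
  set X := q ^ (k * k / 4 + (8 * d + 5) * n) with hX
  set Y := m ^ (8 * d + 5) with hY
  set Q := q ^ (k * k / 4 + k) with hQ
  have hN2 : 2 ≤ N := hq.trans (Nat.le_self_pow (by omega) _)
  have hQ1 : 1 ≤ Q := Nat.one_le_pow _ _ (by omega)
  by_cases hS : Nat.size m ≤ N
  · have h1 : N + Nat.size m + 10 ≤ N ^ 4 := by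
      have h2 : 2 * N ≤ N ^ 2 := by rw [pow_two]; exact Nat.mul_le_mul_right _ hN2
      have h3 : 2 * N ^ 2 ≤ N ^ 3 := by
        rw [pow_succ N 2, mul_comm]; exact Nat.mul_le_mul_left _ hN2
      have h4 : 2 * N ^ 3 ≤ N ^ 4 := by
        rw [pow_succ N 3, mul_comm]; exact Nat.mul_le_mul_left _ hN2
      omega
    have h2 : (N + Nat.size m + 10) ^ d ≤ N ^ (4 * d) := by
      rw [pow_mul]; exact Nat.pow_le_pow_left h1 d
    set A := N ^ (4 * d) with hA
    have h3 : A * A ≤ X := by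
      rw [hA, hX, hN, ← pow_add, ← pow_mul]
      have h4 : n * (4 * d + 4 * d) + 5 * n = (8 * d + 5) * n := by ring
      exact Nat.pow_le_pow_right (by omega) (by omega)
    have h4 : A * Q ≤ X := by
      rw [hA, hX, hN, hQ, ← pow_mul, ← pow_add]
      have h4 : n * (4 * d) + 4 * (d * n) + 5 * n = (8 * d + 5) * n := by ring
      exact Nat.pow_le_pow_right (by omega) (by omega)
    have h5 : m * m ≤ Y := by
      rcases Nat.eq_zero_or_pos m with h | h
      · simp [h]
      · rw [← pow_two]; exact Nat.pow_le_pow_right h (by omega)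
    have h6 : A * m ≤ A * A + m * m := by
      rcases le_total A m with h | h
      · exact (Nat.mul_le_mul_right m h).trans (Nat.le_add_left _ _)
      · exact (Nat.mul_le_mul_left A h).trans (Nat.le_add_right _ _)
    have h7 : A ≤ A * Q := Nat.le_mul_of_pos_right _ hQ1
    calc _ ≤ A * (m + 2 * Q + 1) := Nat.mul_le_mul_right _ h2
      _ = A * m + 2 * (A * Q) + A := by ring
      _ ≤ _ := by omega
  · rw [not_le] at hS
    have hm4 : 4 ≤ m := by
      have h1 : 2 ^ N ≤ m := Nat.lt_size.1 hS
      have h2 : 2 ^ 2 ≤ 2 ^ N := Nat.pow_le_pow_right (by norm_num) hN2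
      omega
    have hSm : Nat.size m ≤ m := Nat.size_le.2 Nat.lt_two_pow_self
    have hp2 : 4 * m ≤ m ^ 2 := by rw [pow_two]; exact Nat.mul_le_mul_right _ hm4
    have hp3 : 4 * m ^ 2 ≤ m ^ 3 := by
      rw [pow_succ m 2, mul_comm]; exact Nat.mul_le_mul_left _ hm4
    have hp4 : 4 * m ^ 3 ≤ m ^ 4 := by
      rw [pow_succ m 3, mul_comm]; exact Nat.mul_le_mul_left _ hm4
    have hp5 : 4 * m ^ 4 ≤ m ^ 5 := by
      rw [pow_succ m 4, mul_comm]; exact Nat.mul_le_mul_left _ hm4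
    have h1 : N + Nat.size m + 10 ≤ m ^ 4 := by omega
    have h2 : (N + Nat.size m + 10) ^ d ≤ m ^ (4 * d) := by
      rw [pow_mul]; exact Nat.pow_le_pow_left h1 d
    have h3 : Q ≤ m ^ 4 := by
      refine le_trans ?_ (pow_le_of_lt_size hq hS)
      rw [hQ, ← pow_mul]
      apply Nat.pow_le_pow_right (by omega)
      have h : k * k / 4 ≤ k * k := Nat.div_le_self _ _
      have h' : k * k ≤ n * n := Nat.mul_le_mul hk hk
      rw [mul_add, mul_one]
      omega
    have h4 : m + 2 * Q + 1 ≤ m ^ 5 := by omega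
    calc _ ≤ m ^ (4 * d) * m ^ 5 := Nat.mul_le_mul h2 h4
      _ = m ^ (4 * d + 5) := (pow_add _ _ _).symm
      _ ≤ Y := Nat.pow_le_pow_right (by omega) (by omega)
      _ ≤ _ := by omega

theorem total_le {L c K x : ℕ} (hL : 100 ≤ L) (hK : 1 ≤ K) (hx : x ≤ L) :
    2 ^ 3 * L ^ 2 + L + (x + 1 + (L ^ 6 + L ^ c * K)) ≤ L ^ (c + 7) * K := by
  have h1 : L ^ (c + 7) * K = L * (L ^ (c + 6) * K) := by
    rw [show c + 7 = (c + 6) + 1 from rfl, pow_succ', mul_assoc]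
  have h2 : L ^ 2 ≤ L ^ (c + 6) := pow_le_of_le hL (by omega)
  have h3 : L ≤ L ^ (c + 6) := le_pow_self hL (by omega)
  have h4 : L ^ 6 ≤ L ^ (c + 6) := pow_le_of_le hL (by omega)
  have h5 : L ^ c * K ≤ L ^ (c + 6) * K := Nat.mul_le_mul_right _ (pow_le_of_le hL (by omega))
  have h6 : L ^ (c + 6) ≤ L ^ (c + 6) * K := Nat.le_mul_of_pos_right _ hK
  have h7 : 100 * (L ^ (c + 6) * K) ≤ L * (L ^ (c + 6) * K) := Nat.mul_le_mul_right _ hL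
  rw [h1]
  omega

/-- The algorithm. -/
def transporterP : Prog :=
  .seq (.assign 4 (.load (.lit 0)))
    -- For `n = 0` there is only one vector, so the assumption `1 ≤ n` of `Tables` fails. The group
    -- and the spaces are trivial, and the answer is always the identity with no generators.
    (.branch (.reg 4) (.seq preludeP (solveS.compile [] 8)) (.seq (.emit (.lit 1)) (.emit (.lit 0))))

end Ram

/-! ### Correctness and running time of the whole algorithm -/

namespace SubspTrans

open Ram Matrix

theorem two_le_of_code {F : Type} [Field F] {q : ℕ} (code : F ≃ Fin q) : 2 ≤ q := by
  let _ : Fintype F := Fintype.ofEquiv _ code.symm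
  have h : Fintype.card F = q := by rw [Fintype.card_congr code, Fintype.card_fin]
  rw [← h]
  exact Fintype.one_lt_card

section
variable {F : Type} [Field F] {q k m : ℕ} (code : F ≃ Fin q)

/-- The run of the algorithm in dimension zero. -/
theorem halts_zero (gens : Fin m → GL (Fin 0) F) {V W : Submodule F (Fin 0 → F)}
    (bV : Module.Basis (Fin k) F V) (bW : Module.Basis (Fin k) F W) :
    ∃ output t, HaltsWith transporterP (encInput code gens bV bW) output t ∧
      DescribesCoset code (transporter (Subgroup.closure (Set.range gens)) V W) output ∧
      t ≤ 12 := by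
  set s := State.init (encInput code gens bV bW) with hs
  have h0 : s.mem 0 = 0 := rfl
  have r₁ := Run.assign s 4 (.load (.lit 0))
  have v : (Expr.load (.lit 0)).eval s = 0 := rfl
  rw [v] at r₁
  set s₁ : State := { s with reg := Function.update s.reg 4 0 }
  have r₂ : Run (.seq (.emit (.lit 1)) (.emit (.lit 0))) s₁ _ _ :=
    Run.seq ⟨_, le_rfl, .emit s₁ (.lit 1)⟩ ⟨_, le_rfl, .emit _ (.lit 0)⟩
  obtain ⟨t, ht, he⟩ := r₁.seq (r₂.branch_false (p := .seq preludeP (solveS.compile [] 8))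
    (e := .reg 4) rfl)
  refine ⟨[1, 0], t, ⟨_, he, rfl⟩, .inr ⟨1, 0, Fin.elim0, ?_, ?_⟩, ht.trans ?_⟩
  · ext g
    have hg : g = 1 := Subsingleton.elim _ _
    subst hg
    simp only [Set.mem_ofPred_eq]
    refine iff_of_true ⟨one_mem _, Subsingleton.elim _ _⟩ ⟨1, one_mem _, by simp⟩
  · simp [encMatrix, encGens]
  · have c0 : charge 0 = 1 := rfl
    have c1 : charge 1 = 2 := rfl
    simp [Expr.cost, Expr.eval, h0, c0, c1, s₁]

/-- The algorithm is correct in positive dimension. -/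
theorem exists_halts : ∃ d : ℕ, ∀ {F : Type} [Field F] {q n k m : ℕ} (code : F ≃ Fin q)
    (gens : Fin m → GL (Fin n) F) {V W : Submodule F (Fin n → F)}
    (bV : Module.Basis (Fin k) F V) (bW : Module.Basis (Fin k) F W), 1 ≤ n →
    ∃ output t, HaltsWith transporterP (encInput code gens bV bW) output t ∧
      DescribesCoset code (transporter (Subgroup.closure (Set.range gens)) V W) output ∧
      t ≤ (q ^ n + Nat.size m + 10) ^ d * (m + 2 * q ^ (k * k / 4 + k) + 1) := by
  obtain ⟨c, hc, hrun⟩ := solveS.compile_spec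
  -- The bound `L` is the fourth power of the base in the statement, and `total_le` gives the
  -- exponent `c + 7` over `L`.
  refine ⟨4 * (c + 7), ?_⟩
  intro F _ q n k m code gens V W bV bW hn
  have hq := two_le_of_code code
  have : NeZero q := ⟨by omega⟩
  have hk : k ≤ n := by
    have h := Submodule.finrank_le V
    rw [Module.finrank_eq_card_basis bV] at h
    simpa using h
  set Z := q ^ n + Nat.size m + 10 with hZ
  set L := Z ^ 4 with hL
  have hnN : n < q ^ n := Nat.lt_pow_self hq
  have z10 : 10 ≤ Z := by omega
  have hZ2 : Z * Z ≤ L := by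
    rw [hL, ← pow_two]; exact Nat.pow_le_pow_right (by omega) (by norm_num)
  have hL100 : 100 ≤ L := (Nat.mul_le_mul z10 z10).trans hZ2
  have hZL : Z ≤ L := (Nat.le_mul_of_pos_left Z (by omega)).trans hZ2
  have hG := charge_params_le (m := m) hq hn hk
  rw [← hZ, ← hL] at hG
  have hNZ : q ^ n + 2 ≤ Z := by omega
  clear_value L Z
  set s := State.init (encInput code gens bV bW) with hs
  have small : Small s L := by
    constructor
    · intro r
      show charge 0 ≤ L
      have : charge 0 = 1 := rfl
      omega
    · intro a
      have h : ∀ v, v = n ∨ v = k ∨ v = m ∨ v ≤ q → charge v ≤ L := by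
        rintro v (rfl | rfl | rfl | h)
        · exact hG .n
        · exact hG .k
        · exact hG .m
        · exact (charge_mono h).trans (hG .q)
      show charge ((encInput code gens bV bW).getD a 0) ≤ L
      rcases lt_or_ge a (encInput code gens bV bW).length with ha | ha
      · rw [List.getD_eq_getElem _ _ ha]
        exact h _ (encInput_le code gens bV bW (List.getElem_mem ha))
      · rw [List.getD_eq_default _ _ ha]
        exact h 0 (.inr (.inr (.inr (Nat.zero_le _))))
  have v : (Expr.load (.lit 0)).eval s = n := rfl
  obtain ⟨s₁, r₁, e₁, k₁⟩ := assign_spec small 4 (.load (.lit 0)) (by rw [v]; exact hG .n)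
  have h4 : s₁.reg 4 = n := e₁.val
  have hkk : k * k / 4 + k + 1 ≤ L := by
    have h : k * k / 4 ≤ k * k := Nat.div_le_self _ _
    have h' : (k + 1) * (k + 1) ≤ Z * Z := Nat.mul_le_mul (by omega) (by omega)
    rw [add_mul, mul_add, one_mul, mul_one] at h'
    omega
  obtain ⟨s₂, r₂, hR, m₂, o₂⟩ := preludeP_spec (q := q) (n := n) (k := k) (m := m) k₁ hL100 h4
    (by rw [e₁.mem]; rfl) (by rw [e₁.mem]; rfl) (by rw [e₁.mem]; rfl) (by omega) hG (by omega)
    (by omega) hkk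
  obtain ⟨s₃, r₃, a₃⟩ := hrun _ _ _ _ _ hR
  -- The long loops are not nested, so the bound for the number of subspaces enters only to the
  -- first power; a second power would spoil the exponent `k ^ 2 / 4`.
  have hh : solveS.height = 1 := rfl
  rw [hh, pow_one] at r₃
  obtain ⟨t, ht, he⟩ := r₁.seq (Run.branch_true (e := .reg 4)
    (p' := .seq (.emit (.lit 1)) (.emit (.lit 0))) (by show s₁.reg 4 ≠ 0; omega) (r₂.seq r₃))
  refine ⟨s₃.out, t, ⟨s₃, he, rfl⟩, ?_, ht.trans ?_⟩
  · rw [a₃.out, m₂, e₁.mem, o₂, e₁.out]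
    have h := solveS_spec (input_init code gens bV bW hq hn hk) (linearIndependent_basis bV)
      (linearIndependent_basis bW) (Nat.le_add_right _ _) (Nat.le_add_left _ _) (by
        intro a ha
        show (encInput code gens bV bW).getD a 0 = 0
        apply List.getD_eq_default
        rw [length_encInput]
        exact ha)
    dsimp only at h
    rw [flag_basis, flag_basis] at h
    exact h
  · have z : (Expr.load (.lit 0)).size = 2 := rfl
    rw [z]
    have hb : (Expr.reg 4).cost s₁ ≤ L := k₁.reg 4
    show 2 ^ 3 * L ^ 2 + L + ((Expr.reg 4).cost s₁ + 1 + (L ^ 6 + L ^ c * (_ + 1))) ≤ _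
    rw [pow_mul, ← hL]
    exact total_le hL100 (Nat.succ_pos _) hb

end

end SubspTrans

theorem theorem7p2 :
    ∃ (P : Ram.Prog) (C : ℕ),
      ∀ (F : Type) [Field F] (q n k m : ℕ) (code : F ≃ Fin q)
        (gens : Fin m → Matrix.GeneralLinearGroup (Fin n) F)
        (V W : Submodule F (Fin n → F))
        (bV : Module.Basis (Fin k) F V) (bW : Module.Basis (Fin k) F W),
        ∃ (output : List ℕ) (t : ℕ),
          Ram.HaltsWith P (SubspTrans.encInput code gens bV bW) output t ∧
          SubspTrans.DescribesCoset code
            (SubspTrans.transporter (Subgroup.closure (Set.range gens)) V W) output ∧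
          (t : ℝ) ≤ C * ((q : ℝ) ^ ((k : ℝ) ^ 2 / 4 + C * (n : ℝ)) + (m : ℝ) ^ C) := by
  obtain ⟨d, hd⟩ := SubspTrans.exists_halts
  -- Large enough for `8 * d + 5` in `time_bound` and, as a factor, for the 12 time units in
  -- dimension zero.
  refine ⟨Ram.transporterP, 8 * d + 12, ?_⟩
  intro F _ q n k m code gens V W bV bW
  have hq := SubspTrans.two_le_of_code code
  have hq1 : (1 : ℝ) ≤ q := by exact_mod_cast (by omega : 1 ≤ q)
  have hC : (12 : ℝ) ≤ ((8 * d + 12 : ℕ) : ℝ) := by exact_mod_cast (by omega : 12 ≤ 8 * d + 12)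
  set X : ℝ := (q : ℝ) ^ ((k : ℝ) ^ 2 / 4 + ((8 * d + 12 : ℕ) : ℝ) * (n : ℝ)) with hX
  have hX1 : 1 ≤ X := Real.one_le_rpow hq1 (by positivity)
  have hY : (0 : ℝ) ≤ (m : ℝ) ^ (8 * d + 12) := by positivity
  have hXY := mul_le_mul_of_nonneg_right hC (by linarith : 0 ≤ X + (m : ℝ) ^ (8 * d + 12))
  rcases Nat.eq_zero_or_pos n with rfl | hn
  · obtain ⟨output, t, h1, h2, h3⟩ := SubspTrans.halts_zero code gens bV bW
    refine ⟨output, t, h1, h2, ?_⟩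
    have h4 : (t : ℝ) ≤ 12 := by exact_mod_cast h3
    linarith
  · obtain ⟨output, t, h1, h2, h3⟩ := hd code gens bV bW hn
    refine ⟨output, t, h1, h2, ?_⟩
    have hk : k ≤ n := by
      have h := Submodule.finrank_le V
      rw [Module.finrank_eq_card_basis bV] at h
      simpa using h
    have h4 : (t : ℝ) ≤ 4 * ((q : ℝ) ^ (k * k / 4 + (8 * d + 5) * n) + (m : ℝ) ^ (8 * d + 5)) := by
      exact_mod_cast h3.trans (Ram.time_bound d hq hn hk)
    have h5 : (q : ℝ) ^ (k * k / 4 + (8 * d + 5) * n) ≤ X := by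
      rw [hX, ← Real.rpow_natCast]
      apply Real.rpow_le_rpow_of_exponent_le hq1
      -- The program uses the integral quotient, which is at most the real exponent of the theorem.
      have h6 : ((k * k / 4 : ℕ) : ℝ) ≤ (k : ℝ) ^ 2 / 4 := by
        have h := Nat.cast_div_le (α := ℝ) (m := k * k) (n := 4)
        push_cast at h
        rwa [pow_two]
      push_cast at h6 ⊢
      have hn0 : (0 : ℝ) ≤ n := Nat.cast_nonneg n
      linarith
    have h7 : (m : ℝ) ^ (8 * d + 5) ≤ (m : ℝ) ^ (8 * d + 12) := by
      rcases Nat.eq_zero_or_pos m with h | h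
      · simp [h]
      · exact pow_le_pow_right₀ (by exact_mod_cast h) (by omega)
    linarith
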